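/- **Theorem (Relative Schenzel Formula).** Let $\Bbbk$ be an infinite field. A simplicial complex is a family of subsets of $[n]=\{1,\dots,n\}$ closed under taking subsets (it may be empty, and singletons need not be faces). Let $\Psi=(\Delta,\Gamma)$ be a relative simplicial complex, that is, a pair of simplicial complexes on $[n]$ with $\Gamma\subsetneq\Delta$. Its faces are the elements of $\Delta\setminus\Gamma$; let $d-1=\max\{|\sigma|-1:\sigma\in\Delta\setminus\Gamma\}$ be its dimension, $f_{i-1}$ the number of its faces with $i$ elements, and define $h_k(\Delta,\Gamma)$, $k\ge 0$, by $$\sum_{k} h_k(\Delta,\Gamma)\,t^k=\sum_{i=0}^d f_{i-1}\,t^i(1-t)^{d-i}.$$ Let $R=\Bbbk[x_1,\dots,x_n]$, $\mathfrak m=\langle x_1,\dots,x_n\rangle$, $I_\Delta=\langle \prod_{i\in\tau}x_i : \tau\subseteq[n],\ \tau\notin\Delta\rangle$, $\Bbbk[\Delta]=R/I_\Delta$, and let $M=\ker(\Bbbk[\Delta]\to\Bbbk[\Gamma])$ be the face module, a graded $R$-module by polynomial degree. For a graded $R$-module $N$, a homogeneous system of parameters for $N$ is a sequence $\Theta=(\theta_1,\dots,\theta_\ell)$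 of homogeneous elements of $R$ with $\ell=\dim N$ and $\dim N/\Theta N=\dim N-\ell$; it is a linear system of parameters if moreover all $\theta_i$ are of degree one. It is a weak $N$-sequence if $\Theta N\ne N$ and $(\theta_1,\dots,\theta_{i-1})N:\theta_i=(\theta_1,\dots,\theta_{i-1})N:\mathfrak m$ for all $1\le i\le\ell$ (as submodules of $N$). A finitely generated graded $R$-module $N$ is Buchsbaum if every homogeneous system of parameters for $N$ is a weak $N$-sequence. Write $\operatorname{Hilb}(N,t)=\sum_j \dim_\Bbbk N_j\,t^j$, and let $\tilde\beta_{j}(\Delta,\Gamma)=\dim_\Bbbk\tilde H_j(\Delta,\Gamma;\Bbbk)$ be the Betti numbers of the relative simplicial homology of $(\Delta,\Gamma)$, computed from the augmented chain complexes (the empty face sits in degree $-1$). Suppose that $M$ is Buchsbaum, and let $\Theta$ be a linear system of parameters for $M$. Then $$(1-t)^d\operatorname{Hilb}(M,t)=\operatorname{Hilb}(M/\Theta M,t)+\sum_{j=1}^{d}\binom dj\Bigl(\sum_{i=0}^{j-1}(-1)^{j-i}\tilde\beta_{i-1}(\Delta,\Gamma)\Bigr)t^j .$$ Equivalently, for every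 integer $k\ge 0$, $$h_k(\Delta,\Gamma)=\dim_\Bbbk\,(M/\Theta M)_k+\binom dk\sum_{i=0}^{k-1}(-1)^{k-i}\,\tilde\beta_{i-1}(\Delta,\Gamma).$$ -/

import Mathlib

noncomputable section

namespace RelativeSR

open MvPolynomial

/-- A (finite, abstract) simplicial complex on the vertex set `[n]`: a family of subsets of `[n]`
closed under taking subsets. The void complex is `⊥`, and it differs from `{∅}`. It is not
required that every singleton be a face. -/
abbrev SimplicialComplex (n : ℕ) : Type := LowerSet (Finset (Fin n))

/-- A relative simplicial complex `(Δ, Γ)`: a pair of simplicial complexes on `[n]` such that `Γ`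
is a proper subcomplex of `Δ`. -/
structure RelativeComplex (n : ℕ) where
  Δ : SimplicialComplex n
  Γ : SimplicialComplex n
  proper : Γ < Δ

/-! ### Modules over the polynomial ring -/

section Modules

variable {𝕜 : Type*} [Field 𝕜] {n : ℕ}
variable (M : Type*) [AddCommGroup M] [Module (MvPolynomial (Fin n) 𝕜) M]

/-- The irrelevant ideal `⟨x₁, …, xₙ⟩` of `𝕜[x₁, …, xₙ]`. -/
def irrelevantIdeal (𝕜 : Type*) [Field 𝕜] (n : ℕ) : Ideal (MvPolynomial (Fin n) 𝕜) :=
  Ideal.span (Set.range X)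

/-- The submodule `Θ M = ∑ᵢ θᵢ M`. -/
def paramSubmodule {ℓ : ℕ} (Θ : Fin ℓ → MvPolynomial (Fin n) 𝕜) :
    Submodule (MvPolynomial (Fin n) 𝕜) M :=
  Ideal.span (Set.range Θ) • ⊤

/-- The submodule generated by the multiples of the parameters strictly before the `i`-th one:
`θ₁ M + ⋯ + θᵢ₋₁ M`. -/
def initialSubmodule {ℓ : ℕ} (Θ : Fin ℓ → MvPolynomial (Fin n) 𝕜) (i : Fin ℓ) :
    Submodule (MvPolynomial (Fin n) 𝕜) M :=
  Ideal.span (Θ '' Set.Iio i) • ⊤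

variable {M} in
/-- The colon submodule `N : S = {m ∈ M | r m ∈ N for all r ∈ S}` of `M`, for a set `S` of ring
elements. -/
def colonSubmodule (N : Submodule (MvPolynomial (Fin n) 𝕜) M)
    (S : Set (MvPolynomial (Fin n) 𝕜)) : Submodule (MvPolynomial (Fin n) 𝕜) M where
  carrier := {m | ∀ r ∈ S, r • m ∈ N}
  add_mem' ha hb r hr := by
    rw [smul_add]
    exact N.add_mem (ha r hr) (hb r hr)
  zero_mem' r _ := by
    rw [smul_zero]
    exact N.zero_mem
  smul_mem' c m hm r hr := by
    rw [smul_comm]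
    exact N.smul_mem c (hm r hr)

/-- `Θ = (θ₁, …, θ_ℓ)` is a partial homogeneous system of parameters for `M`: the `θᵢ` are
homogeneous and `dim M / Θ M = dim M - ℓ`. -/
def IsPartialHSOP {ℓ : ℕ} (Θ : Fin ℓ → MvPolynomial (Fin n) 𝕜) : Prop :=
  (∀ i, ∃ m : ℕ, (Θ i).IsHomogeneous m) ∧
    Module.supportDim (MvPolynomial (Fin n) 𝕜) (M ⧸ paramSubmodule M Θ) + (ℓ : WithBot ℕ∞) =
      Module.supportDim (MvPolynomial (Fin n) 𝕜) M

/-- A homogeneous system of parameters: a partial one, of length `dim M`. -/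
def IsHSOP {ℓ : ℕ} (Θ : Fin ℓ → MvPolynomial (Fin n) 𝕜) : Prop :=
  IsPartialHSOP M Θ ∧ (ℓ : WithBot ℕ∞) = Module.supportDim (MvPolynomial (Fin n) 𝕜) M

/-- A linear system of parameters: a homogeneous system of parameters of linear forms. -/
def IsLSOP {ℓ : ℕ} (Θ : Fin ℓ → MvPolynomial (Fin n) 𝕜) : Prop :=
  IsHSOP M Θ ∧ ∀ i, (Θ i).IsHomogeneous 1

/-- `Θ` is a weak `M`-sequence: `Θ M ≠ M` and
`(θ₁, …, θᵢ₋₁) M : θᵢ = (θ₁, …, θᵢ₋₁) M : 𝔪` for every `i`, with `𝔪` the irrelevant ideal. -/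
def IsWeakSequence {ℓ : ℕ} (Θ : Fin ℓ → MvPolynomial (Fin n) 𝕜) : Prop :=
  paramSubmodule M Θ ≠ ⊤ ∧
    ∀ i, colonSubmodule (initialSubmodule M Θ i) {Θ i} =
      colonSubmodule (initialSubmodule M Θ i) (irrelevantIdeal 𝕜 n)

/-- A (finitely generated graded) module `M` is Buchsbaum if every homogeneous system of
parameters for `M` is a weak `M`-sequence. -/
def IsBuchsbaumModule : Prop :=
  ∀ (ℓ : ℕ) (Θ : Fin ℓ → MvPolynomial (Fin n) 𝕜), IsHSOP M Θ → IsWeakSequence M Θ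

end Modules

/-- The Hilbert series `∑ⱼ (dim Mⱼ) tʲ` of a family `(Mⱼ)` of subspaces of a vector space, namely
of the homogeneous components of a graded module that lives in degrees `j ≥ 0`. -/
def hilbertSeries {𝕜 : Type*} [Field 𝕜] {V : Type*} [AddCommGroup V] [Module 𝕜 V]
    (comp : ℕ → Submodule 𝕜 V) : PowerSeries ℤ :=
  PowerSeries.mk fun j => (Module.finrank 𝕜 (comp j) : ℤ)

/-! ### Face rings and face modules -/

section FaceModule

variable (𝕜 : Type*) [Field 𝕜] {n : ℕ}

/-- The face ideal `⟨x^τ : τ ∉ Δ⟩`. -/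
def faceIdeal (Δ : SimplicialComplex n) : Ideal (MvPolynomial (Fin n) 𝕜) :=
  Ideal.span {p | ∃ τ : Finset (Fin n), τ ∉ Δ ∧ p = ∏ i ∈ τ, X i}

/-- The face ring (Stanley--Reisner ring) `𝕜[Δ]`. -/
abbrev faceRing (Δ : SimplicialComplex n) : Type _ :=
  MvPolynomial (Fin n) 𝕜 ⧸ faceIdeal 𝕜 Δ

theorem faceIdeal_anti {Γ Δ : SimplicialComplex n} (h : Γ ≤ Δ) :
    faceIdeal 𝕜 Δ ≤ faceIdeal 𝕜 Γ := by
  refine Ideal.span_mono ?_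
  rintro p ⟨τ, hτ, rfl⟩
  exact ⟨τ, fun hh => hτ (h hh), rfl⟩

namespace RelativeComplex

variable (Ψ : RelativeComplex n)

/-- The restriction map `𝕜[Δ] → 𝕜[Γ]`. -/
def restriction : faceRing 𝕜 Ψ.Δ →ₐ[MvPolynomial (Fin n) 𝕜] faceRing 𝕜 Ψ.Γ :=
  Ideal.Quotient.factorₐ (MvPolynomial (Fin n) 𝕜) (faceIdeal_anti 𝕜 Ψ.proper.le)

/-- The face module `M[Δ, Γ] = ker (𝕜[Δ] → 𝕜[Γ])`, as a module over `𝕜[x₁, …, xₙ]`. -/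
def faceModule : Submodule (MvPolynomial (Fin n) 𝕜) (faceRing 𝕜 Ψ.Δ) :=
  LinearMap.ker (Ψ.restriction 𝕜).toLinearMap

/-- The component of degree `j` of the face module in the coarse grading: the elements of
`M[Δ, Γ] ⊆ 𝕜[Δ]` that are represented by a homogeneous polynomial of degree `j`. -/
def component (j : ℕ) : Submodule 𝕜 (Ψ.faceModule 𝕜) :=
  ((homogeneousSubmodule (Fin n) 𝕜 j).map
      (Ideal.Quotient.mkₐ 𝕜 (faceIdeal 𝕜 Ψ.Δ)).toLinearMap).comap
    ((Ψ.faceModule 𝕜).subtype.restrictScalars 𝕜)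

variable {𝕜} in
/-- The component of degree `j` of `M / Θ M`, for `M = M[Δ, Γ]`: the image of `Mⱼ`. -/
def quotientComponent {ℓ : ℕ} (Θ : Fin ℓ → MvPolynomial (Fin n) 𝕜) (j : ℕ) :
    Submodule 𝕜 (Ψ.faceModule 𝕜 ⧸ paramSubmodule (Ψ.faceModule 𝕜) Θ) :=
  (Ψ.component 𝕜 j).map ((paramSubmodule (Ψ.faceModule 𝕜) Θ).mkQ.restrictScalars 𝕜)

/-- A relative complex is Buchsbaum (over `𝕜`) if its face module is Buchsbaum. -/
def IsBuchsbaum : Prop := IsBuchsbaumModule (𝕜 := 𝕜) (n := n) (Ψ.faceModule 𝕜)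

end RelativeComplex

end FaceModule

/-! ### Face numbers and homology -/

namespace RelativeComplex

variable {n : ℕ} (Ψ : RelativeComplex n)

/-- `σ` is a face of `(Δ, Γ)`, that is, `σ ∈ Δ \ Γ`. -/
def IsFace (σ : Finset (Fin n)) : Prop := σ ∈ Ψ.Δ ∧ σ ∉ Ψ.Γ

open Classical in
/-- The finite set of faces `Δ \ Γ`; it is never empty. -/
def faces : Finset (Finset (Fin n)) := Finset.univ.filter Ψ.IsFace

/-- The largest number of elements of a face, that is, `dim (Δ, Γ) + 1`. -/
def maxCard : ℕ := Ψ.faces.sup Finset.card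

/-- The dimension of `(Δ, Γ)`: the maximum of `dim σ = |σ| - 1` over all faces. -/
def dim : ℤ := (Ψ.maxCard : ℤ) - 1

/-- The number of faces with `i` elements, usually written `f_{i-1}`. -/
def numFaces (i : ℕ) : ℕ := (Ψ.faces.filter fun σ => σ.card = i).card

/-- The polynomial `h₀ + h₁ t + ⋯ + h_d t^d = ∑ᵢ f_{i-1} tⁱ (1 - t)^{d - i}` for `(Δ, Γ)` of
dimension `d - 1`. -/
def hPolynomial : Polynomial ℤ :=
  ∑ i ∈ Finset.range (Ψ.maxCard + 1),
    Polynomial.C (Ψ.numFaces i : ℤ) * Polynomial.X ^ i *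
      (1 - Polynomial.X) ^ (Ψ.maxCard - i)

/-- The entry `h_k` of the `h`-vector (which is zero for `k > d`). -/
def hNumber (k : ℕ) : ℤ := Ψ.hPolynomial.coeff k

variable (𝕜 : Type*) [Field 𝕜]

/-- The space of relative simplicial chains of `(Δ, Γ)`, in all degrees together, with basis the
finitely many faces of `(Δ, Γ)`. The empty set, if it is a face, sits in degree `-1`. -/
abbrev Chains : Type _ := {σ : Finset (Fin n) // Ψ.IsFace σ} → 𝕜

open Classical in
/-- The boundary map: with `σ = {v₀ < ⋯ < v_j}`, the basis element of `σ` goes to the sum of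
`(-1)^m` times that of `σ \ {v_m}`, over those `m` for which `σ \ {v_m}` is not in `Γ`. -/
def boundary : Ψ.Chains 𝕜 →ₗ[𝕜] Ψ.Chains 𝕜 :=
  Fintype.linearCombination 𝕜 fun σ : {σ : Finset (Fin n) // Ψ.IsFace σ} =>
    ∑ v ∈ σ.1,
      if h : Ψ.IsFace (σ.1.erase v) then
        Pi.single ⟨σ.1.erase v, h⟩ ((-1 : 𝕜) ^ (σ.1.filter (· < v)).card)
      else 0

/-- The chains of degree `j`: those supported on the faces of dimension `j = |σ| - 1`. -/
def chainsOfDegree (j : ℤ) : Submodule 𝕜 (Ψ.Chains 𝕜) where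
  carrier := {c | ∀ σ, (σ.1.card : ℤ) - 1 ≠ j → c σ = 0}
  add_mem' ha hb σ h := by simp [ha σ h, hb σ h]
  zero_mem' _ _ := rfl
  smul_mem' r c hc σ h := by simp [hc σ h]

/-- The cycles of degree `j`. -/
def cycles (j : ℤ) : Submodule 𝕜 (Ψ.Chains 𝕜) :=
  Ψ.chainsOfDegree 𝕜 j ⊓ LinearMap.ker (Ψ.boundary 𝕜)

/-- The boundaries of degree `j`. -/
def boundaries (j : ℤ) : Submodule 𝕜 (Ψ.Chains 𝕜) :=
  (Ψ.chainsOfDegree 𝕜 (j + 1)).map (Ψ.boundary 𝕜)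

/-- The reduced relative simplicial homology of `(Δ, Γ)` in degree `j`, with coefficients in
`𝕜`: cycles modulo boundaries. -/
abbrev Homology (j : ℤ) : Type _ :=
  Ψ.cycles 𝕜 j ⧸ (Ψ.boundaries 𝕜 j).submoduleOf (Ψ.cycles 𝕜 j)

/-- The reduced Betti number of `(Δ, Γ)` in degree `j`. -/
def rBetti (j : ℤ) : ℕ := Module.finrank 𝕜 (Ψ.Homology 𝕜 j)

variable {𝕜} in
/-- The algebraic component of `h_k` with respect to `Θ`: the dimension of `(M / Θ M)_k`, for
`M = M[Δ, Γ]`. -/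
def hAlg {ℓ : ℕ} (Θ : Fin ℓ → MvPolynomial (Fin n) 𝕜) (k : ℕ) : ℤ :=
  (Module.finrank 𝕜 (Ψ.quotientComponent Θ k) : ℤ)

end RelativeComplex

end RelativeSR

end

/-! Write `d` for the dimension of `M`, which is also the length of `Θ`. Form the double complex
(Čech complex of `M` on the variables) ⊗ (Koszul complex of `Θ`) and keep one total degree `e`:
position `(p, q)` holds, for all `|F| = p` and `|J| = q`, the part of coarse degree `e - q` of `M`
localized at `x_F`. Column `0` is the Koszul complex of `Θ` on `M`. Its Euler characteristic is the
coefficient of `t^e` in `(1-t)^d Hilb(M,t)`, and its homology at the bottom is `(M/ΘM)_e`. What has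
to be found is its homology at `q > 0`.

The columns `p > 0` are exact at every `q > 0`. For a weak sequence the irrelevant ideal kills every
obstruction to regularity, and on a localization at a nonempty `F` some variable is invertible, so
`Θ` becomes regular there (`linOp_regular`, `exists_koszulDown_eq`).

The rows compute local cohomology. Powers of parameters are again parameters, so the Buchsbaum
property makes the variables annihilate it in cohomological degrees below `d`
(`IsBuchsbaumModule.hasWeakParameters`, `HasWeakParameters.smul_powTrans_sub_mem`,
`exists_cech_eq`). The Čech complex is graded by integer vectors, and `x_l` maps the strand of
degree `b` isomorphically onto that of degree `b + e_l` unless `b_l` is `0` or `-1`. Hence in those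
cohomological degrees only fine degree zero survives (`exists_fine_eq`), and the strand there is the
relative simplicial cochain complex. Fine degree zero occurs only in row `q = e`, once for each `J`
with `e` elements; all other rows are exact in columns `p < d`.

A chase in the style of the salamander lemma (`relDim_vertical_eq_horizontal`) now identifies the
homology of column `0` at `q = e - i > 0` with the cohomology of row `e` at `p = i`, which is
`binom(d, e)` copies of the relative cohomology in degree `i - 1`. Its sign in the Euler
characteristic is `(-1)^(e-i)`, which gives the formula (`sum_choose_mul_finrank`). It remains to
pass from cohomology to homology (`rBetti_eq_cohDim`), to see that `dim M` is the largest size of a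
face (`supportDim_faceModule`), and to recognize the `h`-polynomial as the numerator of the Hilbert
series (`one_sub_X_pow_mul_hilbertSeries`). -/

noncomputable section

namespace RelativeSR

open MvPolynomial

/-! ### Signs and Koszul-type operators -/

section Signs

variable {ι : Type*} [LinearOrder ι]

/-- The sign `(-1)^m`, where `m` is the number of elements of `F` below `i`. -/
def sgn (F : Finset ι) (i : ι) : ℤ := (-1) ^ (F.filter (· < i)).card

theorem sgn_mul_self (F : Finset ι) (i : ι) : sgn F i * sgn F i = 1 := by
  unfold sgn
  rw [← mul_pow]
  simp

theorem sgn_erase_of_le {F : Finset ι} {i j : ι} (h : i ≤ j) : sgn (F.erase j) i = sgn F i := by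
  unfold sgn
  rw [Finset.filter_erase, Finset.erase_eq_of_notMem]
  simp [h]

theorem sgn_erase_of_lt {F : Finset ι} {i j : ι} (hj : j ∈ F) (h : j < i) :
    sgn (F.erase j) i = -sgn F i := by
  unfold sgn
  have hm : j ∈ F.filter (· < i) := by simp [hj, h]
  rw [Finset.filter_erase, ← Finset.card_erase_add_one hm, pow_succ]
  simp

theorem sgn_insert_of_le {F : Finset ι} {i j : ι} (h : i ≤ j) : sgn (insert j F) i = sgn F i := by
  rw [← sgn_erase_of_le (F := insert j F) h, ← sgn_erase_of_le (F := F) h]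
  simp

theorem sgn_insert_of_lt {F : Finset ι} {i j : ι} (hj : j ∉ F) (h : j < i) :
    sgn (insert j F) i = -sgn F i := by
  have := sgn_erase_of_lt (Finset.mem_insert_self j F) h
  rw [Finset.erase_insert hj] at this
  rw [this, neg_neg]

theorem sgn_mul_sgn_erase {F : Finset ι} {i j : ι} (hi : i ∈ F) (hj : j ∈ F) (h : i ≠ j) :
    sgn F i * sgn (F.erase i) j = -(sgn F j * sgn (F.erase j) i) := by
  rcases lt_or_gt_of_ne h with h | h
  · rw [sgn_erase_of_lt hi h, sgn_erase_of_le h.le]; ring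
  · rw [sgn_erase_of_lt hj h, sgn_erase_of_le h.le]; ring

theorem sgn_mul_sgn_insert {F : Finset ι} {i j : ι} (hi : i ∉ F) (hj : j ∉ F) (h : i ≠ j) :
    sgn F i * sgn (insert i F) j = -(sgn F j * sgn (insert j F) i) := by
  rcases lt_or_gt_of_ne h with h | h
  · rw [sgn_insert_of_lt hi h, sgn_insert_of_le h.le]; ring
  · rw [sgn_insert_of_lt hj h, sgn_insert_of_le h.le]; ring

theorem sgn_mul_sgn_erase_insert {F : Finset ι} {i j : ι} (hi : i ∈ F) (hj : j ∉ F) :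
    sgn F i * sgn (F.erase i) j = -(sgn F j * sgn (insert j F) i) := by
  have h : i ≠ j := fun h => hj (h ▸ hi)
  rcases lt_or_gt_of_ne h with h | h
  · rw [sgn_erase_of_lt hi h, sgn_insert_of_le h.le]; ring
  · rw [sgn_insert_of_lt hj h, sgn_erase_of_le h.le]; ring

/-- Swapping the indices pairs off the terms. Vanishing on the diagonal is a separate hypothesis
because antisymmetry does not yield it when there is 2-torsion. -/
theorem sum_sum_eq_zero_of_antisymm {A κ : Type*} [AddCommGroup A] (s : Finset κ) (f : κ → κ → A)
    (h : ∀ i j, f i j = -f j i) (h0 : ∀ i, f i i = 0) : ∑ i ∈ s, ∑ j ∈ s, f i j = 0 := by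
  rw [← Finset.sum_product']
  refine Finset.sum_involution (fun a _ => a.swap) ?_ ?_ ?_ ?_
  · rintro ⟨i, j⟩ _
    simp [h i j]
  · rintro ⟨i, j⟩ _ hne he
    apply hne
    simp only [Prod.swap_prod_mk, Prod.mk.injEq] at he
    simp only [he.1, h0]
  · rintro ⟨i, j⟩ hij
    simpa [and_comm] using hij
  · rintro ⟨i, j⟩ _
    rfl

variable {S : Type*} [CommRing S] {W : Type*} [AddCommGroup W] [Module S W]

/-- The Koszul-type cochain differential of a family of endomorphisms. -/
def koszulUp (T : ι → W →ₗ[S] W) : (Finset ι → W) →ₗ[S] (Finset ι → W) where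
  toFun m F := ∑ i ∈ F, sgn F i • T i (m (F.erase i))
  map_add' a b := by
    ext F
    simp [Finset.sum_add_distrib]
  map_smul' c a := by
    ext F
    simp [Finset.smul_sum, smul_comm c]

theorem koszulUp_apply (T : ι → W →ₗ[S] W) (m : Finset ι → W) (F : Finset ι) :
    koszulUp T m F = ∑ i ∈ F, sgn F i • T i (m (F.erase i)) := rfl

theorem koszulUp_koszulUp (T : ι → W →ₗ[S] W) (hT : ∀ i j w, T i (T j w) = T j (T i w))
    (m : Finset ι → W) : koszulUp T (koszulUp T m) = 0 := by
  ext F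
  simp only [koszulUp_apply, map_sum, map_zsmul, Finset.smul_sum, Pi.zero_apply, smul_smul]
  -- The inner sums run over `F.erase i`; extension by zero to all of `F × F` makes the double sum
  -- antisymmetric.
  rw [← sum_sum_eq_zero_of_antisymm F fun i j => if i ∈ F ∧ j ∈ F ∧ i ≠ j then
      (sgn F i * sgn (F.erase i) j) • T i (T j (m ((F.erase i).erase j))) else 0]
  · refine Finset.sum_congr rfl fun i hi => ?_
    rw [← Finset.sum_subset (Finset.erase_subset i F)]
    · refine Finset.sum_congr rfl fun j hj => ?_
      rw [if_pos ⟨hi, Finset.mem_of_mem_erase hj, (Finset.ne_of_mem_erase hj).symm⟩]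
    · intro j hj hj'
      rw [if_neg]
      rintro ⟨_, _, h⟩
      exact hj' (Finset.mem_erase.2 ⟨h.symm, hj⟩)
  · intro i j
    by_cases h : i ∈ F ∧ j ∈ F ∧ i ≠ j
    · rw [if_pos h, if_pos ⟨h.2.1, h.1, h.2.2.symm⟩, sgn_mul_sgn_erase h.1 h.2.1 h.2.2, neg_smul,
        hT i j, Finset.erase_right_comm]
    · rw [if_neg h, if_neg, neg_zero]
      rintro ⟨h1, h2, h3⟩
      exact h ⟨h2, h1, h3.symm⟩
  · simp

/-- Contraction against the `j`-th basis vector. -/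
def contract (j : ι) : (Finset ι → W) →ₗ[S] (Finset ι → W) where
  toFun m F := if j ∈ F then 0 else sgn F j • m (insert j F)
  map_add' a b := by
    ext F
    by_cases h : j ∈ F <;> simp [h]
  map_smul' c a := by
    ext F
    by_cases h : j ∈ F <;> simp [h, smul_comm c]

theorem contract_apply (j : ι) (m : Finset ι → W) (F : Finset ι) :
    contract (S := S) j m F = if j ∈ F then 0 else sgn F j • m (insert j F) := rfl

/-- A Cartan formula: contraction with the `j`-th basis vector is a null-homotopy of `T j`. The
terms with `i ≠ j` cancel by sign alone, so the operators need not commute. -/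
theorem koszulUp_contract_add (T : ι → W →ₗ[S] W) (j : ι) (m : Finset ι → W) (F : Finset ι) :
    koszulUp T (contract (S := S) j m) F + contract (S := S) j (koszulUp T m) F = T j (m F) := by
  by_cases hj : j ∈ F
  · rw [contract_apply, if_pos hj, add_zero, koszulUp_apply, Finset.sum_eq_single j]
    · rw [contract_apply, if_neg (Finset.notMem_erase j F), Finset.insert_erase hj,
        map_zsmul, smul_smul, sgn_erase_of_le le_rfl, sgn_mul_self, one_smul]
    · intro i hi hij
      rw [contract_apply, if_pos (Finset.mem_erase.2 ⟨hij.symm, hj⟩)]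
      simp
    · exact fun h => (h hj).elim
  · rw [contract_apply, if_neg hj, koszulUp_apply, koszulUp_apply, Finset.sum_insert hj,
      Finset.erase_insert hj, sgn_insert_of_le le_rfl, smul_add, smul_smul, sgn_mul_self, one_smul,
      add_left_comm, Finset.smul_sum, ← Finset.sum_add_distrib, Finset.sum_eq_zero, add_zero]
    intro i hi
    have hij : i ≠ j := fun h => hj (h ▸ hi)
    rw [contract_apply, if_neg (fun h => hj (Finset.mem_of_mem_erase h)), map_zsmul, smul_smul,
      smul_smul, sgn_mul_sgn_erase_insert hi hj, neg_smul, Finset.erase_insert_of_ne hij.symm,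
      neg_add_cancel]

variable [Fintype ι]

/-- The Koszul chain differential of a family of endomorphisms. -/
def koszulDown (T : ι → W →ₗ[S] W) : (Finset ι → W) →ₗ[S] (Finset ι → W) where
  toFun m F := ∑ i ∈ Fᶜ, sgn F i • T i (m (insert i F))
  map_add' a b := by
    ext F
    simp [Finset.sum_add_distrib]
  map_smul' c a := by
    ext F
    simp [Finset.smul_sum, smul_comm c]

theorem koszulDown_apply (T : ι → W →ₗ[S] W) (m : Finset ι → W) (F : Finset ι) :
    koszulDown T m F = ∑ i ∈ Fᶜ, sgn F i • T i (m (insert i F)) := rfl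

theorem koszulDown_koszulDown (T : ι → W →ₗ[S] W) (hT : ∀ i j w, T i (T j w) = T j (T i w))
    (m : Finset ι → W) : koszulDown T (koszulDown T m) = 0 := by
  ext F
  simp only [koszulDown_apply, map_sum, map_zsmul, Finset.smul_sum, Pi.zero_apply, smul_smul]
  rw [← sum_sum_eq_zero_of_antisymm Fᶜ fun i j => if i ∉ F ∧ j ∉ F ∧ i ≠ j then
      (sgn F i * sgn (insert i F) j) • T i (T j (m (insert j (insert i F)))) else 0]
  · refine Finset.sum_congr rfl fun i hi => ?_
    rw [Finset.mem_compl] at hi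
    rw [← Finset.sum_subset (Finset.compl_subset_compl.2 (Finset.subset_insert i F))]
    · refine Finset.sum_congr rfl fun j hj => ?_
      rw [Finset.mem_compl, Finset.mem_insert, not_or] at hj
      rw [if_pos ⟨hi, hj.2, fun h => hj.1 h.symm⟩]
    · intro j hj hj'
      rw [if_neg]
      rintro ⟨_, h', h⟩
      apply hj'
      rw [Finset.mem_compl, Finset.mem_insert, not_or]
      exact ⟨h.symm, h'⟩
  · intro i j
    by_cases h : i ∉ F ∧ j ∉ F ∧ i ≠ j
    · rw [if_pos h, if_pos ⟨h.2.1, h.1, h.2.2.symm⟩, sgn_mul_sgn_insert h.1 h.2.1 h.2.2, neg_smul,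
        hT i j, Finset.insert_comm]
    · rw [if_neg h, if_neg, neg_zero]
      rintro ⟨h1, h2, h3⟩
      exact h ⟨h2, h1, h3.symm⟩
  · simp

end Signs

/-! ### Annihilation of Koszul cohomology -/

section Annihilation

variable {R : Type*} [CommRing R] {M : Type*} [AddCommGroup M] [Module R M]
variable {ι : Type*}

/-- There are `r` successive elements of the ideal generated by the `x i` such that, starting
from `M / N`, the elements killed by any power of each are killed by all `x i`, modulo powers of
the preceding ones. -/
def HasWeakParameters (x : ι → R) : ℕ → Submodule R M → Prop
  | 0, _ => True
  | r + 1, N => ∃ θ ∈ Ideal.span (Set.range x), ∀ a : ℕ,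
      (∀ m : M, θ ^ (a + 1) • m ∈ N → ∀ l, x l • m ∈ N) ∧
        HasWeakParameters x r (N ⊔ LinearMap.range (LinearMap.lsmul R M (θ ^ (a + 1))))

/-- The exponent depends on `t`, which is why `HasWeakParameters` quantifies over all powers of `θ`.
-/
theorem exists_pow_mem_span_pow (x : ι → R) {θ : R}
    (hθ : θ ∈ Ideal.span (Set.range x)) (t : ℕ) :
    ∃ a : ℕ, θ ^ (a + 1) ∈ Ideal.span (Set.range fun i => x i ^ t) := by
  have h : Ideal.span (Set.range x) ≤ (Ideal.span (Set.range fun i => x i ^ t)).radical := by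
    rw [Ideal.span_le]
    rintro _ ⟨i, rfl⟩
    exact ⟨t, Ideal.subset_span ⟨i, rfl⟩⟩
  obtain ⟨a, ha⟩ := h hθ
  exact ⟨a, by rw [pow_succ]; exact Ideal.mul_mem_right _ _ ha⟩

/-- The transition map between the Koszul complexes of different powers. -/
def powTrans (x : ι → R) (s : ℕ) (m : Finset ι → M) : Finset ι → M :=
  fun F => (∏ i ∈ F, x i ^ s) • m F

theorem powTrans_powTrans (x : ι → R) (s s' : ℕ) (m : Finset ι → M) :
    powTrans x s (powTrans x s' m) = powTrans x (s' + s) m := by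
  ext F
  simp only [powTrans, smul_smul, ← Finset.prod_mul_distrib, pow_add]
  simp only [mul_comm]

variable [LinearOrder ι]

/-- The cochain differential of the Koszul complex of the powers `x i ^ t`. -/
abbrev powDiff (x : ι → R) (t : ℕ) : (Finset ι → M) →ₗ[R] (Finset ι → M) :=
  koszulUp fun i => LinearMap.lsmul R M (x i ^ t)

theorem powDiff_apply (x : ι → R) (t : ℕ) (m : Finset ι → M) (F : Finset ι) :
    powDiff x t m F = ∑ i ∈ F, sgn F i • x i ^ t • m (F.erase i) := rfl

/-- The transition maps are cochain maps, so the complexes of the powers `x i ^ t` form a direct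
system. For the face module and the variables its limit is the Čech complex. -/
theorem powDiff_powTrans (x : ι → R) (t s : ℕ) (m : Finset ι → M) :
    powDiff x (t + s) (powTrans x s m) = powTrans x s (powDiff x t m) := by
  ext F
  simp only [powDiff_apply, powTrans, Finset.smul_sum]
  refine Finset.sum_congr rfl fun i hi => ?_
  rw [smul_comm _ (sgn F i), smul_smul, smul_smul, ← Finset.mul_prod_erase F _ hi]
  congr 2
  ring

/-- Koszul cohomology in degrees below the number of weak parameters is killed, in the limit, by
all `x l`. -/
theorem HasWeakParameters.smul_powTrans_sub_mem [Fintype ι] {x : ι → R} {p : ℕ}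
    {N : Submodule R M} (hN : HasWeakParameters x (p + 1) N) {t : ℕ} {m : Finset ι → M}
    (hm : ∀ F : Finset ι, F.card = p + 1 → powDiff x t m F ∈ N) (l : ι) :
    ∃ (s : ℕ) (w : Finset ι → M), ∀ F : Finset ι, F.card = p →
      x l • powTrans x s m F - powDiff x (t + s) w F ∈ N := by
  induction p generalizing N t m with
  | zero =>
    obtain ⟨θ, hθ, h⟩ := hN
    obtain ⟨a, ha⟩ := exists_pow_mem_span_pow x hθ t
    refine ⟨0, 0, fun F hF => ?_⟩
    rw [Finset.card_eq_zero] at hF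
    subst hF
    -- A cocycle in degree zero is killed modulo `N` by every `x i ^ t`, hence by `θ ^ (a + 1)`.
    have key : x l • m ∅ ∈ N := by
      refine (h a).1 _ ?_ l
      rw [Ideal.mem_span_range_iff_exists_fun] at ha
      obtain ⟨g, hg⟩ := ha
      rw [← hg, Finset.sum_smul]
      refine N.sum_mem fun i _ => ?_
      rw [mul_smul]
      refine N.smul_mem _ ?_
      have := hm {i} (by simp)
      simpa [powDiff_apply, sgn, Finset.filter_singleton] using this
    simpa [powDiff_apply, powTrans] using key
  | succ p ih =>
    obtain ⟨θ, hθ, h⟩ := hN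
    obtain ⟨a, ha⟩ := exists_pow_mem_span_pow x hθ t
    rw [Ideal.mem_span_range_iff_exists_fun] at ha
    obtain ⟨g, hg⟩ := ha
    -- This is the homotopy attached to `θ ^ (a + 1) = ∑ g i * x i ^ t`. Modulo `N` the differential
    -- of `u` is `θ ^ (a + 1) • m`, so `u` is a cocycle of one degree less modulo the next
    -- submodule.
    set u : Finset ι → M := ∑ i, g i • contract (S := R) i m with hu
    have hδu : ∀ F : Finset ι, F.card = p + 1 →
        powDiff x t u F - θ ^ (a + 1) • m F ∈ N := by
      intro F hF
      have e : powDiff x t u F - θ ^ (a + 1) • m F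
          = -∑ i, g i • contract (S := R) i (powDiff x t m) F := by
        rw [← hg, Finset.sum_smul, hu, map_sum, Finset.sum_apply, ← Finset.sum_neg_distrib,
          ← Finset.sum_sub_distrib]
        refine Finset.sum_congr rfl fun i _ => ?_
        have := koszulUp_contract_add (fun i => LinearMap.lsmul R M (x i ^ t)) i m F
        rw [LinearMap.lsmul_apply] at this
        rw [map_smul, Pi.smul_apply, mul_smul, ← this, smul_add]
        abel
      rw [e]
      refine N.neg_mem (N.sum_mem fun i _ => N.smul_mem _ ?_)
      rw [contract_apply]
      split_ifs with hi
      · exact N.zero_mem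
      · exact zsmul_mem (hm _ (by rw [Finset.card_insert_of_notMem hi, hF])) _
    obtain ⟨s, v, hv⟩ := ih (h a).2 (t := t) (m := u) fun F hF => by
      have e : powDiff x t u F = (powDiff x t u F - θ ^ (a + 1) • m F) + θ ^ (a + 1) • m F := by
        abel
      rw [e]
      exact Submodule.add_mem_sup (hδu F hF) ⟨m F, rfl⟩
    -- The inductive conclusion holds modulo `N + θ ^ (a + 1) M`; the coefficient `w` of `θ ^ (a +
    -- 1)` is the primitive sought for `x l • m`.
    have hw : ∀ F : Finset ι, ∃ w : M, F.card = p →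
        x l • powTrans x s u F - powDiff x (t + s) v F - θ ^ (a + 1) • w ∈ N := by
      intro F
      by_cases hF : F.card = p
      · obtain ⟨y, hy, z, hz, hyz⟩ := Submodule.mem_sup.1 (hv F hF)
        obtain ⟨w, rfl⟩ := hz
        exact ⟨w, fun _ => by
          rw [← hyz, LinearMap.lsmul_apply, add_sub_cancel_right]; exact hy⟩
      · exact ⟨0, fun h => (hF h).elim⟩
    choose w hw using hw
    -- Applying the differential once more removes `v`, and both remaining terms carry the factor `θ
    -- ^ (a + 1)`.
    have key : ∀ F : Finset ι, F.card = p + 1 →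
        θ ^ (a + 1) • (x l • powTrans x s m F - powDiff x (t + s) w F) ∈ N := by
      intro F hF
      have h1 : powDiff x (t + s)
          (x l • powTrans x s u - powDiff x (t + s) v - θ ^ (a + 1) • w) F ∈ N := by
        rw [powDiff_apply]
        refine N.sum_mem fun i hi => zsmul_mem (N.smul_mem _ ?_) _
        exact hw _ (by rw [Finset.card_erase_of_mem hi, hF, Nat.add_sub_cancel])
      rw [map_sub, map_sub, koszulUp_koszulUp _ (fun i j w => by
        simp only [LinearMap.lsmul_apply]; exact smul_comm _ _ _), sub_zero, map_smul, map_smul,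
        powDiff_powTrans, Pi.sub_apply, Pi.smul_apply, Pi.smul_apply] at h1
      have h2 : x l • (powTrans x s (powDiff x t u) F - θ ^ (a + 1) • powTrans x s m F) ∈ N := by
        refine N.smul_mem _ ?_
        simp only [powTrans]
        rw [smul_comm, ← smul_sub]
        exact N.smul_mem _ (hδu F hF)
      have := N.sub_mem h1 h2
      convert this using 1
      rw [smul_sub, smul_sub, smul_comm (x l) (θ ^ (a + 1))]
      abel
    -- One more transition multiplies the component at `F` by all `x j` with `j ∈ F`. As `F` is
    -- nonempty, one of them is available to cancel `θ ^ (a + 1)` through the weak parameter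
    -- property.
    refine ⟨s + 1, powTrans x 1 w, fun F hF => ?_⟩
    rw [← powTrans_powTrans, ← add_assoc, powDiff_powTrans]
    have hne : F.Nonempty := by
      rw [← Finset.card_pos]
      omega
    obtain ⟨i, hi⟩ := hne
    have h1 := (h a).1 _ (key F hF) i
    have e : x l • powTrans x 1 (powTrans x s m) F - powTrans x 1 (powDiff x (t + s) w) F
        = (∏ j ∈ F.erase i, x j ^ 1) •
          x i • (x l • powTrans x s m F - powDiff x (t + s) w F) := by
      unfold powTrans
      rw [← Finset.mul_prod_erase F (fun i => x i ^ 1) hi, smul_smul _ (x i), mul_comm _ (x i),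
        pow_one, smul_sub, smul_comm (x l)]
    rw [e]
    exact N.smul_mem _ h1

end Annihilation

/-! ### Dimensions of subquotients -/

section RelDim

variable {k : Type*} [Field k] {V W : Type*} [AddCommGroup V] [Module k V] [AddCommGroup W]
  [Module k W]

/-- The dimension of `V₁ / V₀`. -/
def relDim (V₁ V₀ : Submodule k V) : ℕ := Module.finrank k (V₁ ⧸ V₀.submoduleOf V₁)

/-- The map induced by `f` between the subquotients is bijective. No inclusion `V₀ ≤ V₁` and no
finiteness is assumed, so this applies to the Čech terms, which may be infinite-dimensional. -/
theorem relDim_congr {V₁ V₀ : Submodule k V} {W₁ W₀ : Submodule k W} (f : V →ₗ[k] W)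
    (h1 : ∀ v ∈ V₁, f v ∈ W₁) (h2 : ∀ w ∈ W₁, ∃ v ∈ V₁, w - f v ∈ W₀)
    (h3 : ∀ v ∈ V₁, f v ∈ W₀ ↔ v ∈ V₀) : relDim V₁ V₀ = relDim W₁ W₀ := by
  let g : V₁ →ₗ[k] W₁ ⧸ W₀.submoduleOf W₁ := (W₀.submoduleOf W₁).mkQ ∘ₗ f.restrict h1
  have hg : Function.Surjective g := by
    intro y
    obtain ⟨⟨w, hw⟩, rfl⟩ := Submodule.Quotient.mk_surjective _ y
    obtain ⟨v, hv, hvw⟩ := h2 w hw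
    refine ⟨⟨v, hv⟩, ((Submodule.Quotient.eq _).2 ?_).symm⟩
    exact hvw
  have hk : V₀.submoduleOf V₁ = LinearMap.ker g := by
    ext ⟨v, hv⟩
    rw [LinearMap.mem_ker, LinearMap.comp_apply, Submodule.mkQ_apply,
      Submodule.Quotient.mk_eq_zero]
    exact (h3 v hv).symm
  exact LinearEquiv.finrank_eq
    ((Submodule.quotEquivOfEq _ _ hk).trans (g.quotKerEquivOfSurjective hg))

theorem relDim_eq_zero {V₁ V₀ : Submodule k V} (h : V₁ ≤ V₀) : relDim V₁ V₀ = 0 := by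
  have : V₀.submoduleOf V₁ = ⊤ := Submodule.submoduleOf_eq_top.2 h
  have hs : Subsingleton (V₁ ⧸ V₀.submoduleOf V₁) := Submodule.Quotient.subsingleton_iff.2 this
  exact Module.finrank_zero_of_subsingleton

theorem relDim_add_finrank {V₁ V₀ : Submodule k V} [FiniteDimensional k V₁] (h : V₀ ≤ V₁) :
    relDim V₁ V₀ + Module.finrank k V₀ = Module.finrank k V₁ := by
  rw [← (Submodule.submoduleOfEquivOfLe h).finrank_eq]
  exact Submodule.finrank_quotient_add_finrank _

theorem sum_neg_one_pow_finrank (B : ℕ → Submodule k V) (D : V →ₗ[k] V)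
    [∀ q, FiniteDimensional k (B q)] (hD : ∀ q, ∀ z ∈ B (q + 1), D z ∈ B q)
    (hDD : ∀ q, ∀ z ∈ B q, D (D z) = 0) (h0 : ∀ z ∈ B 0, D z = 0) {L : ℕ} (hL : B (L + 1) = ⊥) :
    ∑ q ∈ Finset.range (L + 1), (-1 : ℤ) ^ q * Module.finrank k (B q) =
      ∑ q ∈ Finset.range (L + 1),
        (-1 : ℤ) ^ q * relDim (B q ⊓ LinearMap.ker D) ((B (q + 1)).map D) := by
  have hfin : ∀ q, FiniteDimensional k (B q ⊓ LinearMap.ker D : Submodule k V) := fun q =>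
    Submodule.finiteDimensional_of_le inf_le_left
  have hrel : ∀ q, (relDim (B q ⊓ LinearMap.ker D) ((B (q + 1)).map D) : ℤ) =
      Module.finrank k (B q ⊓ LinearMap.ker D : Submodule k V) -
        Module.finrank k ((B (q + 1)).map D) := by
    intro q
    rw [← relDim_add_finrank (V₁ := B q ⊓ LinearMap.ker D) (V₀ := (B (q + 1)).map D)]
    · push_cast
      ring
    · rintro _ ⟨z, hz, rfl⟩
      exact ⟨hD q z hz, hDD _ z hz⟩
  have hrank : ∀ q, (Module.finrank k (B (q + 1)) : ℤ) =
      Module.finrank k (B (q + 1) ⊓ LinearMap.ker D : Submodule k V) +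
        Module.finrank k ((B (q + 1)).map D) := by
    intro q
    have := (D.domRestrict (B (q + 1))).finrank_range_add_finrank_ker
    rw [LinearMap.range_domRestrict] at this
    have e : LinearMap.ker (D.domRestrict (B (q + 1))) =
        (B (q + 1) ⊓ LinearMap.ker D).submoduleOf (B (q + 1)) := by
      ext ⟨z, hz⟩
      simp [Submodule.submoduleOf]
    rw [e, (Submodule.submoduleOfEquivOfLe inf_le_left).finrank_eq] at this
    rw [← this]
    push_cast
    ring
  -- Rank-nullity telescopes. The truncated sum leaves the rank of the next incoming differential,
  -- and this is zero at `m = L`.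
  have key : ∀ m : ℕ, ∑ q ∈ Finset.range (m + 1), (-1 : ℤ) ^ q * Module.finrank k (B q) =
      ∑ q ∈ Finset.range (m + 1),
        (-1 : ℤ) ^ q * relDim (B q ⊓ LinearMap.ker D) ((B (q + 1)).map D) +
      (-1 : ℤ) ^ m * Module.finrank k ((B (m + 1)).map D) := by
    intro m
    induction m with
    | zero =>
      have : B 0 ⊓ LinearMap.ker D = B 0 := inf_eq_left.2 fun z hz => h0 z hz
      simp [hrel]
      rw [this]
    | succ m ih =>
      rw [Finset.sum_range_succ, ih, Finset.sum_range_succ _ (m + 1), hrel, hrank]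
      ring
  rw [key, hL]
  simp

end RelDim

/-! ### Double complexes -/

section DoubleComplex

variable {k : Type*} [Field k] {V : Type*} [AddCommGroup V] [Module k V]

/-- A double complex with commuting differentials `δ` of bidegree `(1, 0)` and `D` of bidegree
`(0, -1)`, realized on subspaces of one vector space. -/
structure IsDoubleComplex (A : ℕ → ℕ → Submodule k V) (δ D : V →ₗ[k] V) : Prop where
  δ_mem : ∀ {p q z}, z ∈ A p q → δ z ∈ A (p + 1) q
  D_mem : ∀ {p q z}, z ∈ A p (q + 1) → D z ∈ A p q
  δ_δ : ∀ {p q z}, z ∈ A p q → δ (δ z) = 0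
  D_D : ∀ {p q z}, z ∈ A p q → D (D z) = 0
  comm : ∀ {p q z}, z ∈ A p q → D (δ z) = δ (D z)

/-- The horizontal boundaries. -/
def horBoundary (A : ℕ → ℕ → Submodule k V) (δ : V →ₗ[k] V) : ℕ → ℕ → Submodule k V
  | 0, _ => ⊥
  | p + 1, q => (A p q).map δ

/-- The numerator `ker (D δ)` of the donor at `(p, q)`. -/
def donor (A : ℕ → ℕ → Submodule k V) (δ D : V →ₗ[k] V) (p q : ℕ) : Submodule k V :=
  A p q ⊓ LinearMap.ker (D ∘ₗ δ)

/-- The denominator `im D + im δ` of the donor at `(p, q)`. -/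
def donorBoundary (A : ℕ → ℕ → Submodule k V) (δ D : V →ₗ[k] V) (p q : ℕ) : Submodule k V :=
  (A p (q + 1)).map D ⊔ horBoundary A δ p q

namespace IsDoubleComplex

variable {A : ℕ → ℕ → Submodule k V} {δ D : V →ₗ[k] V} (h : IsDoubleComplex A δ D)
include h

theorem δ_eq_zero_of_mem_horBoundary {p q : ℕ} {z : V} (hz : z ∈ horBoundary A δ p q) :
    δ z = 0 := by
  cases p with
  | zero => rw [(Submodule.mem_bot k).1 hz, map_zero]
  | succ p =>
    obtain ⟨v, hv, rfl⟩ := hz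
    exact h.δ_δ hv

theorem D_mem_horBoundary {p q : ℕ} {z : V} (hz : z ∈ horBoundary A δ p (q + 1)) :
    D z ∈ horBoundary A δ p q := by
  cases p with
  | zero => rw [(Submodule.mem_bot k).1 hz, map_zero]; exact Submodule.zero_mem _
  | succ p =>
    obtain ⟨v, hv, rfl⟩ := hz
    exact ⟨D v, h.D_mem hv, (h.comm hv).symm⟩

/-- Both donors are isomorphic to the receptor at `(p + 1, q)`, the common kernel of `δ` and `D`
modulo the image of `D ∘ δ`: one through `δ` by exactness of rows, the other through `D` by
exactness of columns. -/
theorem relDim_donor_succ {p q : ℕ}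
    (hr : ∀ z ∈ A p q, δ z = 0 → z ∈ horBoundary A δ p q)
    (hr' : ∀ z ∈ A (p + 1) q, δ z = 0 → z ∈ horBoundary A δ (p + 1) q)
    (hc : ∀ z ∈ A (p + 1) q, D z = 0 → z ∈ (A (p + 1) (q + 1)).map D)
    (hc' : ∀ z ∈ A (p + 1) (q + 1), D z = 0 → z ∈ (A (p + 1) (q + 2)).map D) :
    relDim (donor A δ D p q) (donorBoundary A δ D p q) =
      relDim (donor A δ D (p + 1) (q + 1)) (donorBoundary A δ D (p + 1) (q + 1)) := by
  trans relDim (A (p + 1) q ⊓ (LinearMap.ker δ ⊓ LinearMap.ker D)) ((A p (q + 1)).map (D ∘ₗ δ))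
  · refine relDim_congr δ ?_ ?_ ?_
    · rintro v ⟨hv, hv'⟩
      exact ⟨h.δ_mem hv, h.δ_δ hv, hv'⟩
    · rintro w ⟨hw, hw1, hw2⟩
      obtain ⟨v, hv, rfl⟩ := hr' w hw hw1
      exact ⟨v, ⟨hv, hw2⟩, by simp⟩
    · rintro v ⟨hv, hv'⟩
      constructor
      · rintro ⟨w, hw, hwv⟩
        rw [LinearMap.comp_apply, h.comm hw] at hwv
        rw [← sub_add_cancel v (D w), add_comm]
        refine Submodule.add_mem_sup ⟨w, hw, rfl⟩ (hr _ (Submodule.sub_mem _ hv (h.D_mem hw)) ?_)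
        rw [map_sub, hwv, sub_self]
      · intro hv0
        obtain ⟨_, ⟨w, hw, rfl⟩, b, hb, rfl⟩ := Submodule.mem_sup.1 hv0
        refine ⟨w, hw, ?_⟩
        rw [LinearMap.comp_apply, h.comm hw, map_add, h.δ_eq_zero_of_mem_horBoundary hb, add_zero]
  · symm
    refine relDim_congr D ?_ ?_ ?_
    · rintro v ⟨hv, hv'⟩
      exact ⟨h.D_mem hv, (h.comm hv).symm.trans hv', h.D_D hv⟩
    · rintro w ⟨hw, hw1, hw2⟩
      obtain ⟨v, hv, rfl⟩ := hc w hw hw2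
      exact ⟨v, ⟨hv, (h.comm hv).trans hw1⟩, by simp⟩
    · rintro v ⟨hv, hv'⟩
      constructor
      · rintro ⟨w, hw, hwv⟩
        rw [← sub_add_cancel v (δ w)]
        refine Submodule.add_mem_sup (hc' _ (Submodule.sub_mem _ hv (h.δ_mem hw)) ?_) ⟨w, hw, rfl⟩
        rw [map_sub, ← hwv, LinearMap.comp_apply, sub_self]
      · intro hv0
        obtain ⟨_, ⟨y, hy, rfl⟩, _, ⟨w, hw, rfl⟩, rfl⟩ := Submodule.mem_sup.1 hv0
        refine ⟨w, hw, ?_⟩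
        rw [LinearMap.comp_apply, map_add, h.D_D hy, zero_add]

/-- Lift `δ z` through `D`. The lift lies in the donor at `(p + 1, q + 1)`, which is trivial, and
its horizontal part supplies the correction of `z`. -/
theorem exists_sub_D_mem {p q : ℕ}
    (hc : ∀ z ∈ A (p + 1) q, D z = 0 → z ∈ (A (p + 1) (q + 1)).map D)
    (hd : donor A δ D (p + 1) (q + 1) ≤ donorBoundary A δ D (p + 1) (q + 1))
    {z : V} (hz : z ∈ donor A δ D p q) :
    ∃ w ∈ A p (q + 1), δ (z - D w) = 0 := by
  obtain ⟨w, hw, hwz⟩ := hc _ (h.δ_mem hz.1) hz.2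
  have hw' : w ∈ donor A δ D (p + 1) (q + 1) := by
    refine Submodule.mem_inf.2 ⟨hw, ?_⟩
    rw [LinearMap.mem_ker, LinearMap.comp_apply, h.comm hw, hwz, h.δ_δ hz.1]
  obtain ⟨_, ⟨y, hy, rfl⟩, _, ⟨v, hv, rfl⟩, rfl⟩ := Submodule.mem_sup.1 (hd hw')
  refine ⟨v, hv, ?_⟩
  rw [map_sub, ← hwz, map_add, h.D_D hy, h.comm hv, zero_add, sub_self]

theorem donor_le {p q : ℕ}
    (hr : ∀ z ∈ A p q, δ z = 0 → z ∈ horBoundary A δ p q)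
    (hc : ∀ z ∈ A (p + 1) q, D z = 0 → z ∈ (A (p + 1) (q + 1)).map D)
    (hd : donor A δ D (p + 1) (q + 1) ≤ donorBoundary A δ D (p + 1) (q + 1)) :
    donor A δ D p q ≤ donorBoundary A δ D p q := by
  intro z hz
  obtain ⟨w, hw, hwz⟩ := h.exists_sub_D_mem hc hd hz
  rw [← sub_add_cancel z (D w), add_comm]
  exact Submodule.add_mem_sup ⟨w, hw, rfl⟩ (hr _ (Submodule.sub_mem _ hz.1 (h.D_mem hw)) hwz)

/-- The comparison map is the identity. Triviality of the donor at `(p + 1, q + 1)` gives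
surjectivity, triviality of the one at `(p, q + 1)` injectivity. -/
theorem relDim_horizontal {p q : ℕ}
    (hc : ∀ z ∈ A (p + 1) q, D z = 0 → z ∈ (A (p + 1) (q + 1)).map D)
    (hd : donor A δ D (p + 1) (q + 1) ≤ donorBoundary A δ D (p + 1) (q + 1))
    (hd' : donor A δ D p (q + 1) ≤ donorBoundary A δ D p (q + 1)) :
    relDim (A p q ⊓ LinearMap.ker δ) (horBoundary A δ p q) =
      relDim (donor A δ D p q) (donorBoundary A δ D p q) := by
  refine relDim_congr LinearMap.id ?_ ?_ ?_
  · rintro z ⟨hz, hz'⟩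
    exact ⟨hz, by simp [LinearMap.mem_ker.1 hz']⟩
  · intro z hz
    obtain ⟨w, hw, hwz⟩ := h.exists_sub_D_mem hc hd hz
    refine ⟨z - D w, ⟨Submodule.sub_mem _ hz.1 (h.D_mem hw), hwz⟩, ?_⟩
    rw [LinearMap.id_apply, sub_sub_cancel]
    exact Submodule.mem_sup_left ⟨w, hw, rfl⟩
  · rintro z ⟨hz, hz'⟩
    refine ⟨fun hz0 => ?_, fun hz0 => Submodule.mem_sup_right hz0⟩
    obtain ⟨_, ⟨w, hw, rfl⟩, b, hb, rfl⟩ := Submodule.mem_sup.1 hz0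
    have hw' : w ∈ donor A δ D p (q + 1) := by
      refine Submodule.mem_inf.2 ⟨hw, ?_⟩
      rw [SetLike.mem_coe, LinearMap.mem_ker, map_add, h.δ_eq_zero_of_mem_horBoundary hb,
        add_zero] at hz'
      rw [LinearMap.mem_ker, LinearMap.comp_apply, h.comm hw, hz']
    obtain ⟨_, ⟨y, hy, rfl⟩, b', hb', rfl⟩ := Submodule.mem_sup.1 (hd' hw')
    refine Submodule.add_mem _ ?_ hb
    rw [map_add, h.D_D hy, zero_add]
    exact h.D_mem_horBoundary hb'

/-- Exactness of row `q` at column `0` means that `δ` is injective there, so `D z = 0` and `D (δ z)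
= 0` agree; column `0` receives no horizontal boundaries. -/
theorem relDim_vertical {q : ℕ} (hr : ∀ z ∈ A 0 q, δ z = 0 → z ∈ horBoundary A δ 0 q) :
    relDim (A 0 (q + 1) ⊓ LinearMap.ker D) ((A 0 (q + 2)).map D) =
      relDim (donor A δ D 0 (q + 1)) (donorBoundary A δ D 0 (q + 1)) := by
  congr 1
  · ext z
    refine and_congr_right fun hz => ?_
    rw [SetLike.mem_coe, SetLike.mem_coe, LinearMap.mem_ker, LinearMap.mem_ker,
      LinearMap.comp_apply, h.comm hz]
    exact ⟨fun e => by rw [e, map_zero], fun e => hr _ (h.D_mem hz) e⟩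
  · rw [donorBoundary, horBoundary, sup_bot_eq]

/-- Triviality is inherited from `(p + 1, q + 1)`, and everything is zero once `q > ℓ`. The
condition `p < q` keeps `p < ℓ` until then, and the diagonal never meets row `e` on the way, so each
row used is exact. -/
theorem donor_le_of_lt {ℓ e : ℕ} (htop : ∀ p q, ℓ < q → A p q = ⊥)
    (hr : ∀ p q, p < ℓ → q ≠ e → ∀ z ∈ A p q, δ z = 0 → z ∈ horBoundary A δ p q)
    (hc : ∀ p q, ∀ z ∈ A (p + 1) (q + 1), D z = 0 → z ∈ (A (p + 1) (q + 2)).map D)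
    {p q : ℕ} (hpq : p < q) (hq : e < q ∨ ℓ < e) :
    donor A δ D p q ≤ donorBoundary A δ D p q := by
  by_cases hqℓ : ℓ < q
  · rw [donor, htop p q hqℓ, bot_inf_eq]
    exact bot_le
  · have ih : donor A δ D (p + 1) (q + 1) ≤ donorBoundary A δ D (p + 1) (q + 1) :=
      donor_le_of_lt htop hr hc (by omega) (by omega)
    obtain ⟨q, rfl⟩ : ∃ r, q = r + 1 := ⟨q - 1, by omega⟩
    exact h.donor_le (hr _ _ (by omega) (by omega)) (hc p q) ih
  termination_by ℓ + 1 - q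

/-- If the rows other than the `e`-th one are exact in columns before the `ℓ`-th one, and the
columns other than the initial one are exact away from the bottom, then the homology of the
initial column is the cohomology of the `e`-th row. -/
theorem relDim_vertical_eq_horizontal {ℓ e : ℕ} (htop : ∀ p q, ℓ < q → A p q = ⊥)
    (hr : ∀ p q, p < ℓ → q ≠ e → ∀ z ∈ A p q, δ z = 0 → z ∈ horBoundary A δ p q)
    (hc : ∀ p q, ∀ z ∈ A (p + 1) (q + 1), D z = 0 → z ∈ (A (p + 1) (q + 2)).map D)
    (he : e ≤ ℓ) {q i : ℕ} (hqi : q + 1 + i = e) :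
    relDim (A 0 (q + 1) ⊓ LinearMap.ker D) ((A 0 (q + 2)).map D) =
      relDim (A i e ⊓ LinearMap.ker δ) (horBoundary A δ i e) := by
  rw [h.relDim_vertical (hr 0 q (by omega) (by omega)), ← hqi, h.relDim_horizontal]
  -- Climb the diagonal from `(0, q + 1)` to `(i, e)`; the rows left behind lie strictly below `e`
  -- and are exact.
  · have key : ∀ j, j ≤ i → relDim (donor A δ D 0 (q + 1)) (donorBoundary A δ D 0 (q + 1)) =
        relDim (donor A δ D j (q + 1 + j)) (donorBoundary A δ D j (q + 1 + j)) := by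
      intro j
      induction j with
      | zero => exact fun _ => rfl
      | succ j ih =>
        intro hj
        rw [ih (by omega), h.relDim_donor_succ (hr _ _ (by omega) (by omega))
          (hr _ _ (by omega) (by omega))]
        · rfl
        · rw [show q + 1 + j = (q + j) + 1 by ring]
          exact hc _ _
        · exact hc _ _
    exact key i le_rfl
  · rw [show q + 1 + i = (q + i) + 1 by ring]
    exact hc _ _
  · exact h.donor_le_of_lt htop hr hc (by omega) (by omega)
  · exact h.donor_le_of_lt htop hr hc (by omega) (by omega)

/-- No row `q ≤ ℓ` is exceptional, so the diagonal carries only trivial donors. -/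
theorem relDim_vertical_eq_zero {ℓ e : ℕ} (htop : ∀ p q, ℓ < q → A p q = ⊥)
    (hr : ∀ p q, p < ℓ → q ≠ e → ∀ z ∈ A p q, δ z = 0 → z ∈ horBoundary A δ p q)
    (hc : ∀ p q, ∀ z ∈ A (p + 1) (q + 1), D z = 0 → z ∈ (A (p + 1) (q + 2)).map D)
    (he : ℓ < e) {q : ℕ} :
    relDim (A 0 (q + 1) ⊓ LinearMap.ker D) ((A 0 (q + 2)).map D) = 0 := by
  by_cases hq : ℓ < q + 1
  · refine relDim_eq_zero ?_
    rw [htop _ _ hq, bot_inf_eq]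
    exact bot_le
  · rw [h.relDim_vertical (hr 0 q (by omega) (by omega))]
    exact relDim_eq_zero (h.donor_le_of_lt htop hr hc (by omega) (by omega))

end IsDoubleComplex

end DoubleComplex

/-! ### Acyclicity of Koszul complexes of regular sequences -/

section Acyclic

variable {S : Type*} [CommRing S] {W : Type*} [AddCommGroup W] [Module S W]

section

variable {ι : Type*} [LinearOrder ι]

/-- Exterior multiplication by the `r`-th basis vector. -/
def wedge (r : ι) (v : Finset ι → W) (J : Finset ι) : W :=
  if r ∈ J then sgn J r • v (J.erase r) else 0

variable [Fintype ι]

/-- The chain-level counterpart of `koszulUp_contract_add`: exterior multiplication is a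
null-homotopy of `T r`. -/
theorem koszulDown_wedge_add (T : ι → W →ₗ[S] W) (r : ι) (v : Finset ι → W) (J : Finset ι) :
    koszulDown T (wedge r v) J + wedge r (koszulDown T v) J = T r (v J) := by
  by_cases hr : r ∈ J
  · have hc : (J.erase r)ᶜ = insert r Jᶜ := by
      ext i
      by_cases h : i = r <;> simp [h]
    rw [wedge, if_pos hr, koszulDown_apply, koszulDown_apply, hc, Finset.sum_insert (by simpa),
      Finset.insert_erase hr, sgn_erase_of_le le_rfl, smul_add, smul_smul, sgn_mul_self, one_smul,
      add_left_comm, Finset.smul_sum, ← Finset.sum_add_distrib, Finset.sum_eq_zero, add_zero]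
    intro i hi
    rw [Finset.mem_compl] at hi
    have hir : i ≠ r := fun h => hi (h ▸ hr)
    rw [wedge, if_pos (Finset.mem_insert_of_mem hr), map_zsmul, smul_smul, smul_smul,
      sgn_mul_sgn_erase_insert hr hi, neg_smul, Finset.erase_insert_of_ne hir,
      add_neg_cancel]
  · rw [wedge, if_neg hr, add_zero, koszulDown_apply, Finset.sum_eq_single r]
    · rw [wedge, if_pos (Finset.mem_insert_self r J), Finset.erase_insert hr,
        map_zsmul, smul_smul, sgn_insert_of_le le_rfl, sgn_mul_self, one_smul]
    · intro i _ hir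
      rw [wedge, if_neg, map_zero, smul_zero]
      rw [Finset.mem_insert, not_or]
      exact ⟨hir.symm, hr⟩
    · intro h
      exact (h (Finset.mem_compl.2 hr)).elim

/-- Contraction anticommutes with the chain differential, so it turns cycles into cycles. -/
theorem koszulDown_contract_add (T : ι → W →ₗ[S] W) (r : ι) (z : Finset ι → W) (J : Finset ι) :
    koszulDown T (contract (S := S) r z) J + contract (S := S) r (koszulDown T z) J = 0 := by
  by_cases hr : r ∈ J
  · rw [contract_apply, if_pos hr, add_zero, koszulDown_apply]
    refine Finset.sum_eq_zero fun i _ => ?_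
    rw [contract_apply, if_pos (Finset.mem_insert_of_mem hr), map_zero, smul_zero]
  · have hc : Jᶜ = insert r (insert r J)ᶜ := by
      ext i
      by_cases h : i = r <;> simp [h, hr]
    rw [contract_apply, if_neg hr, koszulDown_apply, koszulDown_apply, hc,
      Finset.sum_insert (by simp), contract_apply, if_pos (Finset.mem_insert_self r J), map_zero,
      smul_zero, zero_add, Finset.smul_sum, ← Finset.sum_add_distrib]
    refine Finset.sum_eq_zero fun i hi => ?_
    rw [Finset.mem_compl, Finset.mem_insert, not_or] at hi
    rw [contract_apply, if_neg, map_zsmul, smul_smul, smul_smul,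
      sgn_mul_sgn_insert hi.2 hr hi.1, neg_smul, Finset.insert_comm, neg_add_cancel]
    rw [Finset.mem_insert, not_or]
    exact ⟨fun h => hi.1 h.symm, hr⟩

end

variable {ℓ : ℕ}

/-- The Koszul complex of a regular sequence of commuting endomorphisms is acyclic in positive
degrees. -/
theorem exists_koszulDown_eq (T : Fin ℓ → W →ₗ[S] W)
    (hT : ∀ i j w, T i (T j w) = T j (T i w))
    (hreg : ∀ (i : Fin ℓ) (w : W) (g : Fin ℓ → W), T i w = ∑ j ∈ Finset.Iio i, T j (g j) →
      ∃ g' : Fin ℓ → W, w = ∑ j ∈ Finset.Iio i, T j (g' j))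
    {z : Finset (Fin ℓ) → W} (hz : koszulDown T z = 0) (hz0 : z ∅ = 0) :
    ∃ y, koszulDown T y = z := by
  -- Induction on the number of operators in play, that is, on chains supported on subsets of the
  -- first `r` indices. The normalization `y ∅ = 0` is carried along because otherwise `T r (y ∅)`
  -- would appear in degree zero at the next stage.
  have key : ∀ (r : ℕ), r ≤ ℓ → ∀ z : Finset (Fin ℓ) → W, koszulDown T z = 0 → z ∅ = 0 →
      (∀ J, ∀ i ∈ J, r ≤ i.val → z J = 0) → ∃ y : Finset (Fin ℓ) → W, koszulDown T y = z ∧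
        y ∅ = 0 ∧ ∀ J, ∀ i ∈ J, r ≤ i.val → y J = 0 := by
    intro r
    induction r with
    | zero =>
      intro _ z _ hz0 hs
      refine ⟨0, ?_, rfl, fun _ _ _ _ => rfl⟩
      rw [map_zero]
      ext J
      rcases J.eq_empty_or_nonempty with rfl | ⟨i, hi⟩
      · rw [hz0, Pi.zero_apply]
      · rw [hs J i hi (Nat.zero_le _), Pi.zero_apply]
    | succ n ih =>
      intro hn z hz hz0 hs
      let r : Fin ℓ := ⟨n, hn⟩
      -- `v` collects the part of `z` involving `r`. It is a cycle for the preceding operators, but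
      -- `v ∅ = z {r}` need not vanish; regularity provides `y₀` to correct this.
      set v := contract (S := S) r z with hv
      have hvs : ∀ J, ∀ i ∈ J, n ≤ i.val → v J = 0 := by
        intro J i hi hni
        rw [hv, contract_apply]
        split_ifs with hrJ
        · rfl
        · rw [hs _ i (Finset.mem_insert_of_mem hi), smul_zero]
          refine Nat.lt_of_le_of_ne hni fun h => hrJ ?_
          have : i = r := Fin.ext h.symm
          exact this ▸ hi
      have hDv : koszulDown T v = 0 := by
        ext J
        have := koszulDown_contract_add T r z J
        rwa [hz, map_zero, Pi.zero_apply, add_zero] at this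
      have hv0 : v ∅ = z {r} := by
        rw [hv, contract_apply, if_neg (Finset.notMem_empty r)]
        simp [sgn]
      have hD0 : ∀ y : Finset (Fin ℓ) → W, koszulDown T y ∅ = ∑ i, T i (y {i}) := by
        intro y
        simp [koszulDown_apply, sgn]
      -- The empty component of `koszulDown T z = 0` expresses `T r (z {r})` through the preceding
      -- operators.
      have hreg' : ∃ g : Fin ℓ → W, z {r} = ∑ j ∈ Finset.Iio r, T j (g j) := by
        refine hreg r _ (fun j => -z {j}) ?_
        have h0 := hD0 z
        rw [hz, Pi.zero_apply, ← Finset.sum_subset (Finset.subset_univ (Finset.Iic r)),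
          ← Finset.Iio_insert, Finset.sum_insert (by simp)] at h0
        · simp only [map_neg, Finset.sum_neg_distrib]
          exact eq_neg_of_add_eq_zero_left h0.symm
        · intro j _ hj
          rw [hs {j} j (by simp), map_zero]
          simpa [Fin.lt_def, r] using hj
      obtain ⟨g, hg⟩ := hreg'
      let y₀ : Finset (Fin ℓ) → W := fun J => ∑ j ∈ Finset.Iio r, if J = {j} then g j else 0
      have hy₀1 : ∀ j ∈ Finset.Iio r, y₀ {j} = g j := by
        intro j hj
        simp only [y₀]
        rw [Finset.sum_eq_single j]
        · simp
        · intro i _ hij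
          rw [if_neg]
          simpa using fun h => hij h.symm
        · exact fun h => (h hj).elim
      have hy₀s : ∀ J, ∀ i ∈ J, n ≤ i.val → y₀ J = 0 := by
        intro J i hi hni
        refine Finset.sum_eq_zero fun j hj => if_neg ?_
        rintro rfl
        rw [Finset.mem_singleton] at hi
        subst hi
        have : i.val < n := by simpa [Fin.lt_def, r] using hj
        omega
      have hy₀0 : y₀ ∅ = 0 := Finset.sum_eq_zero fun j _ =>
        if_neg (Finset.singleton_ne_empty j).symm
      have hy₀D : koszulDown T y₀ ∅ = z {r} := by
        rw [hD0, hg, ← Finset.sum_subset (Finset.subset_univ (Finset.Iio r))]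
        · exact Finset.sum_congr rfl fun j hj => by rw [hy₀1 j hj]
        · intro j _ hj
          rw [hy₀s {j} j (by simp), map_zero]
          simpa [Fin.lt_def, r] using hj
      have hDs : ∀ y : Finset (Fin ℓ) → W, (∀ J, ∀ i ∈ J, n ≤ i.val → y J = 0) →
          ∀ J, ∀ i ∈ J, n ≤ i.val → koszulDown T y J = 0 := by
        intro y hy J i hi hni
        rw [koszulDown_apply]
        refine Finset.sum_eq_zero fun j _ => ?_
        rw [hy _ i (Finset.mem_insert_of_mem hi) hni, map_zero, smul_zero]
      obtain ⟨y₁, hy₁, hy₁0, hy₁s⟩ := ih (by omega) (v - koszulDown T y₀)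
        (by rw [map_sub, hDv, koszulDown_koszulDown T hT, sub_zero])
        (by rw [Pi.sub_apply, hv0, hy₀D, sub_self])
        (fun J i hi hni => by
          rw [Pi.sub_apply, hvs J i hi hni, hDs y₀ hy₀s J i hi hni, sub_zero])
      set v' := y₀ + y₁ with hv'
      have hv'D : koszulDown T v' = v := by rw [hv', map_add, hy₁, add_sub_cancel]
      have hv's : ∀ J, ∀ i ∈ J, n ≤ i.val → v' J = 0 := fun J i hi hni => by
        rw [hv', Pi.add_apply, hy₀s J i hi hni, hy₁s J i hi hni, add_zero]
      have hv'0 : v' ∅ = 0 := by rw [hv', Pi.add_apply, hy₀0, hy₁0, add_zero]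
      have hDw : koszulDown T (wedge r v') = (fun J => T r (v' J)) - wedge r v := by
        ext J
        rw [Pi.sub_apply, ← koszulDown_wedge_add T r v' J, hv'D, add_sub_cancel_right]
      -- By the homotopy formula, adding this boundary cancels every term of `z` whose index set
      -- contains `r`.
      obtain ⟨y₂, hy₂, hy₂0, hy₂s⟩ := ih (by omega) (z + koszulDown T (wedge r v'))
        (by rw [map_add, hz, koszulDown_koszulDown T hT, add_zero])
        (by simp [hDw, hz0, wedge, hv'0])
        (fun J i hi hni => by
          rw [hDw, Pi.add_apply, Pi.sub_apply, hv's J i hi hni, map_zero, zero_sub, wedge]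
          by_cases hrJ : r ∈ J
          · rw [if_pos hrJ, hv, contract_apply, if_neg (Finset.notMem_erase r J),
              Finset.insert_erase hrJ, smul_smul, sgn_erase_of_le le_rfl, sgn_mul_self, one_smul,
              add_neg_cancel]
          · rw [if_neg hrJ, neg_zero, add_zero]
            refine hs J i hi (Nat.lt_of_le_of_ne hni fun h => hrJ ?_)
            have : i = r := Fin.ext h.symm
            exact this ▸ hi)
      refine ⟨y₂ - wedge r v', ?_, ?_, ?_⟩
      · rw [map_sub, hy₂, add_sub_cancel_right]
      · simp [hy₂0, wedge]
      · intro J i hi hni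
        rw [Pi.sub_apply, hy₂s J i hi (by omega), wedge, zero_sub, neg_eq_zero]
        split_ifs with hrJ
        · rw [hv's _ i (Finset.mem_erase.2 ⟨?_, hi⟩) (by omega), smul_zero]
          rintro rfl
          simp [r] at hni
        · rfl
  obtain ⟨y, hy, _⟩ := key ℓ le_rfl z hz hz0 fun J i _ hi => absurd i.isLt (by omega)
  exact ⟨y, hy⟩

end Acyclic

/-! ### Fine-graded localizations of the face module -/

section Localization

variable {n : ℕ}

/-- The indicator vector of `F`. -/
def indVec (F : Finset (Fin n)) : Fin n → ℤ := fun i => if i ∈ F then 1 else 0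

/-- The set of indices of the nonzero coordinates of an exponent vector. -/
def suppSet (a : Fin n → ℤ) : Finset (Fin n) := Finset.univ.filter fun i => a i ≠ 0

theorem mem_suppSet {a : Fin n → ℤ} {i : Fin n} : i ∈ suppSet a ↔ a i ≠ 0 := by
  simp [suppSet]

namespace RelativeComplex

variable (Ψ : RelativeComplex n)

theorem isFace_of_subset_of_subset {σ τ υ : Finset (Fin n)} (h1 : Ψ.IsFace σ) (h2 : Ψ.IsFace υ)
    (h3 : σ ⊆ τ) (h4 : τ ⊆ υ) : Ψ.IsFace τ :=
  ⟨Ψ.Δ.lower h4 h2.1, fun h => h1.2 (Ψ.Γ.lower h3 h)⟩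

/-- The exponent `a` belongs to the monomial basis of the localization of the face module at the
product of the variables in `F`. -/
def Adm (F : Finset (Fin n)) (a : Fin n → ℤ) : Prop :=
  (∀ i ∉ F, 0 ≤ a i) ∧ Ψ.IsFace (F ∪ suppSet a)

variable {Ψ}

/-- The faces are convex under inclusion, and `F ∪ suppSet a` can only grow when variables are
inverted or when exponents outside the inverted set increase. -/
theorem Adm.convex {F G H : Finset (Fin n)} {a b c : Fin n → ℤ} (ha : Ψ.Adm F a)
    (hc : Ψ.Adm H c) (hFG : F ⊆ G) (hab : ∀ i ∉ G, a i ≤ b i) (hGH : G ⊆ H)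
    (hbc : ∀ i ∉ H, b i ≤ c i) : Ψ.Adm G b := by
  have h0 : ∀ i ∉ G, 0 ≤ b i := fun i hi => (ha.1 i fun h => hi (hFG h)).trans (hab i hi)
  refine ⟨h0, Ψ.isFace_of_subset_of_subset ha.2 hc.2 (fun i => ?_) (fun i => ?_)⟩
  · simp only [Finset.mem_union, mem_suppSet]
    rintro (h | h)
    · exact Or.inl (hFG h)
    · by_cases hG : i ∈ G
      · exact Or.inl hG
      · have h1 := hab i hG
        have h2 := ha.1 i fun h => hG (hFG h)
        right
        omega
  · simp only [Finset.mem_union, mem_suppSet]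
    rintro (h | h)
    · exact Or.inl (hGH h)
    · by_cases hH : i ∈ H
      · exact Or.inl hH
      · have h1 := hbc i hH
        have h2 := h0 i fun h => hH (hGH h)
        right
        omega

theorem Adm.congr {F G : Finset (Fin n)} {a b : Fin n → ℤ} (ha : Ψ.Adm F a)
    (h0 : ∀ i ∉ G, 0 ≤ b i) (h : F ∪ suppSet a = G ∪ suppSet b) : Ψ.Adm G b :=
  ⟨h0, h ▸ ha.2⟩

variable (Ψ) (𝕜 : Type*) [Field 𝕜]

/-- The localization of the face module at the product of the variables in `F`, as a space of
Laurent polynomials. -/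
def Loc (F : Finset (Fin n)) : Submodule 𝕜 ((Fin n → ℤ) →₀ 𝕜) where
  carrier := {g | ∀ a, g a ≠ 0 → Ψ.Adm F a}
  add_mem' {g h} hg hh a ha := by
    by_contra hF
    apply ha
    rw [Finsupp.add_apply, not_ne_iff.1 (mt (hg a) hF), not_ne_iff.1 (mt (hh a) hF), add_zero]
  zero_mem' a ha := (ha rfl).elim
  smul_mem' c g hg a ha := hg a fun h => ha (by rw [Finsupp.smul_apply, h, smul_zero])

open Classical in
/-- Multiplication by the Laurent monomial of exponent `α`, with values in the localization at the
product of the variables in `F`. -/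
def shiftCut (F : Finset (Fin n)) (α : Fin n → ℤ) :
    ((Fin n → ℤ) →₀ 𝕜) →ₗ[𝕜] ((Fin n → ℤ) →₀ 𝕜) where
  toFun g := (Finsupp.equivMapDomain (Equiv.addRight α) g).filter (Ψ.Adm F)
  map_add' g h := by
    ext a
    by_cases ha : Ψ.Adm F a <;> simp [ha]
  map_smul' c g := by
    ext a
    by_cases ha : Ψ.Adm F a <;> simp [ha]

open Classical in
variable {𝕜} in
theorem shiftCut_apply (F : Finset (Fin n)) (α : Fin n → ℤ) (g : (Fin n → ℤ) →₀ 𝕜)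
    (a : Fin n → ℤ) : Ψ.shiftCut 𝕜 F α g a = if Ψ.Adm F a then g (a - α) else 0 := by
  simp [shiftCut, Finsupp.filter_apply, sub_eq_add_neg]

variable {Ψ 𝕜}

theorem shiftCut_mem (F : Finset (Fin n)) (α : Fin n → ℤ) (g : (Fin n → ℤ) →₀ 𝕜) :
    Ψ.shiftCut 𝕜 F α g ∈ Ψ.Loc 𝕜 F := by
  intro a ha
  by_contra h
  rw [shiftCut_apply, if_neg h] at ha
  exact ha rfl

/-- The intermediate cut loses nothing: by convexity, a monomial admissible at the start and at the
end is admissible in between. -/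
theorem shiftCut_shiftCut {F G H : Finset (Fin n)} {α β : Fin n → ℤ} {g : (Fin n → ℤ) →₀ 𝕜}
    (hg : g ∈ Ψ.Loc 𝕜 H) (hHG : H ⊆ G) (hα : ∀ i ∉ G, 0 ≤ α i) (hGF : G ⊆ F)
    (hβ : ∀ i ∉ F, 0 ≤ β i) :
    Ψ.shiftCut 𝕜 F β (Ψ.shiftCut 𝕜 G α g) = Ψ.shiftCut 𝕜 F (β + α) g := by
  ext a
  rw [shiftCut_apply, shiftCut_apply, shiftCut_apply, sub_sub]
  split_ifs with h1 h2
  · rfl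
  · by_contra hne
    refine h2 ((hg _ (Ne.symm hne)).convex h1 hHG (fun i hi => ?_) hGF (fun i hi => ?_))
    · have := hα i hi
      simp only [Pi.sub_apply, Pi.add_apply]
      omega
    · have := hβ i hi
      simp only [Pi.sub_apply]
      omega
  · rfl

/-- The localization map from the face module, multiplied by `(∏ i ∈ F, x i) ^ (-t)`. -/
abbrev locMap (Ψ : RelativeComplex n) (𝕜 : Type*) [Field 𝕜] (F : Finset (Fin n)) (t : ℕ) :
    ((Fin n → ℤ) →₀ 𝕜) →ₗ[𝕜] ((Fin n → ℤ) →₀ 𝕜) :=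
  Ψ.shiftCut 𝕜 F (-(t • indVec F))

theorem indVec_of_mem {F : Finset (Fin n)} {i : Fin n} (h : i ∈ F) : indVec F i = 1 := if_pos h

theorem indVec_of_notMem {F : Finset (Fin n)} {i : Fin n} (h : i ∉ F) : indVec F i = 0 := if_neg h

/-- This clears denominators. The bound makes all exponents on `F` strictly positive after
multiplication by `x_F ^ t`, so that `F` lies in the support and the face `F ∪ suppSet a` is
unchanged. -/
theorem exists_locMap_eq {F : Finset (Fin n)} {g : (Fin n → ℤ) →₀ 𝕜} (hg : g ∈ Ψ.Loc 𝕜 F) :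
    ∃ t₀ : ℕ, ∀ t ≥ t₀, ∃ m ∈ Ψ.Loc 𝕜 ∅, Ψ.locMap 𝕜 F t m = g := by
  refine ⟨∑ a ∈ g.support, ∑ i, ((a i).natAbs + 1), fun t ht => ?_⟩
  have hbound : ∀ a, g a ≠ 0 → ∀ i, 0 < a i + t := by
    intro a ha i
    have h1 : (a i).natAbs + 1 ≤ ∑ i, ((a i).natAbs + 1) :=
      Finset.single_le_sum (f := fun i => (a i).natAbs + 1) (fun _ _ => Nat.zero_le _)
        (Finset.mem_univ i)
    have h2 : ∑ i, ((a i).natAbs + 1) ≤ ∑ a ∈ g.support, ∑ i, ((a i).natAbs + 1) :=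
      Finset.single_le_sum (f := fun a : Fin n → ℤ => ∑ i, ((a i).natAbs + 1))
        (fun _ _ => Nat.zero_le _) (Finsupp.mem_support_iff.2 ha)
    omega
  refine ⟨Finsupp.equivMapDomain (Equiv.addRight (t • indVec F)) g, fun b hb => ?_, ?_⟩
  · rw [Finsupp.equivMapDomain_apply] at hb
    simp only [Equiv.addRight_symm, Equiv.coe_addRight] at hb
    refine (hg _ hb).congr (fun i _ => ?_) (Finset.ext fun i => ?_)
    · by_cases hi : i ∈ F
      · have := hbound _ hb i
        simp [indVec_of_mem hi] at this
        omega
      · have := (hg _ hb).1 i hi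
        simpa [indVec_of_notMem hi] using this
    · simp only [Finset.mem_union, mem_suppSet, Finset.notMem_empty, false_or]
      by_cases hi : i ∈ F
      · have := hbound _ hb i
        simp [indVec_of_mem hi] at this
        simp [hi]
        omega
      · simp [hi, indVec_of_notMem hi]
  · ext a
    rw [shiftCut_apply, Finsupp.equivMapDomain_apply]
    simp only [Equiv.addRight_symm, Equiv.coe_addRight, sub_neg_eq_add, add_neg_cancel_right]
    split_ifs with h
    · rfl
    · exact (not_ne_iff.1 (mt (hg a) h)).symm

/-- One factor `x_F` suffices, whatever `t` is, since being a face depends on the support of a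
monomial and not on its exponents. -/
theorem shiftCut_indVec_eq_zero {F : Finset (Fin n)} {t : ℕ} {m : (Fin n → ℤ) →₀ 𝕜}
    (hm : m ∈ Ψ.Loc 𝕜 ∅) (h : Ψ.locMap 𝕜 F t m = 0) :
    Ψ.shiftCut 𝕜 ∅ (indVec F) m = 0 := by
  ext b
  rw [shiftCut_apply, Finsupp.zero_apply]
  split_ifs with hb
  · by_contra hne
    have hm' := hm _ hne
    have hpos : ∀ i ∈ F, 0 < b i := by
      intro i hi
      have := hm'.1 i (Finset.notMem_empty i)
      simp [indVec_of_mem hi] at this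
      omega
    have hadm : Ψ.Adm F (b - indVec F - t • indVec F) := by
      refine hb.congr (fun i hi => ?_) (Finset.ext fun i => ?_)
      · simpa [indVec_of_notMem hi] using hb.1 i (Finset.notMem_empty i)
      · simp only [Finset.mem_union, mem_suppSet, Finset.notMem_empty, false_or]
        by_cases hi : i ∈ F
        · simp [hi, (hpos i hi).ne']
        · simp [hi, indVec_of_notMem hi]
    apply hne
    have := DFunLike.congr_fun h (b - indVec F - t • indVec F)
    rw [shiftCut_apply, if_pos hadm, Finsupp.zero_apply] at this
    simpa using this
  · rfl

/-! ### The face module as a space of Laurent polynomials -/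

/-- The exponent of an ordinary monomial, as an exponent of a Laurent monomial. -/
def toExp (u : Fin n →₀ ℕ) : Fin n → ℤ := fun i => u i

/-- The nonnegative part of an exponent vector. -/
def natExp (a : Fin n → ℤ) : Fin n →₀ ℕ := Finsupp.equivFunOnFinite.symm fun i => (a i).toNat

theorem natExp_apply (a : Fin n → ℤ) (i : Fin n) : natExp a i = (a i).toNat := rfl

theorem toExp_natExp {a : Fin n → ℤ} (ha : ∀ i, 0 ≤ a i) : toExp (natExp a) = a := by
  ext i
  simp [toExp, natExp_apply, ha i]

theorem natExp_toExp (u : Fin n →₀ ℕ) : natExp (toExp u) = u := by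
  ext i
  simp [toExp, natExp_apply]

theorem suppSet_toExp (u : Fin n →₀ ℕ) : suppSet (toExp u) = u.support := by
  ext i
  simp [mem_suppSet, toExp]

theorem adm_empty_iff {a : Fin n → ℤ} :
    Ψ.Adm ∅ a ↔ (∀ i, 0 ≤ a i) ∧ Ψ.IsFace (natExp a).support := by
  have : (∀ i, 0 ≤ a i) → suppSet a = (natExp a).support := fun h => by
    rw [← suppSet_toExp, toExp_natExp h]
  simp only [Adm, Finset.notMem_empty, not_false_eq_true, forall_const, Finset.empty_union]
  exact and_congr_right fun h => by rw [this h]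

/-- The ideal is monomial, so membership is tested term by term, and `x^τ` divides `x^u` exactly
when `τ ⊆ u.support`. -/
theorem mem_faceIdeal_iff (Δ : SimplicialComplex n) (p : MvPolynomial (Fin n) 𝕜) :
    p ∈ faceIdeal 𝕜 Δ ↔ ∀ u, p.coeff u ≠ 0 → u.support ∉ Δ := by
  have e : {p : MvPolynomial (Fin n) 𝕜 | ∃ τ : Finset (Fin n), τ ∉ Δ ∧ p = ∏ i ∈ τ, X i} =
      (fun s => monomial s (1 : 𝕜)) '' {s | ∃ τ : Finset (Fin n), τ ∉ Δ ∧
        s = ∑ i ∈ τ, Finsupp.single i 1} := by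
    ext p
    constructor
    · rintro ⟨τ, hτ, rfl⟩
      refine ⟨_, ⟨τ, hτ, rfl⟩, ?_⟩
      simp only [X, monomial_sum_one]
    · rintro ⟨_, ⟨τ, hτ, rfl⟩, rfl⟩
      refine ⟨τ, hτ, ?_⟩
      simp only [X, monomial_sum_one]
  rw [faceIdeal, e, mem_ideal_span_monomial_image]
  have hs : ∀ (τ : Finset (Fin n)) (u : Fin n →₀ ℕ),
      ∑ i ∈ τ, Finsupp.single i 1 ≤ u ↔ τ ⊆ u.support := by
    intro τ u
    rw [Finsupp.le_def]
    refine forall_congr' fun i => ?_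
    rw [Finsupp.finsetSum_apply, Finsupp.mem_support_iff]
    by_cases hi : i ∈ τ <;> simp [hi, Finsupp.single_apply, Nat.one_le_iff_ne_zero]
  refine forall_congr' fun u => ?_
  rw [mem_support_iff]
  refine imp_congr_right fun _ => ?_
  constructor
  · rintro ⟨_, ⟨τ, hτ, rfl⟩, h⟩ hu
    exact hτ (Δ.lower ((hs τ u).1 h) hu)
  · intro hu
    exact ⟨_, ⟨u.support, hu, rfl⟩, (hs _ _).2 subset_rfl⟩

open Classical in
/-- The terms of a polynomial whose support is a face. -/
def faceTerms (Ψ : RelativeComplex n) (𝕜 : Type*) [Field 𝕜] :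
    MvPolynomial (Fin n) 𝕜 →ₗ[𝕜] ((Fin n → ℤ) →₀ 𝕜) where
  toFun p := Finsupp.onFinset (p.support.image toExp)
    (fun a => if Ψ.Adm ∅ a then p.coeff (natExp a) else 0) fun a ha => by
      split_ifs at ha with h
      · exact Finset.mem_image.2 ⟨natExp a, mem_support_iff.2 ha,
          toExp_natExp (adm_empty_iff.1 h).1⟩
      · exact (ha rfl).elim
  map_add' p q := by
    ext a
    by_cases ha : Ψ.Adm ∅ a <;> simp [ha]
  map_smul' c p := by
    ext a
    by_cases ha : Ψ.Adm ∅ a <;> simp [ha]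

open Classical in
theorem faceTerms_apply (p : MvPolynomial (Fin n) 𝕜) (a : Fin n → ℤ) :
    Ψ.faceTerms 𝕜 p a = if Ψ.Adm ∅ a then p.coeff (natExp a) else 0 := rfl

theorem faceTerms_eq_zero {p : MvPolynomial (Fin n) 𝕜} (hp : p ∈ faceIdeal 𝕜 Ψ.Δ) :
    Ψ.faceTerms 𝕜 p = 0 := by
  ext a
  rw [faceTerms_apply, Finsupp.zero_apply]
  split_ifs with h
  · by_contra hne
    exact (mem_faceIdeal_iff _ _).1 hp _ hne (adm_empty_iff.1 h).2.1
  · rfl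

theorem mem_faceModule_iff (p : MvPolynomial (Fin n) 𝕜) :
    Ideal.Quotient.mk (faceIdeal 𝕜 Ψ.Δ) p ∈ Ψ.faceModule 𝕜 ↔ p ∈ faceIdeal 𝕜 Ψ.Γ := by
  rw [faceModule, LinearMap.mem_ker]
  exact Ideal.Quotient.eq_zero_iff_mem

theorem exists_mk_eq (m : Ψ.faceModule 𝕜) :
    ∃ p : MvPolynomial (Fin n) 𝕜, Ideal.Quotient.mk (faceIdeal 𝕜 Ψ.Δ) p = m.1 :=
  Ideal.Quotient.mk_surjective m.1

theorem smul_eq_mk_mul {I : Ideal (MvPolynomial (Fin n) 𝕜)} (p : MvPolynomial (Fin n) 𝕜)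
    (x : MvPolynomial (Fin n) 𝕜 ⧸ I) : p • x = Ideal.Quotient.mk I p * x := by
  obtain ⟨q, rfl⟩ := Ideal.Quotient.mk_surjective x
  rfl

theorem faceTerms_congr {p q : MvPolynomial (Fin n) 𝕜}
    (h : Ideal.Quotient.mk (faceIdeal 𝕜 Ψ.Δ) p = Ideal.Quotient.mk (faceIdeal 𝕜 Ψ.Δ) q) :
    Ψ.faceTerms 𝕜 p = Ψ.faceTerms 𝕜 q := by
  rw [← sub_eq_zero, ← map_sub]
  exact faceTerms_eq_zero (Ideal.Quotient.eq.1 h)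

/-- The face module embedded in the space of Laurent polynomials. -/
def toLaurent (Ψ : RelativeComplex n) (𝕜 : Type*) [Field 𝕜] :
    Ψ.faceModule 𝕜 →ₗ[𝕜] ((Fin n → ℤ) →₀ 𝕜) where
  toFun m := Ψ.faceTerms 𝕜 (exists_mk_eq m).choose
  map_add' m m' := by
    rw [← map_add]
    refine faceTerms_congr ?_
    rw [map_add, (exists_mk_eq m).choose_spec, (exists_mk_eq m').choose_spec,
      (exists_mk_eq (m + m')).choose_spec]
    rfl
  map_smul' c m := by
    rw [← map_smul]
    refine faceTerms_congr ?_
    rw [(exists_mk_eq (c • m)).choose_spec, smul_eq_C_mul, map_mul,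
      (exists_mk_eq m).choose_spec]
    rw [SetLike.val_smul_of_tower, ← algebraMap_smul (MvPolynomial (Fin n) 𝕜) c m.1,
      smul_eq_mk_mul]
    rfl

theorem toLaurent_eq {m : Ψ.faceModule 𝕜} {p : MvPolynomial (Fin n) 𝕜}
    (h : Ideal.Quotient.mk (faceIdeal 𝕜 Ψ.Δ) p = m.1) : Ψ.toLaurent 𝕜 m = Ψ.faceTerms 𝕜 p :=
  faceTerms_congr ((exists_mk_eq m).choose_spec.trans h.symm)

theorem toLaurent_mem (m : Ψ.faceModule 𝕜) : Ψ.toLaurent 𝕜 m ∈ Ψ.Loc 𝕜 ∅ := by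
  obtain ⟨p, hp⟩ := exists_mk_eq m
  rw [toLaurent_eq hp]
  intro a ha
  by_contra h
  exact ha (by rw [faceTerms_apply, if_neg h])

theorem coeff_eq_zero_of_mk_eq {m : Ψ.faceModule 𝕜} {p : MvPolynomial (Fin n) 𝕜}
    (h : Ideal.Quotient.mk (faceIdeal 𝕜 Ψ.Δ) p = m.1) {u : Fin n →₀ ℕ} (hu : u.support ∈ Ψ.Γ) :
    p.coeff u = 0 := by
  by_contra hne
  have hp : p ∈ faceIdeal 𝕜 Ψ.Γ := (mem_faceModule_iff p).1 (h ▸ m.2)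
  exact (mem_faceIdeal_iff _ _).1 hp u hne hu

theorem toLaurent_injective : Function.Injective (Ψ.toLaurent 𝕜) := by
  rw [injective_iff_map_eq_zero]
  intro m hm
  obtain ⟨p, hp⟩ := exists_mk_eq m
  rw [toLaurent_eq hp] at hm
  ext1
  rw [← hp, ZeroMemClass.coe_zero, Ideal.Quotient.eq_zero_iff_mem, mem_faceIdeal_iff]
  intro u hu hΔ
  by_cases hΓ : u.support ∈ Ψ.Γ
  · exact hu (coeff_eq_zero_of_mk_eq hp hΓ)
  · have := DFunLike.congr_fun hm (toExp u)
    rw [faceTerms_apply, if_pos, natExp_toExp] at this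
    · exact hu this
    · rw [adm_empty_iff, natExp_toExp]
      exact ⟨fun i => Int.natCast_nonneg _, hΔ, hΓ⟩

theorem exists_toLaurent_eq {g : (Fin n → ℤ) →₀ 𝕜} (hg : g ∈ Ψ.Loc 𝕜 ∅) :
    ∃ m, Ψ.toLaurent 𝕜 m = g := by
  let p : MvPolynomial (Fin n) 𝕜 := ∑ a ∈ g.support, monomial (natExp a) (g a)
  have hcoeff : ∀ u, p.coeff u = g (toExp u) := by
    intro u
    simp only [p, coeff_sum, coeff_monomial]
    rw [Finset.sum_eq_single (toExp u)]
    · rw [if_pos (natExp_toExp u)]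
    · intro a ha hau
      rw [if_neg]
      rintro rfl
      exact hau (toExp_natExp (adm_empty_iff.1 (hg a (Finsupp.mem_support_iff.1 ha))).1).symm
    · intro h
      rw [Finsupp.notMem_support_iff.1 h, ite_self]
  have hp : p ∈ faceIdeal 𝕜 Ψ.Γ := by
    rw [mem_faceIdeal_iff]
    intro u hu
    rw [hcoeff] at hu
    have := (adm_empty_iff.1 (hg _ hu)).2.2
    rwa [natExp_toExp] at this
  refine ⟨⟨Ideal.Quotient.mk _ p, (mem_faceModule_iff p).2 hp⟩, ?_⟩
  rw [toLaurent_eq rfl]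
  ext a
  rw [faceTerms_apply, hcoeff]
  split_ifs with h
  · rw [toExp_natExp (adm_empty_iff.1 h).1]
  · exact (not_ne_iff.1 (mt (hg a) h)).symm

theorem toLaurent_monomial_smul (u : Fin n →₀ ℕ) (c : 𝕜) (m : Ψ.faceModule 𝕜) :
    Ψ.toLaurent 𝕜 (monomial u c • m) = c • Ψ.shiftCut 𝕜 ∅ (toExp u) (Ψ.toLaurent 𝕜 m) := by
  obtain ⟨p, hp⟩ := exists_mk_eq m
  have hp' : Ideal.Quotient.mk (faceIdeal 𝕜 Ψ.Δ) (monomial u c * p) = (monomial u c • m).1 := by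
    rw [map_mul, hp, SetLike.val_smul, smul_eq_mk_mul]
  rw [toLaurent_eq hp, toLaurent_eq hp']
  ext a
  rw [faceTerms_apply, Finsupp.smul_apply, shiftCut_apply, faceTerms_apply]
  by_cases h : Ψ.Adm ∅ a
  · have h0 := (adm_empty_iff.1 h).1
    rw [if_pos h, if_pos h, coeff_monomial_mul']
    by_cases hu : u ≤ natExp a
    · have e : natExp (a - toExp u) = natExp a - u := by
        ext i
        simp only [natExp_apply, Pi.sub_apply, Finsupp.tsub_apply, toExp]
        omega
      have hle : ∀ i, (u i : ℤ) ≤ a i := fun i => by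
        have h1 : u i ≤ (a i).toNat := hu i
        have := h0 i
        omega
      rw [if_pos hu, e, smul_eq_mul]
      split_ifs with h'
      · rfl
      -- The remaining monomial divides a face monomial without being one, so its support lies in
      -- `Γ`, where representatives of elements of the face module have no terms.
      · rw [coeff_eq_zero_of_mk_eq hp, mul_zero]
        by_contra hΓ
        refine h' (adm_empty_iff.2 ⟨fun i => sub_nonneg.2 (hle i), ?_, ?_⟩)
        · refine Ψ.Δ.lower ?_ (adm_empty_iff.1 h).2.1
          rw [e]
          intro i
          simp only [Finsupp.mem_support_iff, Finsupp.tsub_apply]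
          omega
        · rwa [e]
    · rw [if_neg hu, if_neg, smul_zero]
      intro h'
      refine hu fun i => ?_
      have h1 := h'.1 i (Finset.notMem_empty i)
      rw [Pi.sub_apply] at h1
      simp only [toExp] at h1
      rw [natExp_apply]
      omega
  · rw [if_neg h, if_neg h, smul_zero]

theorem toLaurent_X_pow_smul (i : Fin n) (t : ℕ) (m : Ψ.faceModule 𝕜) :
    Ψ.toLaurent 𝕜 ((X i : MvPolynomial (Fin n) 𝕜) ^ t • m) =
      Ψ.shiftCut 𝕜 ∅ (t • indVec {i}) (Ψ.toLaurent 𝕜 m) := by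
  rw [X_pow_eq_monomial, toLaurent_monomial_smul, one_smul]
  congr 2
  ext j
  by_cases h : j = i <;> simp [toExp, indVec, h]

theorem toLaurent_X_smul (i : Fin n) (m : Ψ.faceModule 𝕜) :
    Ψ.toLaurent 𝕜 ((X i : MvPolynomial (Fin n) 𝕜) • m) =
      Ψ.shiftCut 𝕜 ∅ (indVec {i}) (Ψ.toLaurent 𝕜 m) := by
  have := toLaurent_X_pow_smul (Ψ := Ψ) i 1 m
  rwa [pow_one, one_smul] at this

theorem toLaurent_prod_X_pow_smul (F : Finset (Fin n)) (t : ℕ) (m : Ψ.faceModule 𝕜) :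
    Ψ.toLaurent 𝕜 ((∏ i ∈ F, (X i : MvPolynomial (Fin n) 𝕜) ^ t) • m) =
      Ψ.shiftCut 𝕜 ∅ (t • indVec F) (Ψ.toLaurent 𝕜 m) := by
  have : ∏ i ∈ F, (X i : MvPolynomial (Fin n) 𝕜) ^ t =
      monomial (∑ i ∈ F, Finsupp.single i t) 1 := by
    simp only [X_pow_eq_monomial, monomial_sum_one]
  rw [this, toLaurent_monomial_smul, one_smul]
  congr 2
  ext j
  by_cases h : j ∈ F <;> simp [toExp, indVec, h, Finsupp.single_apply]

theorem linear_form_eq_sum {θ : MvPolynomial (Fin n) 𝕜} (hθ : θ.IsHomogeneous 1) :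
    θ = ∑ i, monomial (Finsupp.single i 1) (θ.coeff (Finsupp.single i 1)) := by
  ext u
  rw [coeff_sum]
  simp only [coeff_monomial]
  by_cases hu : u.degree = 1
  · obtain ⟨i, rfl⟩ := (Finsupp.sum_eq_one_iff u).1 hu
    rw [Finset.sum_eq_single i]
    · simp
    · intro j _ hj
      rw [if_neg]
      intro h
      exact hj (Finsupp.single_left_injective one_ne_zero h)
    · simp
  · rw [hθ.coeff_eq_zero hu, Finset.sum_eq_zero]
    intro i _
    rw [if_neg]
    rintro rfl
    simp at hu

theorem toLaurent_linear_smul {θ : MvPolynomial (Fin n) 𝕜} (hθ : θ.IsHomogeneous 1)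
    (m : Ψ.faceModule 𝕜) :
    Ψ.toLaurent 𝕜 (θ • m) = ∑ i, θ.coeff (Finsupp.single i 1) •
      Ψ.shiftCut 𝕜 ∅ (indVec {i}) (Ψ.toLaurent 𝕜 m) := by
  conv_lhs => rw [linear_form_eq_sum hθ]
  rw [Finset.sum_smul, map_sum]
  refine Finset.sum_congr rfl fun i _ => ?_
  rw [toLaurent_monomial_smul]
  congr 3
  ext j
  by_cases h : j = i <;> simp [toExp, indVec, h]

theorem mem_component_iff (m : Ψ.faceModule 𝕜) (j : ℕ) :
    m ∈ Ψ.component 𝕜 j ↔ ∀ a, Ψ.toLaurent 𝕜 m a ≠ 0 → ∑ i, a i = j := by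
  have hdeg : ∀ a : Fin n → ℤ, (∀ i, 0 ≤ a i) → (∑ i, a i = j ↔ (natExp a).degree = j) := by
    intro a ha
    rw [Finsupp.degree_eq_sum]
    conv_lhs => rw [← toExp_natExp ha]
    simp only [toExp]
    exact_mod_cast Iff.rfl
  constructor
  · rintro ⟨p, hp, hpm⟩ a ha
    have hpm' : Ideal.Quotient.mk (faceIdeal 𝕜 Ψ.Δ) p = m.1 := hpm
    rw [toLaurent_eq hpm', faceTerms_apply] at ha
    split_ifs at ha with h
    · rw [hdeg a (adm_empty_iff.1 h).1]
      by_contra hne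
      exact ha (IsHomogeneous.coeff_eq_zero hp hne)
    · exact (ha rfl).elim
  · intro h
    obtain ⟨p, hp⟩ := exists_mk_eq m
    refine ⟨homogeneousComponent j p, homogeneousComponent_mem _ _, ?_⟩
    change Ideal.Quotient.mk (faceIdeal 𝕜 Ψ.Δ) (homogeneousComponent j p) = m.1
    rw [← hp, ← sub_eq_zero, ← map_sub, Ideal.Quotient.eq_zero_iff_mem, mem_faceIdeal_iff]
    intro u hu hΔ
    rw [coeff_sub, coeff_homogeneousComponent] at hu
    split_ifs at hu with hd
    · exact hu (sub_self _)
    · rw [zero_sub, neg_ne_zero] at hu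
      have hΓ : u.support ∉ Ψ.Γ := fun hΓ => hu (coeff_eq_zero_of_mk_eq hp hΓ)
      have hadm : Ψ.Adm ∅ (toExp u) := by
        rw [adm_empty_iff, natExp_toExp]
        exact ⟨fun i => Int.natCast_nonneg _, hΔ, hΓ⟩
      have := h (toExp u) (by rwa [toLaurent_eq hp, faceTerms_apply, if_pos hadm, natExp_toExp])
      rw [hdeg (toExp u) fun i => Int.natCast_nonneg _, natExp_toExp] at this
      exact hd this

end RelativeComplex

end Localization

/-! ### Regularity on the localizations and exactness of the Čech complex -/

section Cech

namespace RelativeComplex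

variable {n : ℕ} {Ψ : RelativeComplex n} {𝕜 : Type*} [Field 𝕜]

theorem indVec_nonneg (F : Finset (Fin n)) (i : Fin n) : 0 ≤ indVec F i := by
  unfold indVec
  split_ifs <;> simp

theorem smul_indVec_nonneg (F : Finset (Fin n)) (t : ℕ) (i : Fin n) : 0 ≤ (t • indVec F) i :=
  nsmul_nonneg (indVec_nonneg F i) t

theorem zero_apply_nonneg (i : Fin n) : 0 ≤ (0 : Fin n → ℤ) i := le_rfl

theorem shiftCut_empty_comp {α β : Fin n → ℤ} (hα : ∀ i, 0 ≤ α i) (hβ : ∀ i, 0 ≤ β i)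
    {m : (Fin n → ℤ) →₀ 𝕜} (hm : m ∈ Ψ.Loc 𝕜 ∅) :
    Ψ.shiftCut 𝕜 ∅ β (Ψ.shiftCut 𝕜 ∅ α m) = Ψ.shiftCut 𝕜 ∅ (β + α) m :=
  shiftCut_shiftCut hm subset_rfl (fun i _ => hα i) subset_rfl (fun i _ => hβ i)

theorem neg_smul_indVec_nonneg {F : Finset (Fin n)} (t : ℕ) :
    ∀ i ∉ F, 0 ≤ (-(t • indVec F)) i := fun i hi => by
  simp [indVec_of_notMem hi]

theorem locMap_shiftCut {F : Finset (Fin n)} {t : ℕ} {α : Fin n → ℤ} (hα : ∀ i, 0 ≤ α i)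
    {m : (Fin n → ℤ) →₀ 𝕜} (hm : m ∈ Ψ.Loc 𝕜 ∅) :
    Ψ.locMap 𝕜 F t (Ψ.shiftCut 𝕜 ∅ α m) = Ψ.shiftCut 𝕜 F (-(t • indVec F) + α) m :=
  shiftCut_shiftCut hm subset_rfl (fun i _ => hα i) (Finset.empty_subset F)
    (neg_smul_indVec_nonneg t)

theorem shiftCut_locMap {F G : Finset (Fin n)} {t : ℕ} {α : Fin n → ℤ} (hGF : G ⊆ F)
    (hα : ∀ i, 0 ≤ α i) {m : (Fin n → ℤ) →₀ 𝕜} (hm : m ∈ Ψ.Loc 𝕜 ∅) :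
    Ψ.shiftCut 𝕜 F α (Ψ.locMap 𝕜 G t m) = Ψ.shiftCut 𝕜 F (α + -(t • indVec G)) m :=
  shiftCut_shiftCut hm (Finset.empty_subset G) (neg_smul_indVec_nonneg t) hGF fun i _ => hα i

theorem locMap_add_shiftCut {F : Finset (Fin n)} {t s : ℕ} {m : (Fin n → ℤ) →₀ 𝕜}
    (hm : m ∈ Ψ.Loc 𝕜 ∅) :
    Ψ.locMap 𝕜 F (t + s) (Ψ.shiftCut 𝕜 ∅ (s • indVec F) m) = Ψ.locMap 𝕜 F t m := by
  rw [locMap_shiftCut (smul_indVec_nonneg F s) hm]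
  congr 2
  rw [add_smul, neg_add, neg_add_cancel_right]

/-- Multiplication by a linear form on the localization at the product of the variables in `F`. -/
def linOp (Ψ : RelativeComplex n) (F : Finset (Fin n)) (θ : MvPolynomial (Fin n) 𝕜) :
    ((Fin n → ℤ) →₀ 𝕜) →ₗ[𝕜] ((Fin n → ℤ) →₀ 𝕜) :=
  ∑ i, θ.coeff (Finsupp.single i 1) • Ψ.shiftCut 𝕜 F (indVec {i})

theorem linOp_apply (F : Finset (Fin n)) (θ : MvPolynomial (Fin n) 𝕜) (g : (Fin n → ℤ) →₀ 𝕜) :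
    Ψ.linOp F θ g = ∑ i, θ.coeff (Finsupp.single i 1) • Ψ.shiftCut 𝕜 F (indVec {i}) g := by
  simp [linOp]

theorem linOp_mem (F : Finset (Fin n)) (θ : MvPolynomial (Fin n) 𝕜) (g : (Fin n → ℤ) →₀ 𝕜) :
    Ψ.linOp F θ g ∈ Ψ.Loc 𝕜 F := by
  rw [linOp_apply]
  exact Submodule.sum_mem _ fun i _ => Submodule.smul_mem _ _ (shiftCut_mem _ _ _)

theorem linOp_comm {F : Finset (Fin n)} (θ θ' : MvPolynomial (Fin n) 𝕜)
    {g : (Fin n → ℤ) →₀ 𝕜} (hg : g ∈ Ψ.Loc 𝕜 F) :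
    Ψ.linOp F θ (Ψ.linOp F θ' g) = Ψ.linOp F θ' (Ψ.linOp F θ g) := by
  simp only [linOp_apply, map_sum, map_smul, Finset.smul_sum]
  rw [Finset.sum_comm]
  refine Finset.sum_congr rfl fun i _ => Finset.sum_congr rfl fun j _ => ?_
  rw [shiftCut_shiftCut hg subset_rfl (fun k _ => indVec_nonneg _ k) subset_rfl
    (fun k _ => indVec_nonneg _ k), shiftCut_shiftCut hg subset_rfl (fun k _ => indVec_nonneg _ k)
    subset_rfl (fun k _ => indVec_nonneg _ k), add_comm, smul_comm]

theorem shiftCut_linOp {F G : Finset (Fin n)} (hGF : G ⊆ F) (θ : MvPolynomial (Fin n) 𝕜)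
    {g : (Fin n → ℤ) →₀ 𝕜} (hg : g ∈ Ψ.Loc 𝕜 G) :
    Ψ.shiftCut 𝕜 F 0 (Ψ.linOp G θ g) = Ψ.linOp F θ (Ψ.shiftCut 𝕜 F 0 g) := by
  simp only [linOp_apply, map_sum, map_smul]
  refine Finset.sum_congr rfl fun i _ => ?_
  rw [shiftCut_shiftCut hg subset_rfl (fun k _ => indVec_nonneg {i} k) hGF
      (fun k _ => zero_apply_nonneg k),
    shiftCut_shiftCut hg hGF (fun k _ => zero_apply_nonneg k) subset_rfl
      (fun k _ => indVec_nonneg _ k),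
    add_comm]

theorem locMap_linOp {F : Finset (Fin n)} {t : ℕ} (θ : MvPolynomial (Fin n) 𝕜)
    {m : (Fin n → ℤ) →₀ 𝕜} (hm : m ∈ Ψ.Loc 𝕜 ∅) :
    Ψ.locMap 𝕜 F t (Ψ.linOp ∅ θ m) = Ψ.linOp F θ (Ψ.locMap 𝕜 F t m) := by
  simp only [linOp_apply, map_sum, map_smul]
  refine Finset.sum_congr rfl fun i _ => ?_
  rw [locMap_shiftCut (indVec_nonneg _) hm, shiftCut_locMap subset_rfl (indVec_nonneg _) hm,
    add_comm]

theorem toLaurent_smul {θ : MvPolynomial (Fin n) 𝕜} (hθ : θ.IsHomogeneous 1)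
    (m : Ψ.faceModule 𝕜) :
    Ψ.toLaurent 𝕜 (θ • m) = Ψ.linOp ∅ θ (Ψ.toLaurent 𝕜 m) := by
  rw [toLaurent_linear_smul hθ, linOp_apply]

end RelativeComplex

theorem mem_span_image_smul_top_iff {R M κ : Type*} [CommRing R] [AddCommGroup M] [Module R M]
    (Θ : κ → R) (s : Finset κ) (m : M) :
    m ∈ (Ideal.span (Θ '' s) • ⊤ : Submodule R M) ↔ ∃ g : κ → M, m = ∑ j ∈ s, Θ j • g j := by
  constructor
  · intro hm
    let P : Submodule R M := LinearMap.range (∑ j ∈ s, Θ j • LinearMap.proj (R := R)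
      (φ := fun _ : κ => M) j)
    have hP : ∀ x, x ∈ P ↔ ∃ g : κ → M, x = ∑ j ∈ s, Θ j • g j := by
      intro x
      simp [P, LinearMap.mem_range, eq_comm]
    rw [← hP]
    have hle : Ideal.span (Θ '' s) • ⊤ ≤ P := by
      rw [Submodule.smul_le]
      intro r hr x _
      have : Ideal.span (Θ '' s) ≤ P.comap (LinearMap.toSpanSingleton R M x) := by
        rw [Ideal.span_le]
        rintro _ ⟨j, hj, rfl⟩
        classical
        rw [SetLike.mem_coe, Submodule.mem_comap, hP, LinearMap.toSpanSingleton_apply]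
        refine ⟨Pi.single j x, ?_⟩
        rw [Finset.sum_eq_single j]
        · rw [Pi.single_eq_same]
        · intro i _ hij
          rw [Pi.single_eq_of_ne hij, smul_zero]
        · exact fun h => (h hj).elim
      exact this hr
    exact hle hm
  · rintro ⟨g, rfl⟩
    exact Submodule.sum_mem _ fun j hj =>
      Submodule.smul_mem_smul (Ideal.subset_span ⟨j, hj, rfl⟩) trivial

namespace RelativeComplex

variable {n : ℕ} {Ψ : RelativeComplex n} {𝕜 : Type*} [Field 𝕜]

theorem mem_initialSubmodule_iff {ℓ : ℕ} (Θ : Fin ℓ → MvPolynomial (Fin n) 𝕜) (i : Fin ℓ)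
    {M : Type*} [AddCommGroup M] [Module (MvPolynomial (Fin n) 𝕜) M] (m : M) :
    m ∈ initialSubmodule M Θ i ↔ ∃ g : Fin ℓ → M, m = ∑ j ∈ Finset.Iio i, Θ j • g j := by
  rw [← mem_span_image_smul_top_iff, Finset.coe_Iio]
  rfl

theorem exists_lift {F : Finset (Fin n)} {g : (Fin n → ℤ) →₀ 𝕜} (hg : g ∈ Ψ.Loc 𝕜 F) :
    ∃ t₀ : ℕ, ∀ t ≥ t₀, ∃ m, Ψ.locMap 𝕜 F t (Ψ.toLaurent 𝕜 m) = g := by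
  obtain ⟨t₀, h⟩ := exists_locMap_eq hg
  refine ⟨t₀, fun t ht => ?_⟩
  obtain ⟨m, hm, hmg⟩ := h t ht
  obtain ⟨m, rfl⟩ := exists_toLaurent_eq hm
  exact ⟨m, hmg⟩

theorem prod_X_smul_eq_zero {F : Finset (Fin n)} {t : ℕ} {m : Ψ.faceModule 𝕜}
    (h : Ψ.locMap 𝕜 F t (Ψ.toLaurent 𝕜 m) = 0) :
    (∏ i ∈ F, (X i : MvPolynomial (Fin n) 𝕜) ^ 1) • m = 0 := by
  apply toLaurent_injective
  rw [toLaurent_prod_X_pow_smul, one_smul, shiftCut_indVec_eq_zero (toLaurent_mem m) h, map_zero]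

/-- A sequence of linear forms that is weakly regular on the face module is regular on its
localizations. -/
theorem linOp_regular {ℓ : ℕ} {Θ : Fin ℓ → MvPolynomial (Fin n) 𝕜}
    (hΘ : ∀ i, (Θ i).IsHomogeneous 1)
    (hW : ∀ (i : Fin ℓ) (m : Ψ.faceModule 𝕜), Θ i • m ∈ initialSubmodule (Ψ.faceModule 𝕜) Θ i →
      ∀ l : Fin n, (X l : MvPolynomial (Fin n) 𝕜) • m ∈ initialSubmodule (Ψ.faceModule 𝕜) Θ i)
    {F : Finset (Fin n)} (hF : F.Nonempty) (i : Fin ℓ) {w : (Fin n → ℤ) →₀ 𝕜}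
    (hw : w ∈ Ψ.Loc 𝕜 F) {g : Fin ℓ → (Fin n → ℤ) →₀ 𝕜} (hg : ∀ j, g j ∈ Ψ.Loc 𝕜 F)
    (h : Ψ.linOp F (Θ i) w = ∑ j ∈ Finset.Iio i, Ψ.linOp F (Θ j) (g j)) :
    ∃ g' : Fin ℓ → (Fin n → ℤ) →₀ 𝕜, (∀ j, g' j ∈ Ψ.Loc 𝕜 F) ∧
      w = ∑ j ∈ Finset.Iio i, Ψ.linOp F (Θ j) (g' j) := by
  obtain ⟨t₁, ht₁⟩ := exists_lift hw
  choose t₂ ht₂ using fun j => exists_lift (hg j)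
  -- A common denominator `x_F ^ t` for `w` and all `g j`.
  let t := t₁ + ∑ j, t₂ j
  obtain ⟨m, hm⟩ := ht₁ t (Nat.le_add_right _ _)
  have ht : ∀ j, t₂ j ≤ t := fun j =>
    (Finset.single_le_sum (f := t₂) (fun _ _ => Nat.zero_le _) (Finset.mem_univ j)).trans
      (Nat.le_add_left _ _)
  choose μ hμ using fun j => ht₂ j t (ht j)
  have h0 : Ψ.locMap 𝕜 F t
      (Ψ.toLaurent 𝕜 (Θ i • m - ∑ j ∈ Finset.Iio i, Θ j • μ j)) = 0 := by
    rw [map_sub, map_sub, map_sum, map_sum, sub_eq_zero, toLaurent_smul (hΘ i),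
      locMap_linOp _ (toLaurent_mem m), hm, h]
    refine Finset.sum_congr rfl fun j _ => ?_
    rw [toLaurent_smul (hΘ j), locMap_linOp _ (toLaurent_mem _), hμ]
  have h1 := prod_X_smul_eq_zero h0
  set P : MvPolynomial (Fin n) 𝕜 := ∏ i ∈ F, (X i : MvPolynomial (Fin n) 𝕜) ^ 1 with hP
  rw [smul_sub, sub_eq_zero, smul_comm, Finset.smul_sum] at h1
  obtain ⟨l, hl⟩ := hF
  have h2 := hW i (P • m) ((mem_initialSubmodule_iff Θ i _).2 ⟨fun j => P • μ j, by
    rw [h1]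
    exact Finset.sum_congr rfl fun j _ => smul_comm _ _ _⟩) l
  -- The variable `x_l` pushes `P • m` into the submodule, and it divides the second factor `P`.
  have h3 : P • P • m ∈ initialSubmodule (Ψ.faceModule 𝕜) Θ i := by
    have e : P • P • m = (∏ j ∈ F.erase l, (X j : MvPolynomial (Fin n) 𝕜) ^ 1) •
        (X l : MvPolynomial (Fin n) 𝕜) • P • m := by
      rw [smul_smul _ (X l), ← pow_one (X l : MvPolynomial (Fin n) 𝕜),
        Finset.prod_erase_mul F (fun j => (X j : MvPolynomial (Fin n) 𝕜) ^ 1) hl]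
    rw [e]
    exact Submodule.smul_mem _ _ h2
  obtain ⟨ν, hν⟩ := (mem_initialSubmodule_iff Θ i _).1 h3
  -- Two extra powers of `x_F` in the denominator undo the two factors `P`.
  refine ⟨fun j => Ψ.locMap 𝕜 F (t + 1 + 1) (Ψ.toLaurent 𝕜 (ν j)), fun j => shiftCut_mem _ _ _, ?_⟩
  have h4 := congrArg (fun x => Ψ.locMap 𝕜 F (t + 1 + 1) (Ψ.toLaurent 𝕜 x)) hν
  simp only [hP] at h4
  rw [toLaurent_prod_X_pow_smul, locMap_add_shiftCut (toLaurent_mem _),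
    toLaurent_prod_X_pow_smul, locMap_add_shiftCut (toLaurent_mem _), hm, map_sum, map_sum] at h4
  rw [h4]
  refine Finset.sum_congr rfl fun j _ => ?_
  rw [toLaurent_smul (hΘ j), locMap_linOp _ (toLaurent_mem _)]

/-- Division of the component at `F` by `x_F ^ t` carries the Koszul differential of the `t`-th
powers to the Čech differential. -/
theorem locMap_powDiff (F : Finset (Fin n)) (t : ℕ) (m : Finset (Fin n) → Ψ.faceModule 𝕜) :
    Ψ.locMap 𝕜 F t
      (Ψ.toLaurent 𝕜 (powDiff (X : Fin n → MvPolynomial (Fin n) 𝕜) t m F)) =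
    ∑ i ∈ F, sgn F i • Ψ.shiftCut 𝕜 F 0
      (Ψ.locMap 𝕜 (F.erase i) t (Ψ.toLaurent 𝕜 (m (F.erase i)))) := by
  rw [powDiff_apply, map_sum, map_sum]
  refine Finset.sum_congr rfl fun i hi => ?_
  rw [map_zsmul, map_zsmul, toLaurent_X_pow_smul,
    locMap_shiftCut (smul_indVec_nonneg _ t) (toLaurent_mem _),
    shiftCut_locMap (Finset.erase_subset _ _) zero_apply_nonneg (toLaurent_mem _)]
  congr 3
  rw [zero_add, neg_add_eq_sub, ← smul_sub, ← smul_neg]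
  congr 1
  ext j
  by_cases hj : j = i
  · subst hj
    simp [indVec, hi]
  · simp [indVec, hj]

end RelativeComplex

theorem HasWeakParameters.mono {R M ι : Type*} [CommRing R] [AddCommGroup M] [Module R M]
    {x : ι → R} {r s : ℕ} (hrs : r ≤ s) {N : Submodule R M} (h : HasWeakParameters x s N) :
    HasWeakParameters x r N := by
  induction r generalizing s N with
  | zero => trivial
  | succ r ih =>
    obtain ⟨s, rfl⟩ : ∃ s', s = s' + 1 := ⟨s - 1, by omega⟩
    obtain ⟨θ, hθ, h⟩ := h
    exact ⟨θ, hθ, fun a => ⟨(h a).1, ih (by omega) (h a).2⟩⟩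

/-! ### Annihilation of Čech cohomology and its concentration in fine degree zero. -/

namespace RelativeComplex

variable {n : ℕ} {Ψ : RelativeComplex n} {𝕜 : Type*} [Field 𝕜]

/-- The variables annihilate the Čech cohomology of the face module in low degrees. -/
theorem exists_cech_eq {p : ℕ}
    (hW : HasWeakParameters (X : Fin n → MvPolynomial (Fin n) 𝕜) (p + 1)
      (⊥ : Submodule (MvPolynomial (Fin n) 𝕜) (Ψ.faceModule 𝕜)))
    {c : Finset (Fin n) → (Fin n → ℤ) →₀ 𝕜} (hc : ∀ F, c F ∈ Ψ.Loc 𝕜 F)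
    (hδ : ∀ F : Finset (Fin n), F.card = p + 1 →
      ∑ i ∈ F, sgn F i • Ψ.shiftCut 𝕜 F 0 (c (F.erase i)) = 0) (l : Fin n) :
    ∃ c' : Finset (Fin n) → (Fin n → ℤ) →₀ 𝕜, (∀ F, c' F ∈ Ψ.Loc 𝕜 F) ∧
      ∀ F : Finset (Fin n), F.card = p → Ψ.shiftCut 𝕜 F (indVec {l}) (c F) =
        ∑ i ∈ F, sgn F i • Ψ.shiftCut 𝕜 F 0 (c' (F.erase i)) := by
  choose t₀ ht₀ using fun F => exists_lift (hc F)
  let t := ∑ F, t₀ F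
  have ht : ∀ F, t₀ F ≤ t := fun F =>
    Finset.single_le_sum (f := t₀) (fun _ _ => Nat.zero_le _) (Finset.mem_univ F)
  choose m hm using fun F => ht₀ F t (ht F)
  -- The numerators `m F` satisfy the cocycle condition only after localization. The defect at `F`
  -- is killed by `x_F`, hence disappears after one transition; this accounts for `t + 1`.
  obtain ⟨s, w, hw⟩ := hW.smul_powTrans_sub_mem (t := t + 1)
    (m := powTrans (X : Fin n → MvPolynomial (Fin n) 𝕜) 1 m) (fun F hF => by
      rw [powDiff_powTrans, Submodule.mem_bot]
      refine prod_X_smul_eq_zero (t := t) ?_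
      rw [locMap_powDiff, ← hδ F hF]
      simp only [hm]) l
  refine ⟨fun F => Ψ.locMap 𝕜 F (t + 1 + s) (Ψ.toLaurent 𝕜 (w F)), fun F => shiftCut_mem _ _ _,
    fun F hF => ?_⟩
  have h := hw F hF
  rw [Submodule.mem_bot, sub_eq_zero] at h
  have h1 := congrArg (fun x => Ψ.locMap 𝕜 F (t + 1 + s) (Ψ.toLaurent 𝕜 x)) h
  simp only [locMap_powDiff] at h1
  rw [← h1, ← hm F, shiftCut_locMap subset_rfl (indVec_nonneg _) (toLaurent_mem _),
    toLaurent_X_smul, powTrans, powTrans, toLaurent_prod_X_pow_smul, toLaurent_prod_X_pow_smul,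
    locMap_shiftCut (indVec_nonneg _) (shiftCut_mem _ _ _),
    shiftCut_empty_comp (smul_indVec_nonneg _ _) (smul_indVec_nonneg _ _) (toLaurent_mem _),
    shiftCut_shiftCut (toLaurent_mem _) subset_rfl _ (Finset.empty_subset F)]
  · congr 2
    simp only [add_smul]
    abel
  · intro i hi
    simpa [indVec_of_notMem hi] using indVec_nonneg {l} i
  · intro i _
    exact add_nonneg (smul_indVec_nonneg _ _ i) (smul_indVec_nonneg _ _ i)

/-- If `b l` and `b l + 1` are both nonzero they have the same sign, and admissibility sees only the
signs of the exponents. Multiplication by `x_l` thus identifies the two fine strands. -/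
theorem adm_add_indVec_iff {F : Finset (Fin n)} {b : Fin n → ℤ} {l : Fin n}
    (h0 : b l ≠ 0) (h1 : b l + 1 ≠ 0) : Ψ.Adm F (b + indVec {l}) ↔ Ψ.Adm F b := by
  have hs : suppSet (b + indVec {l}) = suppSet b := by
    ext i
    by_cases hi : i = l
    · subst hi
      simp [mem_suppSet, indVec, h0, h1]
    · simp [mem_suppSet, indVec, hi]
  have hp : (∀ i ∉ F, 0 ≤ (b + indVec {l}) i) ↔ ∀ i ∉ F, 0 ≤ b i := by
    refine forall₂_congr fun i _ => ?_
    by_cases hi : i = l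
    · subst hi
      simp only [Pi.add_apply, indVec, Finset.mem_singleton, if_true]
      omega
    · simp [indVec, hi]
  rw [Adm, Adm, hs, hp]

open Classical in
/-- The part of the Čech complex of a nonzero fine degree is exact in low degrees. -/
theorem exists_fine_eq {p : ℕ}
    (hW : HasWeakParameters (X : Fin n → MvPolynomial (Fin n) 𝕜) (p + 1)
      (⊥ : Submodule (MvPolynomial (Fin n) 𝕜) (Ψ.faceModule 𝕜)))
    {a : Fin n → ℤ} (ha : a ≠ 0) {γ : Finset (Fin n) → 𝕜} (hγ : ∀ F, γ F ≠ 0 → Ψ.Adm F a)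
    (hδ : ∀ F : Finset (Fin n), F.card = p + 1 → Ψ.Adm F a →
      ∑ i ∈ F, sgn F i • γ (F.erase i) = 0) :
    ∃ η : Finset (Fin n) → 𝕜, (∀ F, η F ≠ 0 → Ψ.Adm F a) ∧
      ∀ F : Finset (Fin n), F.card = p →
        γ F = if Ψ.Adm F a then ∑ i ∈ F, sgn F i • η (F.erase i) else 0 := by
  obtain ⟨l, hl⟩ := Function.ne_iff.1 ha
  rw [Pi.zero_apply] at hl
  obtain ⟨b, hb1, hb2, hab⟩ : ∃ b : Fin n → ℤ, b l ≠ 0 ∧ b l + 1 ≠ 0 ∧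
      (a = b ∨ a = b + indVec {l}) := by
    rcases lt_or_gt_of_ne hl with h | h
    · refine ⟨a - indVec {l}, ?_, ?_, Or.inr (by simp)⟩
      · simp [indVec]
        omega
      · simp [indVec, hl]
    · exact ⟨a, hl, by omega, Or.inl rfl⟩
  have hba : ∀ F, Ψ.Adm F b ↔ Ψ.Adm F a := by
    intro F
    rcases hab with rfl | rfl
    · rfl
    · exact (adm_add_indVec_iff hb1 hb2).symm
  have hba' : ∀ F, Ψ.Adm F (b + indVec {l}) ↔ Ψ.Adm F a := fun F =>
    (adm_add_indVec_iff hb1 hb2).trans (hba F)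
  -- Place the cocycle in degree `b`, multiply by `x_l`, and read the resulting primitive in degree
  -- `b + indVec {l}`.
  obtain ⟨c', hc', h⟩ := exists_cech_eq hW (c := fun F => Finsupp.single b (γ F))
    (fun F a' h => by
      rw [Finsupp.single_apply] at h
      split_ifs at h with hb
      · rw [← hb, hba]
        exact hγ F h
      · exact (h rfl).elim)
    (fun F hF => by
      ext a'
      simp only [Finsupp.finsetSum_apply, Finsupp.smul_apply, shiftCut_apply, sub_zero,
        Finsupp.zero_apply]
      by_cases hb : b = a'
      · subst hb
        by_cases hA : Ψ.Adm F b
        · simpa [hA] using hδ F hF ((hba F).1 hA)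
        · simp [hA]
      · simp [Finsupp.single_eq_of_ne' hb]) l
  refine ⟨fun F => c' F (b + indVec {l}), fun F hF => (hba' F).1 (hc' F _ hF), fun F hF => ?_⟩
  have h1 := DFunLike.congr_fun (h F hF) (b + indVec {l})
  simp only [Finsupp.finsetSum_apply, Finsupp.smul_apply, shiftCut_apply, sub_zero,
    add_sub_cancel_right, Finsupp.single_eq_same, hba'] at h1
  by_cases hA : Ψ.Adm F a
  · simpa [hA] using h1
  · rw [if_neg hA]
    exact not_ne_iff.1 (mt (hγ F) hA)

end RelativeComplex

end Cech

/-! ### The double complex -/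

section Double

namespace RelativeComplex

variable {n : ℕ} (Ψ : RelativeComplex n) (𝕜 : Type*) [Field 𝕜]

/-- The terms of the Čech complex of the face module. -/
def Cech : Type _ := ∀ F : Finset (Fin n), Ψ.Loc 𝕜 F

instance : AddCommGroup (Ψ.Cech 𝕜) :=
  inferInstanceAs (AddCommGroup (∀ F : Finset (Fin n), Ψ.Loc 𝕜 F))

instance : Module 𝕜 (Ψ.Cech 𝕜) :=
  inferInstanceAs (Module 𝕜 (∀ F : Finset (Fin n), Ψ.Loc 𝕜 F))

variable {Ψ 𝕜} in
@[ext]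
theorem Cech.ext {c c' : Ψ.Cech 𝕜} (h : ∀ F, c F = c' F) : c = c' := funext h

/-- The components of the terms of the Čech complex. -/
def Cech.proj (F : Finset (Fin n)) : Ψ.Cech 𝕜 →ₗ[𝕜] Ψ.Loc 𝕜 F where
  toFun c := c F
  map_add' _ _ := rfl
  map_smul' _ _ := rfl

variable {Ψ 𝕜} in
theorem Cech.sum_apply {κ : Type*} (s : Finset κ) (c : κ → Ψ.Cech 𝕜) (F : Finset (Fin n)) :
    (∑ j ∈ s, c j) F = ∑ j ∈ s, c j F :=
  map_sum (Cech.proj Ψ 𝕜 F) c s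

/-- The map from one localization to another one. -/
def cutTo (F G : Finset (Fin n)) : Ψ.Loc 𝕜 G →ₗ[𝕜] Ψ.Loc 𝕜 F :=
  ((Ψ.shiftCut 𝕜 F 0).domRestrict (Ψ.Loc 𝕜 G)).codRestrict _ fun _ => shiftCut_mem _ _ _

/-- The Čech differential. -/
def cechDiff : Ψ.Cech 𝕜 →ₗ[𝕜] Ψ.Cech 𝕜 where
  toFun c F := ∑ i ∈ F, sgn F i • Ψ.cutTo 𝕜 F (F.erase i) (c (F.erase i))
  map_add' a b := by
    ext1 F
    change ∑ i ∈ F, sgn F i • Ψ.cutTo 𝕜 F (F.erase i) (a (F.erase i) + b (F.erase i)) =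
      ∑ i ∈ F, sgn F i • Ψ.cutTo 𝕜 F (F.erase i) (a (F.erase i)) +
        ∑ i ∈ F, sgn F i • Ψ.cutTo 𝕜 F (F.erase i) (b (F.erase i))
    simp [Finset.sum_add_distrib]
  map_smul' r a := by
    ext1 F
    change ∑ i ∈ F, sgn F i • Ψ.cutTo 𝕜 F (F.erase i) (r • a (F.erase i)) =
      r • ∑ i ∈ F, sgn F i • Ψ.cutTo 𝕜 F (F.erase i) (a (F.erase i))
    simp [Finset.smul_sum, smul_comm r]

variable {𝕜}

/-- Multiplication by a linear form on a localization of the face module. -/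
def linLoc (F : Finset (Fin n)) (θ : MvPolynomial (Fin n) 𝕜) : Ψ.Loc 𝕜 F →ₗ[𝕜] Ψ.Loc 𝕜 F :=
  ((Ψ.linOp F θ).domRestrict (Ψ.Loc 𝕜 F)).codRestrict _ fun _ => linOp_mem _ _ _

/-- Multiplication by a linear form on the Čech complex. -/
def cechLin (θ : MvPolynomial (Fin n) 𝕜) : Ψ.Cech 𝕜 →ₗ[𝕜] Ψ.Cech 𝕜 :=
  LinearMap.pi fun F => Ψ.linLoc F θ ∘ₗ LinearMap.proj F

variable {Ψ}

theorem cechDiff_apply (c : Ψ.Cech 𝕜) (F : Finset (Fin n)) :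
    (Ψ.cechDiff 𝕜 c F).1 = ∑ i ∈ F, sgn F i • Ψ.shiftCut 𝕜 F 0 (c (F.erase i)).1 := by
  change (∑ i ∈ F, sgn F i • Ψ.cutTo 𝕜 F (F.erase i) (c (F.erase i))).1 = _
  rw [AddSubmonoidClass.coe_finsetSum]
  rfl

open Classical in
theorem cechDiff_apply_apply (c : Ψ.Cech 𝕜) (F : Finset (Fin n)) (a : Fin n → ℤ) :
    (Ψ.cechDiff 𝕜 c F).1 a =
      if Ψ.Adm F a then ∑ i ∈ F, sgn F i • (c (F.erase i)).1 a else 0 := by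
  rw [cechDiff_apply, Finsupp.finsetSum_apply]
  simp only [Finsupp.smul_apply, shiftCut_apply, sub_zero]
  split_ifs <;> simp

theorem linLoc_coe (F : Finset (Fin n)) (θ : MvPolynomial (Fin n) 𝕜) (g : Ψ.Loc 𝕜 F) :
    (Ψ.linLoc F θ g).1 = Ψ.linOp F θ g.1 := rfl

theorem cechLin_apply (θ : MvPolynomial (Fin n) 𝕜) (c : Ψ.Cech 𝕜) (F : Finset (Fin n)) :
    Ψ.cechLin θ c F = Ψ.linLoc F θ (c F) := rfl

theorem cechDiff_cechDiff (c : Ψ.Cech 𝕜) : Ψ.cechDiff 𝕜 (Ψ.cechDiff 𝕜 c) = 0 := by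
  classical
  ext F a
  rw [cechDiff_apply_apply]
  split_ifs with hF
  · have h := congrFun (koszulUp_koszulUp (fun _ : Fin n => (LinearMap.id : 𝕜 →ₗ[𝕜] 𝕜))
      (fun _ _ _ => rfl) fun G => (c G).1 a) F
    rw [koszulUp_apply] at h
    refine Eq.trans (Finset.sum_congr rfl fun i hi => ?_) h
    rw [cechDiff_apply_apply, koszulUp_apply, LinearMap.id_apply]
    simp only [LinearMap.id_apply]
    split_ifs with hi'
    · rfl
    · congr 1
      symm
      refine Finset.sum_eq_zero fun j hj => ?_
      rw [not_ne_iff.1 (mt ((c _).2 a) fun h => hi' ?_), smul_zero]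
      exact h.convex hF (Finset.erase_subset _ _) (fun _ _ => le_rfl) (Finset.erase_subset _ _)
        (fun _ _ => le_rfl)
  · rfl

theorem cechDiff_cechLin (θ : MvPolynomial (Fin n) 𝕜) (c : Ψ.Cech 𝕜) :
    Ψ.cechDiff 𝕜 (Ψ.cechLin θ c) = Ψ.cechLin θ (Ψ.cechDiff 𝕜 c) := by
  ext1 F
  ext1
  rw [cechLin_apply, linLoc_coe, cechDiff_apply, cechDiff_apply, map_sum]
  refine Finset.sum_congr rfl fun i _ => ?_
  rw [cechLin_apply, linLoc_coe, shiftCut_linOp (Finset.erase_subset _ _) _ (c _).2, map_zsmul]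

theorem cechLin_comm (θ θ' : MvPolynomial (Fin n) 𝕜) (c : Ψ.Cech 𝕜) :
    Ψ.cechLin θ (Ψ.cechLin θ' c) = Ψ.cechLin θ' (Ψ.cechLin θ c) := by
  ext1 F
  ext1
  exact linOp_comm θ θ' (c F).2

variable (Ψ) (𝕜) in
/-- The horizontal differential. -/
abbrev dblHor (ℓ : ℕ) : (Finset (Fin ℓ) → Ψ.Cech 𝕜) →ₗ[𝕜] (Finset (Fin ℓ) → Ψ.Cech 𝕜) :=
  (Ψ.cechDiff 𝕜).compLeft (Finset (Fin ℓ))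

variable (Ψ) in
/-- The vertical differential. -/
abbrev dblVer {ℓ : ℕ} (Θ : Fin ℓ → MvPolynomial (Fin n) 𝕜) :
    (Finset (Fin ℓ) → Ψ.Cech 𝕜) →ₗ[𝕜] (Finset (Fin ℓ) → Ψ.Cech 𝕜) :=
  koszulDown (S := 𝕜) (W := Ψ.Cech 𝕜) fun j => Ψ.cechLin (Θ j)

theorem dblHor_apply {ℓ : ℕ} (z : Finset (Fin ℓ) → Ψ.Cech 𝕜) (J : Finset (Fin ℓ)) :
    Ψ.dblHor 𝕜 ℓ z J = Ψ.cechDiff 𝕜 (z J) := rfl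

theorem dblVer_apply_apply {ℓ : ℕ} (Θ : Fin ℓ → MvPolynomial (Fin n) 𝕜)
    (z : Finset (Fin ℓ) → Ψ.Cech 𝕜) (J : Finset (Fin ℓ)) (F : Finset (Fin n)) :
    Ψ.dblVer Θ z J F = koszulDown (fun j => Ψ.linLoc F (Θ j)) (fun J => z J F) J := by
  rw [koszulDown_apply, koszulDown_apply, Cech.sum_apply]
  rfl

variable (Ψ) (𝕜) in
/-- The part of total degree `e` and bidegree `(p, q)` of the double complex. -/
def dbl (ℓ e p q : ℕ) : Submodule 𝕜 (Finset (Fin ℓ) → Ψ.Cech 𝕜) where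
  carrier := {z | ∀ J F a, (z J F).1 a ≠ 0 →
    J.card = q ∧ F.card = p ∧ ∑ i, a i + (q : ℤ) = (e : ℤ)}
  add_mem' {y z} hy hz J F a ha := by
    by_contra h
    apply ha
    change (y J F).1 a + (z J F).1 a = 0
    rw [not_ne_iff.1 (mt (hy J F a) h), not_ne_iff.1 (mt (hz J F a) h), add_zero]
  zero_mem' J F a ha := (ha rfl).elim
  smul_mem' c z hz J F a ha := hz J F a fun h => ha (by
    change c • (z J F).1 a = 0
    rw [h, smul_zero])

theorem sum_indVec_singleton (i : Fin n) : ∑ j, indVec {i} j = 1 := by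
  simp [indVec]

theorem exists_ne_zero_of_linOp {F : Finset (Fin n)} {θ : MvPolynomial (Fin n) 𝕜}
    {g : (Fin n → ℤ) →₀ 𝕜} {a : Fin n → ℤ} (h : Ψ.linOp F θ g a ≠ 0) :
    ∃ i, g (a - indVec {i}) ≠ 0 := by
  classical
  rw [linOp_apply, Finsupp.finsetSum_apply] at h
  obtain ⟨i, _, hi⟩ := Finset.exists_ne_zero_of_sum_ne_zero h
  refine ⟨i, fun h0 => hi ?_⟩
  rw [Finsupp.smul_apply, shiftCut_apply, h0, ite_self, smul_zero]

theorem koszulDown_linLoc_coe {ℓ : ℕ} (Θ : Fin ℓ → MvPolynomial (Fin n) 𝕜) (F : Finset (Fin n))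
    (z : Finset (Fin ℓ) → Ψ.Loc 𝕜 F) (J : Finset (Fin ℓ)) :
    (koszulDown (fun j => Ψ.linLoc F (Θ j)) z J).1 =
      ∑ j ∈ Jᶜ, sgn J j • Ψ.linOp F (Θ j) (z (insert j J)).1 := by
  rw [koszulDown_apply, AddSubmonoidClass.coe_finsetSum]
  rfl

theorem dblHor_mem {ℓ e p q : ℕ} {z : Finset (Fin ℓ) → Ψ.Cech 𝕜} (hz : z ∈ Ψ.dbl 𝕜 ℓ e p q) :
    Ψ.dblHor 𝕜 ℓ z ∈ Ψ.dbl 𝕜 ℓ e (p + 1) q := by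
  classical
  intro J F a ha
  rw [dblHor_apply, cechDiff_apply_apply] at ha
  split_ifs at ha with hF
  · obtain ⟨i, hi, h⟩ := Finset.exists_ne_zero_of_sum_ne_zero ha
    have := hz J (F.erase i) a fun h0 => h (by rw [h0, smul_zero])
    refine ⟨this.1, ?_, this.2.2⟩
    rw [← Finset.card_erase_add_one hi, this.2.1]
  · exact (ha rfl).elim

theorem dblVer_mem {ℓ e p q : ℕ} (Θ : Fin ℓ → MvPolynomial (Fin n) 𝕜)
    {z : Finset (Fin ℓ) → Ψ.Cech 𝕜} (hz : z ∈ Ψ.dbl 𝕜 ℓ e p (q + 1)) :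
    Ψ.dblVer Θ z ∈ Ψ.dbl 𝕜 ℓ e p q := by
  intro J F a ha
  rw [dblVer_apply_apply, koszulDown_linLoc_coe, Finsupp.finsetSum_apply] at ha
  obtain ⟨j, hj, h⟩ := Finset.exists_ne_zero_of_sum_ne_zero ha
  rw [Finsupp.smul_apply] at h
  obtain ⟨i, hi⟩ := exists_ne_zero_of_linOp fun h0 => h (by rw [h0, smul_zero])
  obtain ⟨h1, h2, h3⟩ := hz _ F _ hi
  rw [Finset.card_insert_of_notMem (Finset.mem_compl.1 hj)] at h1
  refine ⟨by omega, h2, ?_⟩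
  simp only [Pi.sub_apply, Finset.sum_sub_distrib, sum_indVec_singleton] at h3
  push_cast at h3
  omega

theorem dblHor_dblHor {ℓ : ℕ} (z : Finset (Fin ℓ) → Ψ.Cech 𝕜) :
    Ψ.dblHor 𝕜 ℓ (Ψ.dblHor 𝕜 ℓ z) = 0 := by
  ext1 J
  exact cechDiff_cechDiff _

theorem dblVer_dblVer {ℓ : ℕ} (Θ : Fin ℓ → MvPolynomial (Fin n) 𝕜)
    (z : Finset (Fin ℓ) → Ψ.Cech 𝕜) : Ψ.dblVer Θ (Ψ.dblVer Θ z) = 0 :=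
  koszulDown_koszulDown (S := 𝕜) (W := Ψ.Cech 𝕜) _ (fun _ _ _ => cechLin_comm _ _ _) z

theorem dblVer_dblHor {ℓ : ℕ} (Θ : Fin ℓ → MvPolynomial (Fin n) 𝕜)
    (z : Finset (Fin ℓ) → Ψ.Cech 𝕜) :
    Ψ.dblVer Θ (Ψ.dblHor 𝕜 ℓ z) = Ψ.dblHor 𝕜 ℓ (Ψ.dblVer Θ z) := by
  ext1 J
  rw [dblHor_apply, koszulDown_apply, koszulDown_apply, map_sum]
  refine Finset.sum_congr rfl fun j _ => ?_
  rw [map_zsmul, cechDiff_cechLin]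
  rfl

theorem isDoubleComplex_dbl {ℓ : ℕ} (Θ : Fin ℓ → MvPolynomial (Fin n) 𝕜) (e : ℕ) :
    IsDoubleComplex (Ψ.dbl 𝕜 ℓ e) (Ψ.dblHor 𝕜 ℓ)
      (Ψ.dblVer Θ) :=
  ⟨dblHor_mem, dblVer_mem Θ, fun _ => dblHor_dblHor _, fun _ => dblVer_dblVer Θ _,
    fun _ => dblVer_dblHor Θ _⟩

theorem dbl_eq_bot {ℓ e p q : ℕ} (hq : ℓ < q) : Ψ.dbl 𝕜 ℓ e p q = ⊥ := by
  rw [eq_bot_iff]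
  intro z hz
  rw [Submodule.mem_bot]
  ext J F a
  by_contra hne
  have h1 := (hz J F a hne).1
  have h2 := Finset.card_le_univ J
  rw [Fintype.card_fin] at h2
  omega

/-- Cocycles without component of fine degree zero are coboundaries. -/
theorem mem_horBoundary_of_apply_zero {ℓ e p q : ℕ}
    (hW : HasWeakParameters (X : Fin n → MvPolynomial (Fin n) 𝕜) (p + 1)
      (⊥ : Submodule (MvPolynomial (Fin n) 𝕜) (Ψ.faceModule 𝕜)))
    {z : Finset (Fin ℓ) → Ψ.Cech 𝕜} (hz : z ∈ Ψ.dbl 𝕜 ℓ e p q) (hδ : Ψ.dblHor 𝕜 ℓ z = 0)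
    (h0 : ∀ J F, (z J F).1 0 = 0) : z ∈ horBoundary (Ψ.dbl 𝕜 ℓ e) (Ψ.dblHor 𝕜 ℓ) p q := by
  classical
  -- Each fine degree is solved separately. The primitive is zero in degrees absent from `z J`,
  -- which keeps its support finite and its coarse degree correct.
  have hη : ∀ (J : Finset (Fin ℓ)) (a : Fin n → ℤ), ∃ η : Finset (Fin n) → 𝕜,
      (∀ F, η F ≠ 0 → Ψ.Adm F a ∧ F.card + 1 = p ∧ ∃ G, (z J G).1 a ≠ 0) ∧
      ∀ F : Finset (Fin n), F.card = p →
        (z J F).1 a = if Ψ.Adm F a then ∑ i ∈ F, sgn F i • η (F.erase i) else 0 := by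
    intro J a
    by_cases hG : ∃ G, (z J G).1 a ≠ 0
    · have ha : a ≠ 0 := by
        rintro rfl
        obtain ⟨G, hG⟩ := hG
        exact hG (h0 J G)
      obtain ⟨η, h1, h2⟩ := exists_fine_eq hW ha (γ := fun F => (z J F).1 a)
        (fun F hF => (z J F).2 a hF) (fun F hF hA => by
          have : (Ψ.dblHor 𝕜 ℓ z J F).1 a = 0 := by rw [hδ]; rfl
          rwa [dblHor_apply, cechDiff_apply_apply, if_pos hA] at this)
      refine ⟨fun F => if F.card + 1 = p then η F else 0, fun F hF => ?_, fun F hF => ?_⟩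
      · dsimp only at hF
        split_ifs at hF with hc
        · exact ⟨h1 F hF, hc, hG⟩
        · exact (hF rfl).elim
      · rw [h2 F hF]
        congr 1
        refine Finset.sum_congr rfl fun i hi => ?_
        dsimp only
        rw [if_pos (by rw [Finset.card_erase_add_one hi, hF])]
    · refine ⟨0, fun F hF => (hF rfl).elim, fun F _ => ?_⟩
      push Not at hG
      simp [hG F]
  choose η hη1 hη2 using hη
  let y : Finset (Fin ℓ) → Ψ.Cech 𝕜 := fun J F =>
    ⟨Finsupp.onFinset (Finset.univ.biUnion fun G => (z J G).1.support) (fun a => η J a F)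
      fun a ha => by
        obtain ⟨G, hG⟩ := (hη1 J a F ha).2.2
        exact Finset.mem_biUnion.2 ⟨G, Finset.mem_univ _, Finsupp.mem_support_iff.2 hG⟩,
      fun a ha => (hη1 J a F ha).1⟩
  have hy : ∀ J F a, (y J F).1 a = η J a F := fun _ _ _ => rfl
  have hyz : Ψ.dblHor 𝕜 ℓ y = z := by
    ext J F a
    rw [dblHor_apply, cechDiff_apply_apply]
    simp only [hy]
    by_cases hF : F.card = p
    · exact (hη2 J a F hF).symm
    · have e1 : (z J F).1 a = 0 := by
        by_contra hne
        exact hF (hz J F a hne).2.1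
      rw [e1, Finset.sum_eq_zero, ite_self]
      intro i hi
      have h0 : η J a (F.erase i) = 0 := by
        by_contra h
        exact hF (by rw [← (hη1 J a _ h).2.1, Finset.card_erase_add_one hi])
      rw [h0, smul_zero]
  cases p with
  | zero =>
    have : y = 0 := by
      ext J F a
      rw [hy]
      by_contra hne
      exact Nat.succ_ne_zero _ (hη1 J a F hne).2.1
    rw [← hyz, this, map_zero]
    exact Submodule.zero_mem _
  | succ p =>
    refine ⟨y, fun J F a ha => ?_, hyz⟩
    obtain ⟨_, h2, G, hG⟩ := hη1 J a F ha
    have := hz J G a hG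
    exact ⟨this.1, by omega, this.2.2⟩

/-- Fine degree zero has coarse degree zero and therefore lives in row `q = e` alone. -/
theorem dbl_row_exact {ℓ e p q : ℕ}
    (hW : HasWeakParameters (X : Fin n → MvPolynomial (Fin n) 𝕜) ℓ
      (⊥ : Submodule (MvPolynomial (Fin n) 𝕜) (Ψ.faceModule 𝕜)))
    (hp : p < ℓ) (hq : q ≠ e) {z : Finset (Fin ℓ) → Ψ.Cech 𝕜} (hz : z ∈ Ψ.dbl 𝕜 ℓ e p q)
    (hδ : Ψ.dblHor 𝕜 ℓ z = 0) : z ∈ horBoundary (Ψ.dbl 𝕜 ℓ e) (Ψ.dblHor 𝕜 ℓ) p q := by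
  refine mem_horBoundary_of_apply_zero (hW.mono hp) hz hδ fun J F => ?_
  by_contra hne
  have := (hz J F 0 hne).2.2
  simp only [Pi.zero_apply, Finset.sum_const_zero, zero_add] at this
  exact hq (by exact_mod_cast this)

/-- The homogeneous component of degree `s` of a Laurent polynomial. -/
def degPart (s : ℤ) : ((Fin n → ℤ) →₀ 𝕜) →ₗ[𝕜] ((Fin n → ℤ) →₀ 𝕜) where
  toFun g := g.filter fun a => ∑ i, a i = s
  map_add' _ _ := Finsupp.filter_add
  map_smul' _ _ := Finsupp.filter_smul

theorem degPart_apply (s : ℤ) (g : (Fin n → ℤ) →₀ 𝕜) (a : Fin n → ℤ) :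
    degPart s g a = if ∑ i, a i = s then g a else 0 := by
  change (g.filter fun a => ∑ i, a i = s) a = _
  rw [Finsupp.filter_apply]

theorem degPart_mem {F : Finset (Fin n)} {g : (Fin n → ℤ) →₀ 𝕜} (hg : g ∈ Ψ.Loc 𝕜 F) (s : ℤ) :
    degPart s g ∈ Ψ.Loc 𝕜 F := by
  intro a ha
  rw [degPart_apply] at ha
  split_ifs at ha with h
  · exact hg a ha
  · exact (ha rfl).elim

theorem linOp_degPart (F : Finset (Fin n)) (θ : MvPolynomial (Fin n) 𝕜) (s : ℤ)
    (g : (Fin n → ℤ) →₀ 𝕜) :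
    Ψ.linOp F θ (degPart s g) = degPart (s + 1) (Ψ.linOp F θ g) := by
  classical
  rw [linOp_apply, linOp_apply, map_sum]
  refine Finset.sum_congr rfl fun i _ => ?_
  rw [map_smul]
  congr 1
  ext a
  rw [degPart_apply, shiftCut_apply, shiftCut_apply, degPart_apply]
  have : ∑ j, (a - indVec {i}) j = s ↔ ∑ j, a j = s + 1 := by
    simp only [Pi.sub_apply, Finset.sum_sub_distrib, sum_indVec_singleton]
    omega
  simp only [this]
  split_ifs <;> rfl

/-- The Koszul complex is acyclic over each localization at a nonempty `F`. The primitive found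
there need not be homogeneous, and its part of degree `e - q - 2` suffices because linear forms
raise the degree by one. -/
theorem dbl_col_exact {ℓ : ℕ} {Θ : Fin ℓ → MvPolynomial (Fin n) 𝕜}
    (hΘ : ∀ i, (Θ i).IsHomogeneous 1)
    (hW : ∀ (i : Fin ℓ) (m : Ψ.faceModule 𝕜), Θ i • m ∈ initialSubmodule (Ψ.faceModule 𝕜) Θ i →
      ∀ l : Fin n, (X l : MvPolynomial (Fin n) 𝕜) • m ∈ initialSubmodule (Ψ.faceModule 𝕜) Θ i)
    {e p q : ℕ} {z : Finset (Fin ℓ) → Ψ.Cech 𝕜} (hz : z ∈ Ψ.dbl 𝕜 ℓ e (p + 1) (q + 1))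
    (hD : Ψ.dblVer Θ z = 0) : z ∈ (Ψ.dbl 𝕜 ℓ e (p + 1) (q + 2)).map (Ψ.dblVer Θ) := by
  have hy : ∀ F : Finset (Fin n), ∃ y : Finset (Fin ℓ) → Ψ.Loc 𝕜 F, F.card = p + 1 →
      koszulDown (fun j => Ψ.linLoc F (Θ j)) y = fun J => z J F := by
    intro F
    by_cases hF : F.card = p + 1
    · have hne : F.Nonempty := Finset.card_pos.1 (by omega)
      obtain ⟨y, hy⟩ := exists_koszulDown_eq (fun j => Ψ.linLoc F (Θ j))
        (fun i j w => Subtype.ext (linOp_comm _ _ w.2))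
        (fun i w g h => by
          obtain ⟨g', hg', h'⟩ := linOp_regular hΘ hW hne i w.2 (g := fun j => (g j).1)
            (fun j => (g j).2) (by
              have := congrArg Subtype.val h
              rwa [AddSubmonoidClass.coe_finsetSum] at this)
          refine ⟨fun j => ⟨g' j, hg' j⟩, Subtype.ext ?_⟩
          rw [AddSubmonoidClass.coe_finsetSum]
          exact h')
        (z := fun J => z J F)
        (by
          ext1 J
          rw [← dblVer_apply_apply, hD]
          rfl)
        (by
          ext a
          by_contra hne'
          exact Nat.succ_ne_zero q (hz ∅ F a hne').1.symm)
      exact ⟨y, fun _ => hy⟩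
    · exact ⟨0, fun h => (hF h).elim⟩
  choose y hy using hy
  let w : Finset (Fin ℓ) → Ψ.Cech 𝕜 := fun J F => if J.card = q + 2 ∧ F.card = p + 1 then
    ⟨degPart ((e : ℤ) - q - 2) (y F J).1, degPart_mem (y F J).2 _⟩ else 0
  have hw : ∀ J F, w J F = if J.card = q + 2 ∧ F.card = p + 1 then
      ⟨degPart ((e : ℤ) - q - 2) (y F J).1, degPart_mem (y F J).2 _⟩ else 0 := fun _ _ => rfl
  refine ⟨w, ?_, ?_⟩
  · intro J F a ha
    rw [hw] at ha
    split_ifs at ha with h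
    · refine ⟨h.1, h.2, ?_⟩
      rw [degPart_apply] at ha
      split_ifs at ha with hs
      · rw [hs]
        push_cast
        ring
      · exact (ha rfl).elim
    · exact (ha rfl).elim
  · ext1 J
    ext1 F
    ext1
    rw [dblVer_apply_apply, koszulDown_linLoc_coe]
    by_cases hJF : J.card = q + 1 ∧ F.card = p + 1
    · have h1 := congrArg Subtype.val (congrFun (hy F hJF.2) J)
      rw [koszulDown_linLoc_coe] at h1
      have h2 : degPart ((e : ℤ) - q - 1) (z J F).1 = (z J F).1 := by
        ext a
        rw [degPart_apply, ite_eq_left_iff]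
        intro hs
        by_contra hne
        have := (hz J F a (Ne.symm hne)).2.2
        push_cast at this
        omega
      rw [← h2, ← h1, map_sum]
      refine Finset.sum_congr rfl fun j hj => ?_
      rw [hw, if_pos ⟨by rw [Finset.card_insert_of_notMem (Finset.mem_compl.1 hj), hJF.1], hJF.2⟩,
        linOp_degPart, map_zsmul]
      congr 3
      ring
    · have h1 : (z J F).1 = 0 := by
        ext a
        by_contra hne
        have := hz J F a hne
        exact hJF ⟨this.1, this.2.1⟩
      rw [h1]
      refine Finset.sum_eq_zero fun j hj => ?_
      rw [hw, if_neg, ZeroMemClass.coe_zero, map_zero, smul_zero]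
      rw [Finset.card_insert_of_notMem (Finset.mem_compl.1 hj)]
      exact fun h => hJF ⟨by omega, h.2⟩

end RelativeComplex

end Double

/-! ### Dimension counts in the double complex -/

section RelDimPi

variable {k : Type*} [Field k] {V W : Type*} [AddCommGroup V] [Module k V] [AddCommGroup W]
  [Module k W]

theorem relDim_bot (V₁ : Submodule k V) : relDim V₁ ⊥ = Module.finrank k V₁ := by
  have e : (⊥ : Submodule k V).submoduleOf V₁ = ⊥ := by
    rw [Submodule.submoduleOf, Submodule.comap_bot, Submodule.ker_subtype]
  rw [relDim, e]
  exact (Submodule.quotEquivOfEqBot _ rfl).finrank_eq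

theorem finrank_map_eq_relDim (f : V →ₗ[k] W) (V₁ : Submodule k V) :
    Module.finrank k (V₁.map f) = relDim V₁ (LinearMap.ker f) := by
  rw [← relDim_bot]
  symm
  refine relDim_congr f (fun v hv => ⟨v, hv, rfl⟩) ?_ fun v _ => by
    rw [Submodule.mem_bot, LinearMap.mem_ker]
  rintro _ ⟨v, hv, rfl⟩
  exact ⟨v, hv, by simp⟩

theorem relDim_pi {κ : Type*} [Fintype κ] {V₁ V₀ : Submodule k V} [FiniteDimensional k V₁] :
    relDim (Submodule.pi Set.univ fun _ : κ => V₁) (Submodule.pi Set.univ fun _ : κ => V₀) =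
      Fintype.card κ * relDim V₁ V₀ := by
  classical
  let f : (κ → V₁) →ₗ[k] (κ → V) := V₁.subtype.compLeft κ
  have h : relDim (⊤ : Submodule k (κ → V₁))
      (Submodule.pi Set.univ fun _ : κ => V₀.submoduleOf V₁) =
      relDim (Submodule.pi Set.univ fun _ : κ => V₁) (Submodule.pi Set.univ fun _ : κ => V₀) := by
    refine relDim_congr f (fun v _ i _ => (v i).2) (fun w hw => ?_) fun v _ => ?_
    · refine ⟨fun i => ⟨w i, hw i trivial⟩, trivial, ?_⟩
      have : f (fun i => ⟨w i, hw i trivial⟩) = w := rfl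
      rw [this, sub_self]
      exact Submodule.zero_mem _
    · rfl
  have h2 : relDim (⊤ : Submodule k (κ → V₁))
      (Submodule.pi Set.univ fun _ : κ => V₀.submoduleOf V₁) =
      relDim (⊤ : Submodule k (κ → (V₁ ⧸ V₀.submoduleOf V₁))) ⊥ := by
    refine relDim_congr ((V₀.submoduleOf V₁).mkQ.compLeft κ) (fun _ _ => trivial)
      (fun w _ => ?_) fun v _ => ?_
    · choose v hv using fun i => Submodule.Quotient.mk_surjective _ (w i)
      refine ⟨v, trivial, ?_⟩
      rw [Submodule.mem_bot, sub_eq_zero]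
      exact funext fun i => (hv i).symm
    · rw [Submodule.mem_bot, Submodule.mem_pi, funext_iff]
      refine forall_congr' fun i => ?_
      simp only [Set.mem_univ, forall_true_left]
      exact Submodule.Quotient.mk_eq_zero _
  rw [← h, h2, relDim_bot, finrank_top, Module.finrank_pi_fintype]
  simp [relDim]

theorem finiteDimensional_of_injOn {V₁ : Submodule k V} {W₁ : Submodule k W}
    [FiniteDimensional k W₁] (f : V →ₗ[k] W) (h1 : ∀ v ∈ V₁, f v ∈ W₁)
    (h2 : ∀ v ∈ V₁, f v = 0 → v = 0) : FiniteDimensional k V₁ := by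
  refine Module.Finite.of_injective (f.restrict h1) ?_
  rw [injective_iff_map_eq_zero]
  rintro ⟨v, hv⟩ h
  exact Subtype.ext (h2 v hv (congrArg Subtype.val h))

theorem finiteDimensional_pi_submodule {κ : Type*} [Finite κ] {V₁ : Submodule k V}
    [FiniteDimensional k V₁] :
    FiniteDimensional k (Submodule.pi Set.univ fun _ : κ => V₁ : Submodule k (κ → V)) := by
  let f : (Submodule.pi Set.univ fun _ : κ => V₁ : Submodule k (κ → V)) →ₗ[k] (κ → V₁) :=
    LinearMap.pi fun i => ((LinearMap.proj i).domRestrict _).codRestrict V₁ fun w => w.2 i trivial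
  refine Module.Finite.of_injective f ?_
  intro w w' h
  ext i
  exact congrArg Subtype.val (congrFun h i)

end RelDimPi

/-! ### The exceptional row and the initial column. -/

section Count

namespace RelativeComplex

variable {n : ℕ} (Ψ : RelativeComplex n) (𝕜 : Type*) [Field 𝕜]

/-- The relative simplicial cochains on the faces with `p` elements. -/
def relCochains (p : ℕ) : Submodule 𝕜 (Finset (Fin n) → 𝕜) where
  carrier := {γ | ∀ F, γ F ≠ 0 → F.card = p ∧ Ψ.IsFace F}
  add_mem' {a b} ha hb F hF := by
    by_contra h
    apply hF
    rw [Pi.add_apply, not_ne_iff.1 (mt (ha F) h), not_ne_iff.1 (mt (hb F) h), add_zero]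
  zero_mem' F hF := (hF rfl).elim
  smul_mem' c a ha F hF := ha F fun h => hF (by rw [Pi.smul_apply, h, smul_zero])

open Classical in
/-- The relative simplicial coboundary map. -/
def coboundary : (Finset (Fin n) → 𝕜) →ₗ[𝕜] (Finset (Fin n) → 𝕜) where
  toFun γ F := if Ψ.IsFace F then ∑ i ∈ F, sgn F i • γ (F.erase i) else 0
  map_add' a b := by
    ext F
    by_cases h : Ψ.IsFace F <;> simp [h, Finset.sum_add_distrib]
  map_smul' c a := by
    ext F
    by_cases h : Ψ.IsFace F <;> simp [h, Finset.mul_sum, mul_left_comm]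

open Classical in
variable {𝕜} in
theorem coboundary_apply (γ : Finset (Fin n) → 𝕜) (F : Finset (Fin n)) :
    Ψ.coboundary 𝕜 γ F = if Ψ.IsFace F then ∑ i ∈ F, sgn F i • γ (F.erase i) else 0 := rfl

/-- The dimension of the relative simplicial cohomology in the degree of the faces with `p`
elements. -/
def cohDim (p : ℕ) : ℕ :=
  relDim (Ψ.relCochains 𝕜 p ⊓ LinearMap.ker (Ψ.coboundary 𝕜))
    (horBoundary (fun p _ => Ψ.relCochains 𝕜 p) (Ψ.coboundary 𝕜) p 0)

variable {Ψ 𝕜}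

theorem adm_zero_iff {F : Finset (Fin n)} : Ψ.Adm F 0 ↔ Ψ.IsFace F := by
  have : suppSet (0 : Fin n → ℤ) = ∅ := by simp [suppSet]
  rw [Adm, this, Finset.union_empty]
  exact and_iff_right fun i _ => le_rfl

variable (Ψ 𝕜) in
/-- The component of fine degree zero. -/
def evalZero (ℓ e : ℕ) : (Finset (Fin ℓ) → Ψ.Cech 𝕜) →ₗ[𝕜]
    ({J : Finset (Fin ℓ) // J.card = e} → Finset (Fin n) → 𝕜) where
  toFun z J F := (z J F).1 0
  map_add' _ _ := rfl
  map_smul' _ _ := rfl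

theorem evalZero_apply {ℓ e : ℕ} (z : Finset (Fin ℓ) → Ψ.Cech 𝕜)
    (J : {J : Finset (Fin ℓ) // J.card = e}) (F : Finset (Fin n)) :
    Ψ.evalZero 𝕜 ℓ e z J F = (z J F).1 0 := rfl

theorem evalZero_dblHor {ℓ e : ℕ} (z : Finset (Fin ℓ) → Ψ.Cech 𝕜)
    (J : {J : Finset (Fin ℓ) // J.card = e}) :
    Ψ.evalZero 𝕜 ℓ e (Ψ.dblHor 𝕜 ℓ z) J = Ψ.coboundary 𝕜 (Ψ.evalZero 𝕜 ℓ e z J) := by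
  classical
  ext F
  rw [evalZero_apply, dblHor_apply, cechDiff_apply_apply, coboundary_apply]
  simp only [adm_zero_iff]
  rfl

theorem evalZero_mem {ℓ e p q : ℕ} {z : Finset (Fin ℓ) → Ψ.Cech 𝕜} (hz : z ∈ Ψ.dbl 𝕜 ℓ e p q)
    (J : {J : Finset (Fin ℓ) // J.card = e}) : Ψ.evalZero 𝕜 ℓ e z J ∈ Ψ.relCochains 𝕜 p :=
  fun F hF => ⟨(hz J F 0 hF).2.1, adm_zero_iff.1 ((z J F).2 0 hF)⟩

theorem exists_evalZero_eq {ℓ e p : ℕ}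
    {w : {J : Finset (Fin ℓ) // J.card = e} → Finset (Fin n) → 𝕜}
    (hw : ∀ J, w J ∈ Ψ.relCochains 𝕜 p) :
    ∃ z ∈ Ψ.dbl 𝕜 ℓ e p e, Ψ.evalZero 𝕜 ℓ e z = w ∧ ∀ J F a, a ≠ 0 → (z J F).1 a = 0 := by
  classical
  let z : Finset (Fin ℓ) → Ψ.Cech 𝕜 := fun J F =>
    ⟨if h : J.card = e then Finsupp.single 0 (w ⟨J, h⟩ F) else 0, by
      split_ifs with h
      · intro a ha
        rw [Finsupp.single_apply] at ha
        split_ifs at ha with h0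
        · rw [← h0, adm_zero_iff]
          exact (hw _ F ha).2
        · exact (ha rfl).elim
      · exact Submodule.zero_mem _⟩
  have hz : ∀ J F, (z J F).1 = if h : J.card = e then Finsupp.single 0 (w ⟨J, h⟩ F) else 0 :=
    fun _ _ => rfl
  refine ⟨z, fun J F a ha => ?_, ?_, fun J F a ha => ?_⟩
  · rw [hz] at ha
    split_ifs at ha with h
    · rw [Finsupp.single_apply] at ha
      split_ifs at ha with h0
      · refine ⟨h, (hw _ F ha).1, ?_⟩
        simp [← h0]
      · exact (ha rfl).elim
    · exact (ha rfl).elim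
  · ext J F
    rw [evalZero_apply, hz, dif_pos J.2, Finsupp.single_eq_same]
  · rw [hz]
    split_ifs
    · rw [Finsupp.single_eq_of_ne ha]
    · rfl

/-- The cohomology of the row in which fine degree zero occurs. -/
theorem relDim_row {ℓ e p : ℕ}
    (hW : HasWeakParameters (X : Fin n → MvPolynomial (Fin n) 𝕜) (p + 1)
      (⊥ : Submodule (MvPolynomial (Fin n) 𝕜) (Ψ.faceModule 𝕜))) :
    relDim (Ψ.dbl 𝕜 ℓ e p e ⊓ LinearMap.ker (Ψ.dblHor 𝕜 ℓ))
      (horBoundary (Ψ.dbl 𝕜 ℓ e) (Ψ.dblHor 𝕜 ℓ) p e) = ℓ.choose e * Ψ.cohDim 𝕜 p := by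
  have hcard : Fintype.card {J : Finset (Fin ℓ) // J.card = e} = ℓ.choose e := by
    rw [Fintype.card_finset_len, Fintype.card_fin]
  rw [← hcard, cohDim, ← relDim_pi]
  have hδ : ∀ z ∈ Ψ.dbl 𝕜 ℓ e p e, (∀ J F a, a ≠ 0 → (z J F).1 a = 0) →
      (∀ J, Ψ.coboundary 𝕜 (Ψ.evalZero 𝕜 ℓ e z J) = 0) → Ψ.dblHor 𝕜 ℓ z = 0 := by
    classical
    intro z hz h0 h
    ext J F a
    by_contra hne
    have hJ : J.card = e := (dblHor_mem hz J F a hne).1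
    by_cases ha : a = 0
    · subst ha
      have := congrFun (h ⟨J, hJ⟩) F
      rw [← evalZero_dblHor] at this
      exact hne this
    · apply hne
      rw [dblHor_apply, cechDiff_apply_apply, Finset.sum_eq_zero, ite_self]
      · rfl
      · intro i _
        rw [h0 _ _ _ ha, smul_zero]
  have hmem : ∀ z ∈ Ψ.dbl 𝕜 ℓ e p e, Ψ.dblHor 𝕜 ℓ z = 0 → Ψ.evalZero 𝕜 ℓ e z = 0 →
      z ∈ horBoundary (Ψ.dbl 𝕜 ℓ e) (Ψ.dblHor 𝕜 ℓ) p e := by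
    intro z hz hδz h0
    refine mem_horBoundary_of_apply_zero hW hz hδz fun J F => ?_
    by_contra hne
    exact hne (congrFun (congrFun h0 ⟨J, (hz J F 0 hne).1⟩) F)
  refine relDim_congr (Ψ.evalZero 𝕜 ℓ e) ?_ ?_ ?_
  · rintro z ⟨hz, hz'⟩ J _
    refine Submodule.mem_inf.2 ⟨evalZero_mem hz J, ?_⟩
    rw [LinearMap.mem_ker, ← evalZero_dblHor, LinearMap.mem_ker.1 hz']
    rfl
  · intro w hw
    obtain ⟨z, hz, hzw, h0⟩ := exists_evalZero_eq fun J => (hw J trivial).1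
    refine ⟨z, ⟨hz, ?_⟩, ?_⟩
    · exact LinearMap.mem_ker.2 (hδ z hz h0 fun J => by rw [hzw]; exact (hw J trivial).2)
    · rw [hzw, sub_self]
      exact Submodule.zero_mem _
  · rintro z ⟨hz, hz'⟩
    rw [SetLike.mem_coe, LinearMap.mem_ker] at hz'
    cases p with
    | zero =>
      constructor
      · intro h
        refine hmem z hz hz' (funext fun J => ?_)
        exact (Submodule.mem_bot 𝕜).1 (h J trivial)
      · intro h J _
        rw [(Submodule.mem_bot 𝕜).1 h, map_zero]
        exact Submodule.zero_mem _
    | succ p =>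
      constructor
      · intro h
        choose v hv hvz using fun J => h J trivial
        obtain ⟨y, hy, hyv, _⟩ := exists_evalZero_eq hv
        have hy' : Ψ.dblHor 𝕜 ℓ y ∈ horBoundary (Ψ.dbl 𝕜 ℓ e) (Ψ.dblHor 𝕜 ℓ) (p + 1) e :=
          ⟨y, hy, rfl⟩
        rw [← sub_add_cancel z (Ψ.dblHor 𝕜 ℓ y)]
        refine Submodule.add_mem _ (hmem _ (Submodule.sub_mem _ hz (dblHor_mem hy)) ?_ ?_) hy'
        · rw [map_sub, hz', dblHor_dblHor, sub_zero]
        · rw [map_sub, sub_eq_zero]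
          ext1 J
          rw [evalZero_dblHor, hyv, hvz]
      · rintro ⟨y, hy, rfl⟩ J _
        exact ⟨_, evalZero_mem hy J, (evalZero_dblHor y J).symm⟩

/-! #### The initial column -/

variable (Ψ 𝕜) in
/-- The homogeneous component of degree `s` of the face module, as a space of Laurent
polynomials. -/
def homog (s : ℤ) : Submodule 𝕜 ((Fin n → ℤ) →₀ 𝕜) :=
  Finsupp.supported 𝕜 𝕜 {a | Ψ.Adm ∅ a ∧ ∑ i, a i = s}

theorem mem_homog {s : ℤ} {g : (Fin n → ℤ) →₀ 𝕜} :
    g ∈ Ψ.homog 𝕜 s ↔ ∀ a, g a ≠ 0 → Ψ.Adm ∅ a ∧ ∑ i, a i = s := by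
  rw [homog, Finsupp.mem_supported]
  exact forall_congr' fun a => by simp

theorem finite_setOf_adm (s : ℤ) : {a : Fin n → ℤ | Ψ.Adm ∅ a ∧ ∑ i, a i = s}.Finite := by
  refine (Set.finite_Icc (0 : Fin n → ℤ) fun _ => s).subset ?_
  rintro a ⟨ha, hs⟩
  refine ⟨fun i => ha.1 i (Finset.notMem_empty i), fun i => ?_⟩
  rw [← hs]
  exact Finset.single_le_sum (fun j _ => ha.1 j (Finset.notMem_empty j)) (Finset.mem_univ i)

instance finiteDimensional_homog (s : ℤ) : FiniteDimensional 𝕜 (Ψ.homog 𝕜 s) := by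
  have := (finite_setOf_adm (Ψ := Ψ) s).to_subtype
  exact Module.Finite.equiv
    (Finsupp.supportedEquivFinsupp {a | Ψ.Adm ∅ a ∧ ∑ i, a i = s}).symm

theorem finrank_homog (s : ℤ) :
    Module.finrank 𝕜 (Ψ.homog 𝕜 s) = Nat.card {a : Fin n → ℤ // Ψ.Adm ∅ a ∧ ∑ i, a i = s} := by
  have := (finite_setOf_adm (Ψ := Ψ) s).to_subtype
  have hf := Fintype.ofFinite {a : Fin n → ℤ | Ψ.Adm ∅ a ∧ ∑ i, a i = s}
  rw [homog, (Finsupp.supportedEquivFinsupp (M := 𝕜) (R := 𝕜)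
    {a : Fin n → ℤ | Ψ.Adm ∅ a ∧ ∑ i, a i = s}).finrank_eq]
  rw [Module.finrank_finsupp_self, ← Nat.card_eq_fintype_card]
  rfl

theorem finrank_homog_of_neg {s : ℤ} (hs : s < 0) : Module.finrank 𝕜 (Ψ.homog 𝕜 s) = 0 := by
  rw [finrank_homog]
  have : IsEmpty {a : Fin n → ℤ // Ψ.Adm ∅ a ∧ ∑ i, a i = s} := by
    refine ⟨fun ⟨a, ha, h⟩ => ?_⟩
    have := Finset.sum_nonneg fun i (_ : i ∈ Finset.univ) => ha.1 i (Finset.notMem_empty i)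
    omega
  exact Nat.card_of_isEmpty

theorem finrank_component (j : ℕ) :
    Module.finrank 𝕜 (Ψ.component 𝕜 j) = Module.finrank 𝕜 (Ψ.homog 𝕜 j) := by
  have : (Ψ.component 𝕜 j).map (Ψ.toLaurent 𝕜) = Ψ.homog 𝕜 j := by
    ext g
    rw [mem_homog]
    constructor
    · rintro ⟨m, hm, rfl⟩ a ha
      exact ⟨toLaurent_mem m a ha, (mem_component_iff m j).1 hm a ha⟩
    · intro h
      obtain ⟨m, rfl⟩ := exists_toLaurent_eq fun a ha => (h a ha).1
      exact ⟨m, (mem_component_iff m j).2 fun a ha => (h a ha).2, rfl⟩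
  rw [← this]
  exact (Submodule.equivMapOfInjective _ toLaurent_injective _).finrank_eq

theorem homog_le_Loc {s : ℤ} {g : (Fin n → ℤ) →₀ 𝕜} (hg : g ∈ Ψ.homog 𝕜 s) : g ∈ Ψ.Loc 𝕜 ∅ :=
  fun a ha => (mem_homog.1 hg a ha).1

variable (Ψ 𝕜) in
/-- The components of the initial column. -/
def evalEmpty (ℓ q : ℕ) : (Finset (Fin ℓ) → Ψ.Cech 𝕜) →ₗ[𝕜]
    ({J : Finset (Fin ℓ) // J.card = q} → (Fin n → ℤ) →₀ 𝕜) where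
  toFun z J := (z J ∅).1
  map_add' _ _ := rfl
  map_smul' _ _ := rfl

theorem evalEmpty_mem {ℓ e q : ℕ} {z : Finset (Fin ℓ) → Ψ.Cech 𝕜} (hz : z ∈ Ψ.dbl 𝕜 ℓ e 0 q) :
    Ψ.evalEmpty 𝕜 ℓ q z ∈ Submodule.pi Set.univ fun _ => Ψ.homog 𝕜 ((e : ℤ) - q) := by
  intro J _
  refine mem_homog.2 fun a ha => ⟨(z J ∅).2 a ha, ?_⟩
  have := (hz J ∅ a ha).2.2
  omega

theorem eq_zero_of_evalEmpty {ℓ e q : ℕ} {z : Finset (Fin ℓ) → Ψ.Cech 𝕜}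
    (hz : z ∈ Ψ.dbl 𝕜 ℓ e 0 q) (h : Ψ.evalEmpty 𝕜 ℓ q z = 0) : z = 0 := by
  ext J F a
  by_contra hne
  obtain ⟨h1, h2, _⟩ := hz J F a hne
  rw [Finset.card_eq_zero] at h2
  subst h2
  exact hne (DFunLike.congr_fun (congrFun h ⟨J, h1⟩) a)

instance finiteDimensional_dbl (ℓ e q : ℕ) : FiniteDimensional 𝕜 (Ψ.dbl 𝕜 ℓ e 0 q) := by
  have := finiteDimensional_pi_submodule (k := 𝕜) (κ := {J : Finset (Fin ℓ) // J.card = q})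
    (V₁ := Ψ.homog 𝕜 ((e : ℤ) - q))
  exact finiteDimensional_of_injOn (Ψ.evalEmpty 𝕜 ℓ q) (fun _ => evalEmpty_mem)
    fun _ => eq_zero_of_evalEmpty

theorem finrank_dbl (ℓ e q : ℕ) :
    Module.finrank 𝕜 (Ψ.dbl 𝕜 ℓ e 0 q) =
      ℓ.choose q * Module.finrank 𝕜 (Ψ.homog 𝕜 ((e : ℤ) - q)) := by
  classical
  have hcard : Fintype.card {J : Finset (Fin ℓ) // J.card = q} = ℓ.choose q := by
    rw [Fintype.card_finset_len, Fintype.card_fin]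
  have hbot : (Submodule.pi Set.univ fun _ : {J : Finset (Fin ℓ) // J.card = q} =>
      (⊥ : Submodule 𝕜 ((Fin n → ℤ) →₀ 𝕜))) = ⊥ := by
    ext w
    simp [funext_iff]
  rw [← relDim_bot (Ψ.dbl 𝕜 ℓ e 0 q), ← relDim_bot (Ψ.homog 𝕜 ((e : ℤ) - q)), ← hcard,
    ← relDim_pi, hbot]
  refine relDim_congr (Ψ.evalEmpty 𝕜 ℓ q) (fun _ => evalEmpty_mem) (fun w hw => ?_) fun z hz => ?_
  · let z : Finset (Fin ℓ) → Ψ.Cech 𝕜 := fun J F =>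
      ⟨if h : J.card = q ∧ F = ∅ then w ⟨J, h.1⟩ else 0, by
        split_ifs with h
        · obtain ⟨hJ, rfl⟩ := h
          exact homog_le_Loc (hw _ trivial)
        · exact Submodule.zero_mem _⟩
    have hz : ∀ J F, (z J F).1 = if h : J.card = q ∧ F = ∅ then w ⟨J, h.1⟩ else 0 :=
      fun _ _ => rfl
    refine ⟨z, fun J F a ha => ?_, ?_⟩
    · rw [hz] at ha
      split_ifs at ha with h
      · refine ⟨h.1, by rw [h.2, Finset.card_empty], ?_⟩
        rw [(mem_homog.1 (hw _ trivial) a ha).2]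
        ring
      · exact (ha rfl).elim
    · rw [Submodule.mem_bot, sub_eq_zero]
      ext1 J
      change w J = (z J ∅).1
      rw [hz, dif_pos ⟨J.2, rfl⟩]
  · rw [Submodule.mem_bot, Submodule.mem_bot]
    exact ⟨eq_zero_of_evalEmpty hz, fun h => by rw [h, map_zero]⟩

theorem dblVer_eq_zero {ℓ e p : ℕ} (Θ : Fin ℓ → MvPolynomial (Fin n) 𝕜)
    {z : Finset (Fin ℓ) → Ψ.Cech 𝕜} (hz : z ∈ Ψ.dbl 𝕜 ℓ e p 0) : Ψ.dblVer Θ z = 0 := by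
  ext1 J
  rw [koszulDown_apply]
  refine Finset.sum_eq_zero fun j _ => ?_
  have : z (insert j J) = 0 := by
    ext F a
    by_contra hne
    exact Finset.insert_ne_empty _ _ (Finset.card_eq_zero.1 (hz _ F a hne).1)
  rw [this, map_zero, smul_zero]

variable (Ψ) in
/-- The image in degree `s + 1` of the multiplication by linear forms. -/
def linImage {ℓ : ℕ} (Θ : Fin ℓ → MvPolynomial (Fin n) 𝕜) (s : ℤ) :
    Submodule 𝕜 ((Fin n → ℤ) →₀ 𝕜) :=
  (Submodule.pi Set.univ fun _ : Fin ℓ => Ψ.homog 𝕜 s).map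
    (∑ j, Ψ.linOp ∅ (Θ j) ∘ₗ LinearMap.proj j)

theorem mem_linImage {ℓ : ℕ} {Θ : Fin ℓ → MvPolynomial (Fin n) 𝕜} {s : ℤ}
    {g : (Fin n → ℤ) →₀ 𝕜} : g ∈ Ψ.linImage Θ s ↔ ∃ w : Fin ℓ → (Fin n → ℤ) →₀ 𝕜,
      (∀ j, w j ∈ Ψ.homog 𝕜 s) ∧ ∑ j, Ψ.linOp ∅ (Θ j) (w j) = g := by
  constructor
  · rintro ⟨w, hw, rfl⟩
    exact ⟨w, fun j => hw j trivial, by simp⟩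
  · rintro ⟨w, hw, rfl⟩
    exact ⟨w, fun j _ => hw j, by simp⟩

/-- With `finrank_quotientComponent`, this makes the bottom homology of the initial column the
degree `e` part of `M / Θ M`. -/
theorem relDim_column_zero {ℓ : ℕ} (Θ : Fin ℓ → MvPolynomial (Fin n) 𝕜) (e : ℕ) :
    relDim (Ψ.dbl 𝕜 ℓ e 0 0 ⊓ LinearMap.ker (Ψ.dblVer Θ))
      ((Ψ.dbl 𝕜 ℓ e 0 1).map (Ψ.dblVer Θ)) =
    relDim (Ψ.homog 𝕜 e) (Ψ.linImage Θ ((e : ℤ) - 1)) := by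
  classical
  have hver : ∀ y : Finset (Fin ℓ) → Ψ.Cech 𝕜,
      (Ψ.dblVer Θ y ∅ ∅).1 = ∑ j, Ψ.linOp ∅ (Θ j) (y {j} ∅).1 := by
    intro y
    rw [dblVer_apply_apply, koszulDown_linLoc_coe]
    simp [sgn]
  let f : (Finset (Fin ℓ) → Ψ.Cech 𝕜) →ₗ[𝕜] ((Fin n → ℤ) →₀ 𝕜) :=
    (Ψ.Loc 𝕜 ∅).subtype ∘ₗ Cech.proj Ψ 𝕜 ∅ ∘ₗ
      LinearMap.proj (R := 𝕜) (φ := fun _ : Finset (Fin ℓ) => Ψ.Cech 𝕜) ∅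
  have hf : ∀ z, f z = (z ∅ ∅).1 := fun _ => rfl
  refine relDim_congr f ?_ (fun g hg => ?_) ?_
  · rintro z ⟨hz, _⟩
    refine mem_homog.2 fun a ha => ⟨(z ∅ ∅).2 a ha, ?_⟩
    simpa using (hz ∅ ∅ a ha).2.2
  · let z : Finset (Fin ℓ) → Ψ.Cech 𝕜 := fun J F =>
      ⟨if J = ∅ ∧ F = ∅ then g else 0, by
        split_ifs with h
        · rw [h.2]
          exact homog_le_Loc hg
        · exact Submodule.zero_mem _⟩
    have hz : z ∈ Ψ.dbl 𝕜 ℓ e 0 0 := by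
      intro J F a ha
      change (if J = ∅ ∧ F = ∅ then g else 0) a ≠ 0 at ha
      split_ifs at ha with h
      · refine ⟨by rw [h.1, Finset.card_empty], by rw [h.2, Finset.card_empty], ?_⟩
        rw [(mem_homog.1 hg a ha).2]
        simp
      · exact (ha rfl).elim
    refine ⟨z, ⟨hz, dblVer_eq_zero Θ hz⟩, ?_⟩
    have : f z = g := by
      change (if (∅ : Finset (Fin ℓ)) = ∅ ∧ (∅ : Finset (Fin n)) = ∅ then g else 0) = g
      simp
    rw [this, sub_self]
    exact Submodule.zero_mem _
  · rintro z ⟨hz, _⟩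
    rw [hf, mem_linImage]
    constructor
    · rintro ⟨w, hw, hwz⟩
      let y : Finset (Fin ℓ) → Ψ.Cech 𝕜 := fun J F =>
        ⟨if F = ∅ then ∑ j, (if J = {j} then w j else 0) else 0, by
          split_ifs with h
          · rw [h]
            refine Submodule.sum_mem _ fun j _ => ?_
            split_ifs
            · exact homog_le_Loc (hw j)
            · exact Submodule.zero_mem _
          · exact Submodule.zero_mem _⟩
      have hy : ∀ J F, (y J F).1 = if F = ∅ then ∑ j, (if J = {j} then w j else 0) else 0 :=
        fun _ _ => rfl
      have hy1 : ∀ j, (y {j} ∅).1 = w j := by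
        intro j
        rw [hy, if_pos rfl, Finset.sum_eq_single j]
        · rw [if_pos rfl]
        · intro i _ hij
          rw [if_neg]
          simpa using fun h => hij h.symm
        · simp
      have hymem : y ∈ Ψ.dbl 𝕜 ℓ e 0 1 := by
        intro J F a ha
        rw [hy] at ha
        split_ifs at ha with hF
        · rw [Finsupp.finsetSum_apply] at ha
          obtain ⟨j, _, hj⟩ := Finset.exists_ne_zero_of_sum_ne_zero ha
          split_ifs at hj with hJ
          · refine ⟨by rw [hJ, Finset.card_singleton], by rw [hF, Finset.card_empty], ?_⟩
            rw [(mem_homog.1 (hw j) a hj).2]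
            simp
          · exact (hj rfl).elim
        · exact (ha rfl).elim
      refine ⟨y, hymem, ?_⟩
      ext J F a
      by_contra hne
      have h00 : J = ∅ ∧ F = ∅ := by
        have hsub : Ψ.dblVer Θ y - z ∈ Ψ.dbl 𝕜 ℓ e 0 0 :=
          Submodule.sub_mem _ (dblVer_mem Θ hymem) hz
        have := hsub J F a (sub_ne_zero.2 hne)
        exact ⟨Finset.card_eq_zero.1 this.1, Finset.card_eq_zero.1 this.2.1⟩
      obtain ⟨rfl, rfl⟩ := h00
      apply hne
      rw [hver, ← hwz]
      simp only [hy1]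
    · rintro ⟨y, hy, rfl⟩
      refine ⟨fun j => (y {j} ∅).1, fun j => mem_homog.2 fun a ha => ⟨(y _ _).2 a ha, ?_⟩,
        (hver y).symm⟩
      have := (hy _ _ a ha).2.2
      push_cast at this
      omega

theorem finrank_quotientComponent {ℓ : ℕ} {Θ : Fin ℓ → MvPolynomial (Fin n) 𝕜}
    (hΘ : ∀ i, (Θ i).IsHomogeneous 1) (e : ℕ) :
    Module.finrank 𝕜 (Ψ.quotientComponent Θ e) =
      relDim (Ψ.homog 𝕜 e) (Ψ.linImage Θ ((e : ℤ) - 1)) := by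
  rw [quotientComponent, finrank_map_eq_relDim]
  have hmem : ∀ m : Ψ.faceModule 𝕜, m ∈ paramSubmodule (Ψ.faceModule 𝕜) Θ ↔
      ∃ g : Fin ℓ → Ψ.faceModule 𝕜, m = ∑ j, Θ j • g j := by
    intro m
    have := mem_span_image_smul_top_iff Θ Finset.univ m
    rwa [Finset.coe_univ, Set.image_univ] at this
  refine relDim_congr (Ψ.toLaurent 𝕜) (fun m hm => ?_) (fun g hg => ?_) fun m hm => ?_
  · exact mem_homog.2 fun a ha => ⟨toLaurent_mem m a ha, (mem_component_iff m e).1 hm a ha⟩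
  · obtain ⟨m, rfl⟩ := exists_toLaurent_eq (homog_le_Loc hg)
    refine ⟨m, (mem_component_iff m e).2 fun a ha => (mem_homog.1 hg a ha).2, ?_⟩
    rw [sub_self]
    exact Submodule.zero_mem _
  · have hker : m ∈ LinearMap.ker ((paramSubmodule (Ψ.faceModule 𝕜) Θ).mkQ.restrictScalars 𝕜) ↔
        m ∈ paramSubmodule (Ψ.faceModule 𝕜) Θ := by
      rw [LinearMap.mem_ker]
      exact Submodule.Quotient.mk_eq_zero _
    rw [hker, hmem, mem_linImage]
    constructor
    · rintro ⟨w, hw, h⟩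
      choose g hg using fun j => exists_toLaurent_eq (homog_le_Loc (hw j))
      refine ⟨g, toLaurent_injective ?_⟩
      rw [map_sum, ← h]
      refine Finset.sum_congr rfl fun j _ => ?_
      rw [toLaurent_smul (hΘ j), hg]
    · rintro ⟨g, rfl⟩
      refine ⟨fun j => degPart ((e : ℤ) - 1) (Ψ.toLaurent 𝕜 (g j)), fun j => ?_, ?_⟩
      · refine mem_homog.2 fun a ha => ⟨degPart_mem (toLaurent_mem _) _ a ha, ?_⟩
        rw [degPart_apply] at ha
        by_contra hne
        rw [if_neg hne] at ha
        exact ha rfl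
      · have h1 : degPart (e : ℤ) (Ψ.toLaurent 𝕜 (∑ j, Θ j • g j)) =
            Ψ.toLaurent 𝕜 (∑ j, Θ j • g j) := by
          ext a
          rw [degPart_apply, ite_eq_left_iff]
          intro hs
          by_contra hne
          exact hs ((mem_component_iff _ e).1 hm a (Ne.symm hne))
        rw [← h1, map_sum, map_sum]
        refine Finset.sum_congr rfl fun j _ => ?_
        rw [linOp_degPart, toLaurent_smul (hΘ j), sub_add_cancel]

/-- The relation between the Hilbert functions of `M` and `M / Θ M`, in terms of relative
cohomology. -/
theorem sum_choose_mul_finrank {ℓ : ℕ} {Θ : Fin ℓ → MvPolynomial (Fin n) 𝕜}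
    (hΘ : ∀ i, (Θ i).IsHomogeneous 1)
    (hΘW : ∀ (i : Fin ℓ) (m : Ψ.faceModule 𝕜),
      Θ i • m ∈ initialSubmodule (Ψ.faceModule 𝕜) Θ i →
      ∀ l : Fin n, (X l : MvPolynomial (Fin n) 𝕜) • m ∈ initialSubmodule (Ψ.faceModule 𝕜) Θ i)
    (hW : HasWeakParameters (X : Fin n → MvPolynomial (Fin n) 𝕜) ℓ
      (⊥ : Submodule (MvPolynomial (Fin n) 𝕜) (Ψ.faceModule 𝕜))) (e : ℕ) :
    ∑ q ∈ Finset.range (ℓ + 1), (-1 : ℤ) ^ q *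
        (ℓ.choose q * Module.finrank 𝕜 (Ψ.homog 𝕜 ((e : ℤ) - q))) =
      Module.finrank 𝕜 (Ψ.quotientComponent Θ e) +
        (ℓ.choose e : ℤ) * ∑ i ∈ Finset.range e, (-1 : ℤ) ^ (e - i) * Ψ.cohDim 𝕜 i := by
  have hdc := isDoubleComplex_dbl (Ψ := Ψ) Θ e
  have htop : ∀ p q, ℓ < q → Ψ.dbl 𝕜 ℓ e p q = ⊥ := fun p q hq => dbl_eq_bot hq
  have hr : ∀ p q, p < ℓ → q ≠ e → ∀ z ∈ Ψ.dbl 𝕜 ℓ e p q, Ψ.dblHor 𝕜 ℓ z = 0 →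
      z ∈ horBoundary (Ψ.dbl 𝕜 ℓ e) (Ψ.dblHor 𝕜 ℓ) p q :=
    fun p q hp hq z hz hδ => dbl_row_exact hW hp hq hz hδ
  have hc : ∀ p q, ∀ z ∈ Ψ.dbl 𝕜 ℓ e (p + 1) (q + 1), Ψ.dblVer Θ z = 0 →
      z ∈ (Ψ.dbl 𝕜 ℓ e (p + 1) (q + 2)).map (Ψ.dblVer Θ) :=
    fun p q z hz hD => dbl_col_exact hΘ hΘW hz hD
  -- The Euler characteristic of the initial column, by terms and by homology.
  have euler := sum_neg_one_pow_finrank (k := 𝕜) (fun q => Ψ.dbl 𝕜 ℓ e 0 q) (Ψ.dblVer Θ)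
    (fun q z hz => dblVer_mem Θ hz) (fun q z _ => dblVer_dblVer Θ z)
    (fun z hz => dblVer_eq_zero Θ hz) (L := ℓ) (dbl_eq_bot (Nat.lt_succ_self ℓ))
  simp only [finrank_dbl] at euler
  push_cast at euler
  rw [euler, Finset.sum_range_succ', relDim_column_zero, ← finrank_quotientComponent hΘ, pow_zero,
    one_mul, add_comm]
  congr 1
  by_cases he : e ≤ ℓ
  -- Above row `e` the initial column would sit in negative degrees and is zero. The reflection `q =
  -- e - 1 - i` then matches the homology at `q + 1 = e - i` with relative cohomology at faces of
  -- `i` elements.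
  · have hterm : ∀ q ∈ Finset.range ℓ, q ∉ Finset.range e →
        (-1 : ℤ) ^ (q + 1) * (relDim (Ψ.dbl 𝕜 ℓ e 0 (q + 1) ⊓ LinearMap.ker (Ψ.dblVer Θ))
          ((Ψ.dbl 𝕜 ℓ e 0 (q + 1 + 1)).map (Ψ.dblVer Θ)) : ℤ) = 0 := by
      intro q _ hq
      rw [Finset.mem_range, not_lt] at hq
      have hbot : Ψ.dbl 𝕜 ℓ e 0 (q + 1) = ⊥ := by
        rw [← Submodule.finrank_eq_zero (R := 𝕜), finrank_dbl, finrank_homog_of_neg, mul_zero]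
        push_cast
        omega
      rw [relDim_eq_zero, Nat.cast_zero, mul_zero]
      rw [hbot, bot_inf_eq]
      exact bot_le
    rw [← Finset.sum_subset (Finset.range_subset_range.2 he) hterm,
      ← Finset.sum_range_reflect, Finset.mul_sum]
    refine Finset.sum_congr rfl fun i hi => ?_
    rw [Finset.mem_range] at hi
    have e1 : e - 1 - i + 1 = e - i := by omega
    rw [hdc.relDim_vertical_eq_horizontal htop hr hc he (i := i) (by omega),
      relDim_row (hW.mono (by omega)), e1]
    push_cast
    ring
  · rw [Nat.choose_eq_zero_of_lt (by omega), Nat.cast_zero, zero_mul]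
    refine Finset.sum_eq_zero fun q _ => ?_
    rw [hdc.relDim_vertical_eq_zero htop hr hc (by omega), Nat.cast_zero, mul_zero]

end RelativeComplex

end Count

/-! ### Duality between relative homology and cohomology -/

section Duality

theorem finrank_inf_ker_add_finrank_map {k V W : Type*} [Field k] [AddCommGroup V] [Module k V]
    [AddCommGroup W] [Module k W] (f : V →ₗ[k] W) (V₁ : Submodule k V) [FiniteDimensional k V₁] :
    Module.finrank k (V₁ ⊓ LinearMap.ker f : Submodule k V) + Module.finrank k (V₁.map f) =
      Module.finrank k V₁ := by
  rw [← relDim_add_finrank (inf_le_left : V₁ ⊓ LinearMap.ker f ≤ V₁), finrank_map_eq_relDim,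
    add_comm]
  congr 1
  refine relDim_congr LinearMap.id (fun _ h => h) (fun w hw => ⟨w, hw, ?_⟩) fun v hv => ?_
  · rw [LinearMap.id_apply, sub_self]
    exact Submodule.zero_mem _
  · exact ⟨fun h => h.2, fun h => ⟨hv, h⟩⟩

namespace RelativeComplex

variable {n : ℕ} (Ψ : RelativeComplex n) (𝕜 : Type*) [Field 𝕜]

open Classical in
instance : Fintype {σ : Finset (Fin n) // Ψ.IsFace σ} := inferInstance

open Classical in
/-- The matrix of the relative simplicial boundary map on the faces with `p` elements. -/
def boundaryMatrix (p : ℕ) : Matrix {σ : Finset (Fin n) // Ψ.IsFace σ}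
    {σ : Finset (Fin n) // Ψ.IsFace σ} 𝕜 :=
  fun τ σ => if σ.1.card = p then
    ∑ v ∈ σ.1, if σ.1.erase v = τ.1 then (sgn σ.1 v : 𝕜) else 0 else 0

open Classical in
/-- Extension by zero of a function on the set of faces. -/
def extendZero : Ψ.Chains 𝕜 →ₗ[𝕜] (Finset (Fin n) → 𝕜) where
  toFun c F := if h : Ψ.IsFace F then c ⟨F, h⟩ else 0
  map_add' a b := by
    ext F
    by_cases h : Ψ.IsFace F <;> simp [h]
  map_smul' r a := by
    ext F
    by_cases h : Ψ.IsFace F <;> simp [h]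

variable {Ψ 𝕜}

theorem extendZero_apply (c : Ψ.Chains 𝕜) (σ : {σ : Finset (Fin n) // Ψ.IsFace σ}) :
    Ψ.extendZero 𝕜 c σ.1 = c σ := dif_pos σ.2

theorem extendZero_of_not (c : Ψ.Chains 𝕜) {F : Finset (Fin n)} (h : ¬ Ψ.IsFace F) :
    Ψ.extendZero 𝕜 c F = 0 := dif_neg h

theorem extendZero_injective : Function.Injective (Ψ.extendZero 𝕜) := by
  intro c c' h
  ext σ
  rw [← extendZero_apply c, h, extendZero_apply]

theorem map_extendZero (p : ℕ) :
    (Ψ.chainsOfDegree 𝕜 ((p : ℤ) - 1)).map (Ψ.extendZero 𝕜) = Ψ.relCochains 𝕜 p := by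
  ext γ
  constructor
  · rintro ⟨c, hc, rfl⟩ F hF
    by_cases h : Ψ.IsFace F
    · refine ⟨?_, h⟩
      by_contra hp
      exact hF ((extendZero_apply c ⟨F, h⟩).trans (hc ⟨F, h⟩ (by simp; omega)))
    · exact (hF (extendZero_of_not c h)).elim
  · intro h
    refine ⟨fun σ => γ σ.1, fun σ hσ => ?_, ?_⟩
    · by_contra hne
      have := (h σ.1 hne).1
      omega
    · ext F
      by_cases hF : Ψ.IsFace F
      · exact extendZero_apply _ ⟨F, hF⟩
      · rw [extendZero_of_not _ hF]
        by_contra hne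
        exact hF (h F (Ne.symm hne)).2

open Classical in
theorem boundary_apply (c : Ψ.Chains 𝕜) (τ : {σ : Finset (Fin n) // Ψ.IsFace σ}) :
    Ψ.boundary 𝕜 c τ =
      ∑ σ, c σ * ∑ v ∈ σ.1, if σ.1.erase v = τ.1 then (sgn σ.1 v : 𝕜) else 0 := by
  rw [boundary, Fintype.linearCombination_apply, Finset.sum_apply]
  refine Finset.sum_congr rfl fun σ _ => ?_
  rw [Pi.smul_apply, Finset.sum_apply, smul_eq_mul]
  congr 1
  refine Finset.sum_congr rfl fun v _ => ?_
  split_ifs with h1 h2 h2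
  · have : τ = ⟨σ.1.erase v, h1⟩ := Subtype.ext h2.symm
    rw [this, Pi.single_eq_same, sgn]
    push_cast
    rfl
  · rw [Pi.single_eq_of_ne]
    intro h
    exact h2 (congrArg Subtype.val h).symm
  · exact (h1 (h2 ▸ τ.2)).elim
  · rfl

theorem boundaryMatrix_mulVec (p : ℕ) {c : Ψ.Chains 𝕜}
    (hc : c ∈ Ψ.chainsOfDegree 𝕜 ((p : ℤ) - 1)) :
    (Ψ.boundaryMatrix 𝕜 p).mulVec c = Ψ.boundary 𝕜 c := by
  classical
  ext τ
  rw [boundary_apply, Matrix.mulVec, dotProduct]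
  refine Finset.sum_congr rfl fun σ _ => ?_
  rw [boundaryMatrix, mul_comm]
  split_ifs with h
  · rfl
  · rw [hc σ (by omega), zero_mul, zero_mul]

open Classical in
theorem boundaryMatrix_transpose_mulVec (p : ℕ) (c : Ψ.Chains 𝕜)
    (σ : {σ : Finset (Fin n) // Ψ.IsFace σ}) :
    (Ψ.boundaryMatrix 𝕜 p).transpose.mulVec c σ =
      if σ.1.card = p then Ψ.coboundary 𝕜 (Ψ.extendZero 𝕜 c) σ.1 else 0 := by
  rw [Matrix.mulVec, dotProduct]
  simp only [Matrix.transpose_apply, boundaryMatrix]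
  split_ifs with h
  · rw [coboundary_apply, if_pos σ.2]
    simp only [Finset.sum_mul]
    rw [Finset.sum_comm]
    refine Finset.sum_congr rfl fun v _ => ?_
    by_cases hf : Ψ.IsFace (σ.1.erase v)
    · rw [Finset.sum_eq_single ⟨σ.1.erase v, hf⟩, if_pos rfl, zsmul_eq_mul]
      · rw [← extendZero_apply c ⟨σ.1.erase v, hf⟩]
      · intro τ _ hτ
        rw [if_neg, zero_mul]
        intro h
        exact hτ (Subtype.ext h.symm)
      · simp
    · rw [extendZero_of_not c hf, smul_zero]
      refine Finset.sum_eq_zero fun τ _ => ?_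
      rw [if_neg, zero_mul]
      intro h
      exact hf (h ▸ τ.2)
  · simp

/-- Restricting to faces in between is harmless: a set between two faces is a face. -/
theorem coboundary_coboundary {γ : Finset (Fin n) → 𝕜} (hγ : ∀ F, γ F ≠ 0 → Ψ.IsFace F) :
    Ψ.coboundary 𝕜 (Ψ.coboundary 𝕜 γ) = 0 := by
  classical
  ext F
  rw [coboundary_apply]
  split_ifs with hF
  · have h := congrFun (koszulUp_koszulUp (fun _ : Fin n => (LinearMap.id : 𝕜 →ₗ[𝕜] 𝕜))
      (fun _ _ _ => rfl) γ) F
    rw [koszulUp_apply] at h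
    refine Eq.trans (Finset.sum_congr rfl fun i hi => ?_) h
    rw [coboundary_apply, koszulUp_apply, LinearMap.id_apply]
    simp only [LinearMap.id_apply]
    split_ifs with hi'
    · rfl
    · congr 1
      symm
      refine Finset.sum_eq_zero fun j hj => ?_
      rw [not_ne_iff.1 (mt (hγ _) fun h => hi' ?_), smul_zero]
      exact Ψ.isFace_of_subset_of_subset h hF (Finset.erase_subset _ _) (Finset.erase_subset _ _)
  · rfl

theorem extendZero_transpose_mulVec {p : ℕ} {c : Ψ.Chains 𝕜}
    (hc : c ∈ Ψ.chainsOfDegree 𝕜 ((p : ℤ) - 1)) :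
    Ψ.extendZero 𝕜 ((Ψ.boundaryMatrix 𝕜 (p + 1)).transpose.mulVec c) =
      Ψ.coboundary 𝕜 (Ψ.extendZero 𝕜 c) := by
  classical
  ext F
  by_cases hF : Ψ.IsFace F
  · rw [extendZero_apply _ ⟨F, hF⟩, boundaryMatrix_transpose_mulVec]
    split_ifs with h
    · rfl
    · rw [coboundary_apply, if_pos hF, Finset.sum_eq_zero]
      intro i hi
      have : Ψ.extendZero 𝕜 c (F.erase i) = 0 := by
        by_cases hi' : Ψ.IsFace (F.erase i)
        · rw [extendZero_apply c ⟨_, hi'⟩]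
          refine hc _ fun h' => h ?_
          have := Finset.card_erase_add_one hi
          simp only at h' ⊢
          omega
        · exact extendZero_of_not c hi'
      rw [this, smul_zero]
  · rw [extendZero_of_not _ hF, coboundary_apply, if_neg hF]

theorem transpose_mulVec_mem (p : ℕ) (c : Ψ.Chains 𝕜) :
    (Ψ.boundaryMatrix 𝕜 p).transpose.mulVec c ∈ Ψ.chainsOfDegree 𝕜 ((p : ℤ) - 1) := by
  classical
  intro σ hσ
  rw [boundaryMatrix_transpose_mulVec, if_neg]
  omega

/-- Obtained by transposition from `coboundary_coboundary`. -/
theorem boundaryMatrix_mul (p : ℕ) :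
    Ψ.boundaryMatrix 𝕜 p * Ψ.boundaryMatrix 𝕜 (p + 1) = 0 := by
  classical
  rw [← Matrix.transpose_eq_zero, Matrix.transpose_mul]
  refine Matrix.toLin'.injective (LinearMap.ext fun c => extendZero_injective ?_)
  rw [map_zero, LinearMap.zero_apply, map_zero, Matrix.toLin'_mul, LinearMap.comp_apply,
    Matrix.toLin'_apply, Matrix.toLin'_apply,
    extendZero_transpose_mulVec (transpose_mulVec_mem p c)]
  rcases p with _ | p
  · have : (Ψ.boundaryMatrix 𝕜 0).transpose.mulVec c = 0 := by
      ext σ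
      rw [boundaryMatrix_transpose_mulVec]
      split_ifs with h
      · rw [coboundary_apply, if_pos σ.2, Finset.card_eq_zero.1 h, Finset.sum_empty]
        rfl
      · rfl
    rw [this, map_zero, map_zero]
  · ext F
    have h := congrFun (coboundary_coboundary (Ψ := Ψ) (γ := Ψ.extendZero 𝕜 c) fun F hF => by
      by_contra h
      exact hF (extendZero_of_not c h)) F
    by_cases hF : Ψ.IsFace F
    · by_cases hcard : F.card = p + 2
      · rw [← h, coboundary_apply, if_pos hF, coboundary_apply, if_pos hF]
        refine Finset.sum_congr rfl fun i hi => ?_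
        congr 1
        by_cases hi' : Ψ.IsFace (F.erase i)
        · rw [extendZero_apply _ ⟨_, hi'⟩, boundaryMatrix_transpose_mulVec, if_pos]
          rw [Finset.card_erase_of_mem hi, hcard]
          rfl
        · rw [extendZero_of_not _ hi', coboundary_apply, if_neg hi']
      · rw [← extendZero_transpose_mulVec (transpose_mulVec_mem _ c),
          extendZero_apply _ ⟨F, hF⟩, boundaryMatrix_transpose_mulVec, if_neg hcard]
        rfl
    · rw [coboundary_apply, if_neg hF]
      rfl

theorem chainsOfDegree_map_boundary (p : ℕ) :
    (Ψ.chainsOfDegree 𝕜 ((p : ℤ) - 1)).map (Ψ.boundary 𝕜) =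
      LinearMap.range (Ψ.boundaryMatrix 𝕜 p).mulVecLin := by
  classical
  ext c
  constructor
  · rintro ⟨b, hb, rfl⟩
    exact ⟨b, boundaryMatrix_mulVec p hb⟩
  · rintro ⟨b, rfl⟩
    have hb : (fun σ => if σ.1.card = p then b σ else 0) ∈ Ψ.chainsOfDegree 𝕜 ((p : ℤ) - 1) :=
      fun σ hσ => if_neg (by omega)
    refine ⟨_, hb, ?_⟩
    rw [← boundaryMatrix_mulVec p hb]
    ext τ
    rw [Matrix.mulVecLin_apply, Matrix.mulVec, Matrix.mulVec, dotProduct, dotProduct]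
    refine Finset.sum_congr rfl fun σ _ => ?_
    rw [boundaryMatrix]
    split_ifs <;> simp

/-- Boundary and coboundary are transposes of each other, and a matrix and its transpose have equal
rank. -/
theorem finrank_map_coboundary (p : ℕ) :
    Module.finrank 𝕜 ((Ψ.relCochains 𝕜 p).map (Ψ.coboundary 𝕜)) =
      Module.finrank 𝕜 ((Ψ.chainsOfDegree 𝕜 (((p + 1 : ℕ) : ℤ) - 1)).map (Ψ.boundary 𝕜)) := by
  classical
  have h : (LinearMap.range (Ψ.boundaryMatrix 𝕜 (p + 1)).transpose.mulVecLin).map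
      (Ψ.extendZero 𝕜) = (Ψ.relCochains 𝕜 p).map (Ψ.coboundary 𝕜) := by
    rw [← map_extendZero]
    ext γ
    constructor
    · rintro ⟨_, ⟨b, rfl⟩, rfl⟩
      have hb : (fun σ => if σ.1.card = p then b σ else 0) ∈
          Ψ.chainsOfDegree 𝕜 ((p : ℤ) - 1) := fun σ hσ => if_neg (by omega)
      refine ⟨_, ⟨_, hb, rfl⟩, ?_⟩
      rw [← extendZero_transpose_mulVec hb]
      congr 1
      ext τ
      rw [Matrix.mulVecLin_apply, Matrix.mulVec, Matrix.mulVec, dotProduct, dotProduct]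
      refine Finset.sum_congr rfl fun σ _ => ?_
      rw [Matrix.transpose_apply, boundaryMatrix]
      split_ifs with h1 h2
      · rfl
      · rw [Finset.sum_eq_zero, zero_mul, zero_mul]
        intro v hv
        rw [if_neg]
        intro h3
        rw [← h3, Finset.card_erase_of_mem hv] at h2
        omega
      · rfl
      · rw [zero_mul, zero_mul]
    · rintro ⟨_, ⟨b, hb, rfl⟩, rfl⟩
      exact ⟨_, ⟨b, rfl⟩, extendZero_transpose_mulVec hb⟩
  rw [← h, chainsOfDegree_map_boundary,
    ← (Submodule.equivMapOfInjective _ extendZero_injective _).finrank_eq]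
  exact Matrix.rank_transpose _

/-- Both sides equal the number of faces with `p` elements minus the ranks of the two adjacent
differentials, and transposition preserves these ranks. -/
theorem rBetti_eq_cohDim (p : ℕ) : Ψ.rBetti 𝕜 ((p : ℤ) - 1) = Ψ.cohDim 𝕜 p := by
  classical
  have hp : (p : ℤ) - 1 + 1 = ((p + 1 : ℕ) : ℤ) - 1 := by push_cast; ring
  have hle : Ψ.boundaries 𝕜 ((p : ℤ) - 1) ≤ Ψ.cycles 𝕜 ((p : ℤ) - 1) := by
    have hdeg : ∀ c ∈ Ψ.chainsOfDegree 𝕜 (((p + 1 : ℕ) : ℤ) - 1),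
        Ψ.boundary 𝕜 c ∈ Ψ.chainsOfDegree 𝕜 ((p : ℤ) - 1) := by
      intro c hc τ hτ
      rw [boundary_apply]
      refine Finset.sum_eq_zero fun σ _ => ?_
      by_cases h : (σ.1.card : ℤ) - 1 = ((p + 1 : ℕ) : ℤ) - 1
      · rw [Finset.sum_eq_zero, mul_zero]
        intro v hv
        rw [if_neg]
        intro h3
        have := Finset.card_erase_add_one hv
        rw [h3] at this
        push_cast at h
        omega
      · rw [hc σ h, zero_mul]
    rw [boundaries, hp]
    rintro _ ⟨c, hc, rfl⟩
    refine ⟨hdeg c hc, ?_⟩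
    change Ψ.boundary 𝕜 (Ψ.boundary 𝕜 c) = 0
    rw [← boundaryMatrix_mulVec p (hdeg c hc), ← boundaryMatrix_mulVec _ hc,
      Matrix.mulVec_mulVec, boundaryMatrix_mul, Matrix.zero_mulVec]
  have hle' : horBoundary (fun p _ => Ψ.relCochains 𝕜 p) (Ψ.coboundary 𝕜) p 0 ≤
      Ψ.relCochains 𝕜 p ⊓ LinearMap.ker (Ψ.coboundary 𝕜) := by
    rcases p with _ | p
    · exact bot_le
    · rintro _ ⟨γ, hγ, rfl⟩
      refine ⟨fun F hF => ?_, coboundary_coboundary fun F hF => (hγ F hF).2⟩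
      rw [coboundary_apply] at hF
      split_ifs at hF with h
      · obtain ⟨i, hi, hne⟩ := Finset.exists_ne_zero_of_sum_ne_zero hF
        refine ⟨?_, h⟩
        rw [← Finset.card_erase_add_one hi, (hγ _ (right_ne_zero_of_smul hne)).1]
      · exact (hF rfl).elim
  have h1 := relDim_add_finrank hle
  have h2 := relDim_add_finrank hle'
  have h3 := finrank_inf_ker_add_finrank_map (Ψ.boundary 𝕜) (Ψ.chainsOfDegree 𝕜 ((p : ℤ) - 1))
  have h4 := finrank_inf_ker_add_finrank_map (Ψ.coboundary 𝕜) (Ψ.relCochains 𝕜 p)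
  have h5 : Module.finrank 𝕜 (Ψ.relCochains 𝕜 p) =
      Module.finrank 𝕜 (Ψ.chainsOfDegree 𝕜 ((p : ℤ) - 1)) := by
    rw [← map_extendZero]
    exact (Submodule.equivMapOfInjective _ extendZero_injective _).finrank_eq.symm
  have h6 : Module.finrank 𝕜
      (horBoundary (fun p _ => Ψ.relCochains 𝕜 p) (Ψ.coboundary 𝕜) p 0) =
      Module.finrank 𝕜 ((Ψ.chainsOfDegree 𝕜 ((p : ℤ) - 1)).map (Ψ.boundary 𝕜)) := by
    rcases p with _ | p
    · rw [chainsOfDegree_map_boundary]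
      have : Ψ.boundaryMatrix 𝕜 0 = 0 := by
        ext τ σ
        rw [boundaryMatrix]
        split_ifs with h
        · rw [Finset.card_eq_zero.1 h, Finset.sum_empty]
          rfl
        · rfl
      rw [this, Matrix.mulVecLin_zero, LinearMap.range_zero, horBoundary, finrank_bot, finrank_bot]
    · exact finrank_map_coboundary p
  rw [finrank_map_coboundary] at h4
  rw [boundaries, hp] at h1
  change relDim (Ψ.cycles 𝕜 ((p : ℤ) - 1)) (Ψ.boundaries 𝕜 ((p : ℤ) - 1)) = _
  rw [boundaries, hp, cohDim]
  rw [cycles] at h1 ⊢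
  omega

end RelativeComplex

end Duality

/-! ### The Hilbert series of the face module -/

section Hilbert

theorem coeff_one_sub_X_pow_mul (ℓ e : ℕ) (H : ℤ → ℤ) (hH : ∀ s < 0, H s = 0) :
    PowerSeries.coeff e ((1 - PowerSeries.X : PowerSeries ℤ) ^ ℓ *
      PowerSeries.mk fun j : ℕ => H j) =
      ∑ q ∈ Finset.range (ℓ + 1), (-1 : ℤ) ^ q * (ℓ.choose q * H ((e : ℤ) - q)) := by
  have h : (1 - PowerSeries.X : PowerSeries ℤ) ^ ℓ =
      ∑ q ∈ Finset.range (ℓ + 1), PowerSeries.C ((-1 : ℤ) ^ q * ℓ.choose q) *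
        PowerSeries.X ^ q := by
    rw [sub_eq_neg_add, add_pow]
    refine Finset.sum_congr rfl fun q _ => ?_
    rw [neg_pow, one_pow]
    simp only [map_mul, map_pow, map_neg, map_one, map_natCast]
    ring
  rw [h, Finset.sum_mul, map_sum]
  refine Finset.sum_congr rfl fun q _ => ?_
  rw [mul_assoc, PowerSeries.coeff_C_mul, PowerSeries.coeff_X_pow_mul', mul_assoc]
  split_ifs with hq
  · rw [PowerSeries.coeff_mk, Nat.cast_sub hq]
  · rw [hH _ (by omega)]

/-- Here `PowerSeries.mk 1` is `1 / (1 - t)`, so each `i ∈ σ` contributes the series of positive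
powers of one variable. -/
theorem coeff_geometric_pow {n : ℕ} (σ : Finset (Fin n)) (j : ℕ) :
    PowerSeries.coeff j ((PowerSeries.X * PowerSeries.mk 1 : PowerSeries ℤ) ^ σ.card) =
      ((σ.finsuppAntidiag j).filter fun u => u.support = σ).card := by
  have hX : ∀ i, PowerSeries.coeff i (PowerSeries.X * PowerSeries.mk 1 : PowerSeries ℤ) =
      if i = 0 then 0 else 1 := by
    intro i
    rcases i with _ | i
    · simp
    · rw [mul_comm, PowerSeries.coeff_succ_mul_X]
      simp
  rw [← Finset.prod_const, PowerSeries.coeff_prod, Finset.card_filter, Nat.cast_sum]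
  refine Finset.sum_congr rfl fun u hu => ?_
  have hsub := (Finset.mem_finsuppAntidiag.1 hu).2
  simp only [hX]
  split_ifs with h
  · rw [Nat.cast_one]
    refine Finset.prod_eq_one fun i hi => if_neg ?_
    rwa [← h, Finsupp.mem_support_iff] at hi
  · obtain ⟨i, hi, hi'⟩ := Finset.exists_of_ssubset (hsub.ssubset_of_ne h)
    rw [Nat.cast_zero]
    exact Finset.prod_eq_zero hi (if_pos (Finsupp.notMem_support_iff.1 hi'))

namespace RelativeComplex

variable {n : ℕ} {Ψ : RelativeComplex n} {𝕜 : Type*} [Field 𝕜]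

theorem mem_faces {σ : Finset (Fin n)} : σ ∈ Ψ.faces ↔ Ψ.IsFace σ := by
  simp [faces]

theorem finrank_component_eq_sum (j : ℕ) : Module.finrank 𝕜 (Ψ.component 𝕜 j) =
    ∑ σ ∈ Ψ.faces, ((σ.finsuppAntidiag j).filter fun u => u.support = σ).card := by
  classical
  let e : {a : Fin n → ℤ // Ψ.Adm ∅ a ∧ ∑ i, a i = (j : ℤ)} ≃
      {u // u ∈ (Finset.univ.finsuppAntidiag j).filter
        fun u : Fin n →₀ ℕ => u.support ∈ Ψ.faces} :=
    { toFun := fun a => ⟨natExp a.1, by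
        obtain ⟨h0, h⟩ := adm_empty_iff.1 a.2.1
        rw [Finset.mem_filter, Finset.mem_finsuppAntidiag]
        refine ⟨⟨?_, Finset.subset_univ _⟩, mem_faces.2 h⟩
        have := a.2.2
        rw [← toExp_natExp h0] at this
        simp only [toExp] at this
        exact_mod_cast this⟩
      invFun := fun u => ⟨toExp u.1, by
        have hu := u.2
        rw [Finset.mem_filter, Finset.mem_finsuppAntidiag] at hu
        refine ⟨adm_empty_iff.2 ⟨fun i => Int.natCast_nonneg _, ?_⟩, ?_⟩
        · rw [natExp_toExp]
          exact mem_faces.1 hu.2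
        · have h := congrArg (Nat.cast : ℕ → ℤ) hu.1.1
          rwa [Nat.cast_sum] at h⟩
      left_inv := fun a => Subtype.ext (toExp_natExp (adm_empty_iff.1 a.2.1).1)
      right_inv := fun u => Subtype.ext (natExp_toExp _) }
  rw [finrank_component, finrank_homog, Nat.card_congr e, Nat.card_eq_fintype_card,
    Fintype.card_coe, Finset.card_eq_sum_card_fiberwise (s := (Finset.univ.finsuppAntidiag j).filter
      fun u : Fin n →₀ ℕ => u.support ∈ Ψ.faces) (f := fun u : Fin n →₀ ℕ => u.support)
      (t := Ψ.faces) (fun u hu => (Finset.mem_filter.1 hu).2)]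
  refine Finset.sum_congr rfl fun σ hσ => congrArg Finset.card ?_
  ext u
  simp only [Finset.mem_filter, Finset.mem_finsuppAntidiag]
  constructor
  · rintro ⟨⟨⟨h1, _⟩, _⟩, rfl⟩
    refine ⟨⟨?_, subset_rfl⟩, rfl⟩
    rw [← h1]
    exact Finset.sum_subset (Finset.subset_univ _) fun i _ hi => Finsupp.notMem_support_iff.1 hi
  · rintro ⟨⟨h1, _⟩, rfl⟩
    refine ⟨⟨⟨?_, Finset.subset_univ _⟩, hσ⟩, rfl⟩
    rw [← h1]
    symm
    exact Finset.sum_subset (Finset.subset_univ _) fun i _ hi => Finsupp.notMem_support_iff.1 hi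

/-- The h-polynomial is the numerator of the Hilbert series of the face module. -/
theorem one_sub_X_pow_mul_hilbertSeries :
    (1 - PowerSeries.X : PowerSeries ℤ) ^ Ψ.maxCard * hilbertSeries (Ψ.component 𝕜) =
      (Ψ.hPolynomial : PowerSeries ℤ) := by
  classical
  have hle : ∀ σ ∈ Ψ.faces, σ.card ≤ Ψ.maxCard := fun σ hσ => Finset.le_sup hσ
  -- Sorted by support, the monomial basis contributes `(t / (1 - t)) ^ |σ|` for each face `σ`.
  have h1 : hilbertSeries (Ψ.component 𝕜) =
      ∑ σ ∈ Ψ.faces, (PowerSeries.X * PowerSeries.mk 1 : PowerSeries ℤ) ^ σ.card := by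
    ext j
    rw [hilbertSeries, PowerSeries.coeff_mk, finrank_component_eq_sum, map_sum, Nat.cast_sum]
    exact Finset.sum_congr rfl fun σ _ => (coeff_geometric_pow σ j).symm
  have h2 : (Ψ.hPolynomial : PowerSeries ℤ) = ∑ i ∈ Finset.range (Ψ.maxCard + 1),
      PowerSeries.C (Ψ.numFaces i : ℤ) * PowerSeries.X ^ i *
        (1 - PowerSeries.X) ^ (Ψ.maxCard - i) := by
    rw [hPolynomial, ← Polynomial.coeToPowerSeries.ringHom_apply, map_sum]
    refine Finset.sum_congr rfl fun i _ => ?_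
    rw [Polynomial.coeToPowerSeries.ringHom_apply]
    push_cast
    rfl
  rw [h1, h2, Finset.mul_sum, ← Finset.sum_fiberwise_of_maps_to (g := Finset.card)
    (t := Finset.range (Ψ.maxCard + 1)) fun σ hσ => Finset.mem_range_succ_iff.2 (hle σ hσ)]
  refine Finset.sum_congr rfl fun i hi => ?_
  have hi' := Finset.mem_range_succ_iff.1 hi
  rw [numFaces, Finset.sum_congr rfl (g := fun _ => (PowerSeries.X : PowerSeries ℤ) ^ i *
    (1 - PowerSeries.X) ^ (Ψ.maxCard - i))]
  · rw [Finset.sum_const, nsmul_eq_mul, ← mul_assoc]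
    congr 2
  · intro σ hσ
    rw [(Finset.mem_filter.1 hσ).2, mul_pow]
    have h3 : (PowerSeries.mk 1 : PowerSeries ℤ) ^ i * (1 - PowerSeries.X) ^ i = 1 := by
      rw [← mul_pow, PowerSeries.mk_one_mul_one_sub_eq_one, one_pow]
    calc (1 - PowerSeries.X : PowerSeries ℤ) ^ Ψ.maxCard *
          (PowerSeries.X ^ i * PowerSeries.mk 1 ^ i) =
        (1 - PowerSeries.X : PowerSeries ℤ) ^ (Ψ.maxCard - i + i) *
          (PowerSeries.X ^ i * PowerSeries.mk 1 ^ i) := by rw [Nat.sub_add_cancel hi']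
      _ = PowerSeries.X ^ i * (1 - PowerSeries.X) ^ (Ψ.maxCard - i) *
          ((PowerSeries.mk 1 : PowerSeries ℤ) ^ i * (1 - PowerSeries.X) ^ i) := by
        rw [pow_add]
        ring
      _ = _ := by rw [h3, mul_one]

theorem hilbertSeries_component :
    hilbertSeries (Ψ.component 𝕜) =
      PowerSeries.mk fun j : ℕ => (fun s : ℤ => (Module.finrank 𝕜 (Ψ.homog 𝕜 s) : ℤ)) j := by
  rw [hilbertSeries]
  congr
  ext j
  rw [finrank_component]

end RelativeComplex

end Hilbert

/-! ### Dimension of the face module and powers of parameters -/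

section Dimension

namespace RelativeComplex

variable {n : ℕ} (Ψ : RelativeComplex n) (𝕜 : Type*) [Field 𝕜]

instance : Module.Finite (MvPolynomial (Fin n) 𝕜) (Ψ.faceModule 𝕜) := by
  have : IsNoetherian (MvPolynomial (Fin n) 𝕜) (faceRing 𝕜 Ψ.Δ) :=
    isNoetherian_of_isNoetherianRing_of_finite _ _
  exact Module.IsNoetherian.finite _ _

/-- The prime ideal generated by the variables outside of `σ`. -/
def facePrime (σ : Finset (Fin n)) : Ideal (MvPolynomial (Fin n) 𝕜) :=
  RingHom.ker (killCompl (R := 𝕜) (Subtype.val_injective (p := (· ∈ σ)))).toRingHom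

variable {𝕜}

/-- As the kernel of a surjection, the ideal has as quotient the polynomial ring in the variables of
`σ`. -/
theorem krullDim_zeroLocus_facePrime (σ : Finset (Fin n)) :
    Order.krullDim (PrimeSpectrum.zeroLocus (facePrime 𝕜 σ : Set (MvPolynomial (Fin n) 𝕜))) =
      (σ.card : WithBot ℕ∞) := by
  rw [← ringKrullDim_quotient, facePrime, ringKrullDim_eq_of_ringEquiv
    (RingHom.quotientKerEquivOfSurjective (f := (killCompl (R := 𝕜)
      (Subtype.val_injective (p := (· ∈ σ)))).toRingHom)
      fun p => ⟨rename _ p, killCompl_rename_app _ p⟩),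
    MvPolynomial.ringKrullDim_of_isNoetherianRing, ringKrullDim_eq_zero_of_field, zero_add,
    Nat.card_eq_fintype_card, Fintype.card_coe]

theorem killCompl_X_of_mem {σ : Finset (Fin n)} {i : Fin n} (hi : i ∈ σ) :
    killCompl (R := 𝕜) (Subtype.val_injective (p := (· ∈ σ))) (X i) = X ⟨i, hi⟩ := by
  have := killCompl_rename_app (R := 𝕜) (Subtype.val_injective (p := (· ∈ σ))) (X ⟨i, hi⟩)
  rwa [rename_X] at this

theorem killCompl_X_of_notMem {σ : Finset (Fin n)} {i : Fin n} (hi : i ∉ σ) :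
    killCompl (R := 𝕜) (Subtype.val_injective (p := (· ∈ σ))) (X i) = 0 := by
  rw [killCompl, aeval_X, dif_neg]
  rintro ⟨⟨j, hj⟩, rfl⟩
  exact hi hj

/-- Modulo `p`, setting the variables outside `σ` to zero changes nothing. -/
theorem facePrime_le {σ : Finset (Fin n)} {p : Ideal (MvPolynomial (Fin n) 𝕜)}
    (h : ∀ i ∉ σ, (X i : MvPolynomial (Fin n) 𝕜) ∈ p) : facePrime 𝕜 σ ≤ p := by
  have key : (Ideal.Quotient.mkₐ 𝕜 p).comp ((rename (Subtype.val : σ → Fin n)).comp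
      (killCompl (R := 𝕜) (Subtype.val_injective (p := (· ∈ σ))))) = Ideal.Quotient.mkₐ 𝕜 p := by
    refine algHom_ext fun i => ?_
    rw [AlgHom.comp_apply, AlgHom.comp_apply]
    by_cases hi : i ∈ σ
    · rw [killCompl_X_of_mem hi, rename_X]
    · rw [killCompl_X_of_notMem hi, map_zero, map_zero]
      exact (Ideal.Quotient.eq_zero_iff_mem.2 (h i hi)).symm
  intro r hr
  have hr' : killCompl (R := 𝕜) (Subtype.val_injective (p := (· ∈ σ))) r = 0 := hr
  rw [← Ideal.Quotient.eq_zero_iff_mem]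
  have := AlgHom.congr_fun key r
  rw [AlgHom.comp_apply, AlgHom.comp_apply, hr', map_zero, map_zero] at this
  exact this.symm

variable {Ψ}

/-- The class of `x^σ` has its annihilator inside `facePrime 𝕜 σ`: setting the variables outside `σ`
to zero kills the face ideal of `Δ` and sends `x^σ` to a nonzero element of a domain. -/
theorem zeroLocus_facePrime_subset {σ : Finset (Fin n)} (hσ : Ψ.IsFace σ) :
    PrimeSpectrum.zeroLocus (facePrime 𝕜 σ : Set (MvPolynomial (Fin n) 𝕜)) ⊆
      Module.support (MvPolynomial (Fin n) 𝕜) (Ψ.faceModule 𝕜) := by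
  intro p hp
  have hm : Ideal.Quotient.mk (faceIdeal 𝕜 Ψ.Δ) (∏ i ∈ σ, X i) ∈ Ψ.faceModule 𝕜 :=
    (mem_faceModule_iff _).2 (Ideal.subset_span ⟨σ, hσ.2, rfl⟩)
  rw [Module.mem_support_iff']
  refine ⟨⟨_, hm⟩, fun r hr h => hr (hp ?_)⟩
  have h' : r * ∏ i ∈ σ, X i ∈ faceIdeal 𝕜 Ψ.Δ := by
    rw [← Ideal.Quotient.eq_zero_iff_mem]
    exact congrArg Subtype.val h
  have hle : faceIdeal 𝕜 Ψ.Δ ≤ facePrime 𝕜 σ := by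
    rw [faceIdeal, Ideal.span_le]
    rintro _ ⟨τ, hτ, rfl⟩
    obtain ⟨i, hi, hi'⟩ := Finset.not_subset.1 fun h => hτ (Ψ.Δ.lower h hσ.1)
    change killCompl (R := 𝕜) (Subtype.val_injective (p := (· ∈ σ))) _ = 0
    rw [map_prod]
    exact Finset.prod_eq_zero hi (killCompl_X_of_notMem hi')
  have h0 : killCompl (R := 𝕜) (Subtype.val_injective (p := (· ∈ σ))) (r * ∏ i ∈ σ, X i) = 0 :=
    hle h'
  rw [map_mul, map_prod, mul_eq_zero] at h0
  refine h0.resolve_right (Finset.prod_ne_zero_iff.2 fun i hi => ?_)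
  rw [killCompl_X_of_mem hi]
  exact X_ne_zero _

/-- If the variables not in `p` were contained in no face, their product would annihilate the face
module while lying outside `p`. -/
theorem exists_facePrime_le {p : PrimeSpectrum (MvPolynomial (Fin n) 𝕜)}
    (hp : p ∈ Module.support (MvPolynomial (Fin n) 𝕜) (Ψ.faceModule 𝕜)) :
    ∃ σ, Ψ.IsFace σ ∧ facePrime 𝕜 σ ≤ p.asIdeal := by
  classical
  obtain ⟨m, hm⟩ := Module.mem_support_iff'.1 hp
  let F : Finset (Fin n) := Finset.univ.filter fun i => (X i : MvPolynomial (Fin n) 𝕜) ∉ p.asIdeal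
  by_contra! hno
  have hF : ∀ σ, Ψ.IsFace σ → ¬ F ⊆ σ := fun σ hσ hsub => hno σ hσ (facePrime_le fun i hi => by
    by_contra h
    exact hi (hsub (Finset.mem_filter.2 ⟨Finset.mem_univ i, h⟩)))
  refine hm (∏ i ∈ F, X i) (fun h => ?_) (toLaurent_injective ?_)
  · rw [Ideal.IsPrime.prod_mem_iff] at h
    obtain ⟨i, hi, h⟩ := h
    exact (Finset.mem_filter.1 hi).2 h
  · have h1 := toLaurent_prod_X_pow_smul F 1 m
    simp only [pow_one, one_smul] at h1
    rw [h1, map_zero]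
    ext a
    rw [shiftCut_apply, Finsupp.zero_apply, ite_eq_right_iff]
    intro ha
    by_contra hne
    refine hF _ ha.2 fun i hi => ?_
    rw [Finset.empty_union, mem_suppSet]
    have h2 := (toLaurent_mem m _ hne).1 i (Finset.notMem_empty i)
    rw [Pi.sub_apply, indVec_of_mem hi] at h2
    omega

/-- The support is the union of the coordinate subspaces of the faces; a chain of primes in it stays
in the subspace that contains its smallest member. -/
theorem supportDim_faceModule :
    Module.supportDim (MvPolynomial (Fin n) 𝕜) (Ψ.faceModule 𝕜) = (Ψ.maxCard : WithBot ℕ∞) := by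
  classical
  apply le_antisymm
  · rw [Module.supportDim, Order.krullDim]
    refine iSup_le fun s => ?_
    obtain ⟨σ, hσ, hle⟩ := exists_facePrime_le s.head.2
    have hs : ∀ i, (s i).1 ∈
        PrimeSpectrum.zeroLocus (facePrime 𝕜 σ : Set (MvPolynomial (Fin n) 𝕜)) := fun i =>
      hle.trans (show s.head.1.asIdeal ≤ (s i).1.asIdeal from LTSeries.head_le s i)
    let t : LTSeries (PrimeSpectrum.zeroLocus (facePrime 𝕜 σ : Set (MvPolynomial (Fin n) 𝕜))) :=
      { length := s.length
        toFun := fun i => ⟨(s i).1, hs i⟩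
        step := fun i => s.step i }
    have h1 : (t.length : WithBot ℕ∞) ≤ Order.krullDim (PrimeSpectrum.zeroLocus
        (facePrime 𝕜 σ : Set (MvPolynomial (Fin n) 𝕜))) :=
      le_iSup (fun t : LTSeries _ => (t.length : WithBot ℕ∞)) t
    rw [krullDim_zeroLocus_facePrime] at h1
    refine h1.trans ?_
    have h2 : σ.card ≤ Ψ.maxCard := Finset.le_sup (mem_faces.2 hσ)
    exact_mod_cast h2
  · have hne : Ψ.faces.Nonempty := by
      by_contra hemp
      rw [Finset.not_nonempty_iff_eq_empty] at hemp
      refine Ψ.proper.not_ge fun σ hσ => ?_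
      by_contra hσ'
      exact Finset.notMem_empty σ (hemp ▸ mem_faces.2 ⟨hσ, hσ'⟩)
    obtain ⟨σ, hσ, h⟩ := Finset.exists_mem_eq_sup _ hne Finset.card
    rw [maxCard, h, ← krullDim_zeroLocus_facePrime (𝕜 := 𝕜) σ]
    exact Order.krullDim_le_of_strictMono
      (Set.inclusion (zeroLocus_facePrime_subset (mem_faces.1 hσ))) fun _ _ h => h

end RelativeComplex

end Dimension

/-! ### Powers of parameters and the Buchsbaum property. -/

section Powers

variable {𝕜 : Type*} [Field 𝕜] {n ℓ : ℕ} {M : Type*} [AddCommGroup M]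
  [Module (MvPolynomial (Fin n) 𝕜) M] {Θ : Fin ℓ → MvPolynomial (Fin n) 𝕜}

/-- Powers of a homogeneous system of parameters form a homogeneous system of parameters. -/
theorem IsHSOP.pow [Module.Finite (MvPolynomial (Fin n) 𝕜) M] (h : IsHSOP M Θ) (a : Fin ℓ → ℕ) :
    IsHSOP M fun i => Θ i ^ (a i + 1) := by
  refine ⟨⟨fun i => ?_, ?_⟩, h.2⟩
  · obtain ⟨m, hm⟩ := h.1.1 i
    exact ⟨_, hm.pow _⟩
  · rw [← h.1.2]
    congr 1
    -- The dimension of `M / Θ M` depends only on the zero locus of `Θ` in the support of `M`, and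
    -- powers do not change that locus.
    have : PrimeSpectrum.zeroLocus (Ideal.span (Set.range fun i => Θ i ^ (a i + 1)) :
        Set (MvPolynomial (Fin n) 𝕜)) = PrimeSpectrum.zeroLocus (Ideal.span (Set.range Θ)) := by
      rw [PrimeSpectrum.zeroLocus_span, PrimeSpectrum.zeroLocus_span]
      ext p
      simp only [PrimeSpectrum.mem_zeroLocus, Set.range_subset_iff, SetLike.mem_coe]
      exact forall_congr' fun i => p.2.pow_mem_iff_mem _ (Nat.succ_pos _)
    rw [Module.supportDim, Module.supportDim, paramSubmodule, paramSubmodule,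
      Module.support_quotient, Module.support_quotient, this]

theorem IsBuchsbaumModule.smul_mem [Module.Finite (MvPolynomial (Fin n) 𝕜) M]
    (hB : IsBuchsbaumModule (𝕜 := 𝕜) (n := n) M) (h : IsHSOP M Θ) (a : Fin ℓ → ℕ) (i : Fin ℓ)
    {m : M} (hm : Θ i ^ (a i + 1) • m ∈ initialSubmodule M (fun i => Θ i ^ (a i + 1)) i)
    (l : Fin n) : (X l : MvPolynomial (Fin n) 𝕜) • m ∈
      initialSubmodule M (fun i => Θ i ^ (a i + 1)) i := by
  have hw := (hB ℓ _ (h.pow a)).2 i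
  have hm' : m ∈ colonSubmodule (initialSubmodule M (fun i => Θ i ^ (a i + 1)) i)
      {Θ i ^ (a i + 1)} := by
    rintro _ rfl
    exact hm
  rw [hw] at hm'
  exact hm' _ (Ideal.subset_span ⟨l, rfl⟩)

theorem mem_span_range_X {θ : MvPolynomial (Fin n) 𝕜} (hθ : θ.IsHomogeneous 1) :
    θ ∈ Ideal.span (Set.range (X : Fin n → MvPolynomial (Fin n) 𝕜)) := by
  rw [RelativeComplex.linear_form_eq_sum hθ]
  refine Ideal.sum_mem _ fun i _ => ?_
  rw [← C_mul_X_eq_monomial]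
  exact Ideal.mul_mem_left _ _ (Ideal.subset_span ⟨i, rfl⟩)

/-- Every vector of exponents gives a system of parameters, hence a weak sequence. The exponents may
therefore be prescribed one after another, each choice leaving the preceding ones untouched. -/
theorem IsBuchsbaumModule.hasWeakParameters [Module.Finite (MvPolynomial (Fin n) 𝕜) M]
    (hB : IsBuchsbaumModule (𝕜 := 𝕜) (n := n) M) (h : IsLSOP M Θ) :
    HasWeakParameters (X : Fin n → MvPolynomial (Fin n) 𝕜) ℓ
      (⊥ : Submodule (MvPolynomial (Fin n) 𝕜) M) := by
  have key : ∀ r i, i + r = ℓ → ∀ a : Fin ℓ → ℕ,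
      HasWeakParameters (X : Fin n → MvPolynomial (Fin n) 𝕜) r
        (Ideal.span ((fun j => Θ j ^ (a j + 1)) '' {j | j.1 < i}) • ⊤ :
          Submodule (MvPolynomial (Fin n) 𝕜) M) := by
    intro r
    induction r with
    | zero => exact fun _ _ _ => trivial
    | succ r ih =>
      intro i hi a
      let k : Fin ℓ := ⟨i, by omega⟩
      refine ⟨Θ k, mem_span_range_X (h.2 k), fun t => ?_⟩
      let b : Fin ℓ → ℕ := Function.update a k t
      have hbk : b k = t := Function.update_self ..
      have hb : (fun j => Θ j ^ (a j + 1)) '' {j | j.1 < i} =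
          (fun j => Θ j ^ (b j + 1)) '' {j | j.1 < i} := by
        refine Set.image_congr fun j hj => ?_
        have hjk : j ≠ k := fun e => by
          rw [e] at hj
          exact lt_irrefl i hj
        simp only [b, Function.update_of_ne hjk]
      rw [hb]
      constructor
      · intro m hm l
        rw [← hbk] at hm
        exact hB.smul_mem h.1 b k hm l
      · have := ih (i + 1) (by omega) b
        convert this using 1
        have hset : {j : Fin ℓ | j.1 < i + 1} = insert k {j : Fin ℓ | j.1 < i} := by
          ext j
          simp only [Set.mem_ofPred_eq, Set.mem_insert_iff, Fin.ext_iff, k]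
          omega
        rw [hset, Set.image_insert_eq, Ideal.span_insert, Submodule.sup_smul,
          Submodule.ideal_span_singleton_smul, hbk, sup_comm]
        congr 1
        exact LinearMap.range_eq_map _
  have h0 := key ℓ 0 (Nat.zero_add ℓ) fun _ => 0
  simpa using h0

end Powers

end RelativeSR

end

/-! ### The relative Schenzel formula. -/

theorem mainTheorem6 {𝕜 : Type*} [Field 𝕜] [Infinite 𝕜] {n : ℕ}
    (Ψ : RelativeSR.RelativeComplex n) (d : ℕ) (hd : Ψ.dim = (d : ℤ) - 1)
    (hB : Ψ.IsBuchsbaum 𝕜) {ℓ : ℕ} (Θ : Fin ℓ → MvPolynomial (Fin n) 𝕜)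
    (hΘ : RelativeSR.IsLSOP (Ψ.faceModule 𝕜) Θ) :
    ((1 - PowerSeries.X : PowerSeries ℤ) ^ d * RelativeSR.hilbertSeries (Ψ.component 𝕜) =
      RelativeSR.hilbertSeries (Ψ.quotientComponent Θ) +
        ∑ j ∈ Finset.Icc 1 d,
          PowerSeries.C ((d.choose j : ℤ) *
            ∑ i ∈ Finset.range j, (-1 : ℤ) ^ (j - i) * (Ψ.rBetti 𝕜 ((i : ℤ) - 1) : ℤ)) *
            PowerSeries.X ^ j) ∧
    ∀ k : ℕ, Ψ.hNumber k = Ψ.hAlg Θ k +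
      (d.choose k : ℤ) *
        ∑ i ∈ Finset.range k, (-1 : ℤ) ^ (k - i) * (Ψ.rBetti 𝕜 ((i : ℤ) - 1) : ℤ) := by
  have hd' : Ψ.maxCard = d := by
    rw [RelativeSR.RelativeComplex.dim] at hd
    omega
  have hℓ : ℓ = d := by
    have h := hΘ.1.2
    rw [RelativeSR.RelativeComplex.supportDim_faceModule, hd'] at h
    exact_mod_cast h
  subst hℓ
  -- Both forms of the formula are read off from this identity of coefficients.
  have key : ∀ k : ℕ, PowerSeries.coeff k ((1 - PowerSeries.X : PowerSeries ℤ) ^ ℓ *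
      RelativeSR.hilbertSeries (Ψ.component 𝕜)) = Ψ.hAlg Θ k + (ℓ.choose k : ℤ) *
        ∑ i ∈ Finset.range k, (-1 : ℤ) ^ (k - i) * (Ψ.rBetti 𝕜 ((i : ℤ) - 1) : ℤ) := by
    intro k
    rw [RelativeSR.RelativeComplex.hilbertSeries_component,
      RelativeSR.coeff_one_sub_X_pow_mul ℓ k (fun s => Module.finrank 𝕜 (Ψ.homog 𝕜 s)) fun s hs => by
        rw [RelativeSR.RelativeComplex.finrank_homog_of_neg hs, Nat.cast_zero]]
    simp only [RelativeSR.RelativeComplex.rBetti_eq_cohDim]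
    refine RelativeSR.RelativeComplex.sum_choose_mul_finrank hΘ.2 (fun i m hm l => ?_)
      (RelativeSR.IsBuchsbaumModule.hasWeakParameters hB hΘ) k
    have := RelativeSR.IsBuchsbaumModule.smul_mem hB hΘ.1 (fun _ => 0) i (m := m)
    simp only [zero_add, pow_one] at this
    exact this hm l
  refine ⟨?_, fun k => ?_⟩
  · ext k
    rw [key, map_add, RelativeSR.hilbertSeries, PowerSeries.coeff_mk, map_sum]
    simp only [PowerSeries.coeff_C_mul, PowerSeries.coeff_X_pow, mul_ite, mul_one, mul_zero]
    rw [Finset.sum_ite_eq]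
    congr 1
    -- Outside `1 ≤ k ≤ ℓ` the correction vanishes: the inner sum is empty for `k = 0`, and the
    -- binomial coefficient is zero for `k > ℓ`.
    split_ifs with hk
    · rfl
    · rw [Finset.mem_Icc, not_and_or] at hk
      rcases hk with hk | hk
      · rw [show k = 0 by omega, Finset.range_zero, Finset.sum_empty, mul_zero]
      · rw [Nat.choose_eq_zero_of_lt (by omega), Nat.cast_zero, zero_mul]
  · rw [← key, ← hd', RelativeSR.RelativeComplex.one_sub_X_pow_mul_hilbertSeries,
      Polynomial.coeff_coe]
    rfl
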